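/- Let $\mathbb{T}=\mathbb{R}/2\pi\mathbb{Z}$. For $l\in\mathbb{Z}\setminus\{0\}$ and $\alpha\in\mathbb{R}$ define in the complex Hilbert space $L^2(\mathbb{T})$ the operators \[ A_l=\partial_y^2-l^2,\quad D(A_l)=W^{2,2}(\mathbb{T}),\qquad \hat\Lambda_l=M_{\sin y}(I+A_l^{-1}),\quad D(\hat\Lambda_l)=L^2(\mathbb{T}),\qquad L_{\alpha,l}=A_l-i\alpha l\,\hat\Lambda_l,\quad D(L_{\alpha,l})=W^{2,2}(\mathbb{T}), \] where $M_{\sin y}$ is multiplication by $\sin y$. Let $Y_l=\{f\in L^2(\mathbb{T}) : \int_0^{2\pi} f\,dy=0\}$ if $l=\pm1$ and $Y_l=L^2(\mathbb{T})$ if $|l|\ge 2$, let $\mathbb{Q}_l$ be the orthogonal projection of $L^2(\mathbb{T})$ onto $Y_l$, and regard $\mathbb{Q}_lL_{\alpha,l}$ as an operator in $Y_l$ with domain $W^{2,2}(\mathbb{T})\cap Y_l$. There exist constants $c,C,\alpha_0>0$ such that for all $\alpha\in\mathbb{R}$ with $|\alpha|\ge\alpha_0$ and all $l\in\mathbb{Z}\setminus\{0\}$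 the following holds. Every $\zeta$ in the spectrum $\sigma(\mathbb{Q}_lL_{\alpha,l})$ satisfies \[ \operatorname{Re}\zeta\le -c\,|\alpha l|^{1/2}. \] Moreover, for every $\lambda\in\mathbb{R}$, with $\mu=\lambda/(\alpha l)$, the operator $i\lambda+\mathbb{Q}_lL_{\alpha,l}$ has a bounded inverse on $Y_l$, and \[ \|(i\lambda+\mathbb{Q}_lL_{\alpha,l})^{-1}\|_{Y_l\to Y_l}\le \begin{cases} \dfrac{C}{|\alpha l|\,(|\mu|-1)} & \text{if } |\mu|>1+|\alpha l|^{-1/2},\\[2mm] \dfrac{C}{|\alpha l|^{1/2}} & \text{if } 1-|\alpha l|^{-1/2}<|\mu|\le 1+|\alpha l|^{-1/2},\\[2mm] \dfrac{C}{|\alpha l|^{2/3}(1-|\mu|)^{1/3}} & \text{if } |\mu|\le 1-|\alpha l|^{-1/2}. \end{cases} \] -/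

import Mathlib

open MeasureTheory

noncomputable section

namespace Kolmogorov

/-! ### Bounded inverses and spectrum of an unbounded operator -/

section Unbounded

variable {E : Type*} [NormedAddCommGroup E] [NormedSpace ℂ E]

/-- `R` is the bounded, everywhere defined, two-sided inverse of the unbounded operator `S`. -/
def IsBoundedInverse (S : E →ₗ.[ℂ] E) (R : E →L[ℂ] E) : Prop :=
  (∀ f : E, ∃ h : R f ∈ S.domain, S ⟨R f, h⟩ = f) ∧ ∀ u : S.domain, R (S u) = u

/-- The operator `z + S` with domain `D(S)`. -/
def shift (z : ℂ) (S : E →ₗ.[ℂ] E) : E →ₗ.[ℂ] E :=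
  (z • (LinearMap.id : E →ₗ[ℂ] E)) +ᵥ S

/-- The spectrum of `S`: all `ζ` for which `ζ - S` has no bounded everywhere defined inverse. -/
def opSpectrum (S : E →ₗ.[ℂ] E) : Set ℂ :=
  {ζ | ¬ ∃ R : E →L[ℂ] E, IsBoundedInverse (shift ζ (-S)) R}

end Unbounded

/-! ### The torus and its Lebesgue space -/

instance factTwoPiPos : Fact (0 < 2 * Real.pi) := ⟨Real.two_pi_pos⟩

/-- The torus `𝕋 = ℝ / 2πℤ`. -/
abbrev Torus : Type := AddCircle (2 * Real.pi)

/-- The normalized measure `dy / 2π` on `𝕋`; the normalization does not affect operator norms. -/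
abbrev torusMeasure : Measure Torus := AddCircle.haarAddCircle

/-- The complex Hilbert space `L²(𝕋)`. -/
abbrev L2T : Type := Lp ℂ 2 torusMeasure

lemma integrable_mul (f : L2T) (ψ : C(Torus, ℂ)) :
    Integrable (fun y => f y * ψ y) torusMeasure := by
  have hf : Integrable f torusMeasure := (Lp.memLp f).integrable (by norm_num)
  exact hf.mul_bdd (c := ‖ψ‖) ψ.continuous.aestronglyMeasurable
    (Filter.Eventually.of_forall fun y => ψ.norm_coe_le_norm y)

/-! ### Weak derivatives and the operator `A_l` -/

/-- `g` is the weak derivative of `f`: `∫ f φ' = - ∫ g φ` for every smooth `φ` on `𝕋`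
(here `ψ` is the derivative of `φ`). -/
def IsWeakDeriv (f g : L2T) : Prop :=
  ∀ φ ψ : C(Torus, ℂ),
    ContDiff ℝ (⊤ : ℕ∞) (fun x : ℝ => φ (x : Torus)) →
    (∀ x : ℝ, HasDerivAt (fun x : ℝ => φ (x : Torus)) (ψ (x : Torus)) x) →
    ∫ y, f y * ψ y ∂torusMeasure = - ∫ y, g y * φ y ∂torusMeasure

lemma integral_add_mul (f g : L2T) (ψ : C(Torus, ℂ)) :
    ∫ y, (f + g : L2T) y * ψ y ∂torusMeasure =
      ∫ y, f y * ψ y ∂torusMeasure + ∫ y, g y * ψ y ∂torusMeasure := by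
  rw [← integral_add (integrable_mul f ψ) (integrable_mul g ψ)]
  refine integral_congr_ae ?_
  filter_upwards [Lp.coeFn_add f g] with y hy
  rw [hy, Pi.add_apply, add_mul]

lemma integral_smul_mul (c : ℂ) (f : L2T) (ψ : C(Torus, ℂ)) :
    ∫ y, (c • f : L2T) y * ψ y ∂torusMeasure = c * ∫ y, f y * ψ y ∂torusMeasure := by
  rw [← integral_const_mul]
  refine integral_congr_ae ?_
  filter_upwards [Lp.coeFn_smul c f] with y hy
  rw [hy, Pi.smul_apply, smul_eq_mul, mul_assoc]

lemma IsWeakDeriv.add {f g f' g' : L2T} (h : IsWeakDeriv f g) (h' : IsWeakDeriv f' g') :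
    IsWeakDeriv (f + f') (g + g') := by
  intro φ ψ hφ hψ
  rw [integral_add_mul, integral_add_mul, h φ ψ hφ hψ, h' φ ψ hφ hψ]
  ring

lemma IsWeakDeriv.smul (c : ℂ) {f g : L2T} (h : IsWeakDeriv f g) :
    IsWeakDeriv (c • f) (c • g) := by
  intro φ ψ hφ hψ
  rw [integral_smul_mul, integral_smul_mul, h φ ψ hφ hψ]
  ring

lemma integral_zero_mul (ψ : C(Torus, ℂ)) : ∫ y, (0 : L2T) y * ψ y ∂torusMeasure = 0 := by
  have h := integral_smul_mul 0 0 ψ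
  rwa [smul_zero, zero_mul] at h

lemma IsWeakDeriv.zero : IsWeakDeriv 0 0 := by
  intro φ ψ _ _
  rw [integral_zero_mul, integral_zero_mul, neg_zero]

lemma eq_zero_of_integral_fourier {g : L2T}
    (h : ∀ n : ℤ, ∫ y, g y * fourier n y ∂torusMeasure = 0) : g = 0 := by
  apply (fourierBasis (T := 2 * Real.pi)).repr.injective
  ext n
  rw [fourierBasis_repr, map_zero, fourierCoeff]
  simpa [mul_comm] using h (-n)

lemma hasDerivAt_fourier_torus (n : ℤ) (x : ℝ) :
    HasDerivAt (fun x : ℝ => (fourier n : C(Torus, ℂ)) (x : Torus))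
      (((Complex.I * n) • (fourier n : C(Torus, ℂ))) (x : Torus)) x := by
  have h := hasDerivAt_fourier (2 * Real.pi) n x
  convert h using 1
  have : (Real.pi : ℂ) ≠ 0 := by exact_mod_cast Real.pi_ne_zero
  simp only [ContinuousMap.smul_apply, smul_eq_mul]
  push_cast
  field_simp

lemma contDiff_fourier_torus (n : ℤ) :
    ContDiff ℝ (⊤ : ℕ∞) (fun x : ℝ => (fourier n : C(Torus, ℂ)) (x : Torus)) := by
  have : (fun x : ℝ => (fourier n : C(Torus, ℂ)) (x : Torus)) =
      fun x : ℝ => Complex.exp (2 * Real.pi * Complex.I * n * x / (2 * Real.pi : ℝ)) := by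
    funext x
    rw [fourier_coe_apply]
  rw [this]
  exact Complex.contDiff_exp.comp
    ((contDiff_const.mul Complex.ofRealCLM.contDiff).div_const _)

/-- Weak derivatives are unique. -/
lemma IsWeakDeriv.eq_zero {g : L2T} (h : IsWeakDeriv 0 g) : g = 0 := by
  refine eq_zero_of_integral_fourier fun n => ?_
  have h1 := h _ _ (contDiff_fourier_torus n) (hasDerivAt_fourier_torus n)
  rw [integral_zero_mul] at h1
  exact neg_eq_zero.mp h1.symm

/-- The graph of `A_l = ∂_y² - l²` with domain `W^{2,2}(𝕋)`: the pairs `(u, u'' - l² u)` such that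
`u ∈ L²` has weak derivatives `u', u'' ∈ L²`. -/
def graphA (l : ℤ) : Submodule ℂ (L2T × L2T) where
  carrier := {p | ∃ u' u'' : L2T, IsWeakDeriv p.1 u' ∧ IsWeakDeriv u' u'' ∧
    p.2 = u'' - ((l : ℂ) ^ 2) • p.1}
  zero_mem' := ⟨0, 0, IsWeakDeriv.zero, IsWeakDeriv.zero, by simp⟩
  add_mem' := by
    rintro p q ⟨u', u'', h1, h2, h3⟩ ⟨v', v'', k1, k2, k3⟩
    refine ⟨u' + v', u'' + v'', h1.add k1, h2.add k2, ?_⟩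
    rw [Prod.snd_add, Prod.fst_add, h3, k3, smul_add]
    abel
  smul_mem' := by
    rintro c p ⟨u', u'', h1, h2, h3⟩
    refine ⟨c • u', c • u'', h1.smul c, h2.smul c, ?_⟩
    rw [Prod.smul_snd, Prod.smul_fst, h3, smul_sub, smul_comm]

/-- The operator `A_l = ∂_y² - l²` in `L²(𝕋)` with domain `W^{2,2}(𝕋)`. -/
def opA (l : ℤ) : L2T →ₗ.[ℂ] L2T := (graphA l).toLinearPMap

/-- `opA l` is indeed the operator with graph `graphA l`. -/
lemma opA_graph (l : ℤ) : (opA l).graph = graphA l := by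
  refine Submodule.toLinearPMap_graph_eq _ ?_
  rintro ⟨p, q⟩ ⟨u', u'', h1, h2, h3⟩ (h0 : p = 0)
  subst h0
  obtain rfl := h1.eq_zero
  obtain rfl := h2.eq_zero
  simpa using h3

/-! ### The operators `Λ̂_l` and `L_{α,l}` -/

/-- The function `sin` on `𝕋`. -/
def sinT : C(Torus, ℝ) where
  toFun := Real.sin_periodic.lift
  continuous_toFun := continuous_coinduced_dom.mpr Real.continuous_sin

lemma sinT_coe (x : ℝ) : sinT (x : Torus) = Real.sin x := rfl

lemma memLp_sin_mul (f : L2T) :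
    MemLp (fun y => (sinT y : ℂ) * f y) 2 torusMeasure := by
  refine (Lp.memLp f).of_le ?_ (Filter.Eventually.of_forall fun y => ?_)
  · exact (Complex.continuous_ofReal.comp sinT.continuous).aestronglyMeasurable.mul
      (Lp.aestronglyMeasurable f)
  · induction y using QuotientAddGroup.induction_on with
    | H x =>
      rw [norm_mul]
      refine mul_le_of_le_one_left (norm_nonneg _) ?_
      rw [Complex.norm_real]
      exact Real.abs_sin_le_one x

/-- The multiplication operator `M_{sin y}` on `L²(𝕋)`. -/
def mulSin : L2T →ₗ[ℂ] L2T where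
  toFun f := (memLp_sin_mul f).toLp _
  map_add' f g := by
    rw [← MemLp.toLp_add, MemLp.toLp_eq_toLp_iff]
    filter_upwards [Lp.coeFn_add f g] with y hy
    rw [hy, Pi.add_apply, Pi.add_apply, mul_add]
  map_smul' c f := by
    rw [RingHom.id_apply, ← MemLp.toLp_const_smul, MemLp.toLp_eq_toLp_iff]
    filter_upwards [Lp.coeFn_smul c f] with y hy
    rw [hy, Pi.smul_apply, Pi.smul_apply, smul_eq_mul, smul_eq_mul]
    ring

/-- The operator `Λ̂_l = M_{sin y} (I + A_l⁻¹)`. -/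
def opLambda (l : ℤ) : L2T →ₗ.[ℂ] L2T :=
  mulSin.compPMap ((LinearMap.id : L2T →ₗ[ℂ] L2T) +ᵥ (opA l).inverse)

/-- The operator `L_{α,l} = A_l - i α l Λ̂_l`. -/
def opL (α : ℝ) (l : ℤ) : L2T →ₗ.[ℂ] L2T :=
  opA l - (Complex.I * α * l) • opLambda l

/-! ### The space `Y_l`, the projection `ℚ_l` and the operator `ℚ_l L_{α,l}` -/

lemma integral_eq_integral_mul_one (f : L2T) :
    ∫ y, f y ∂torusMeasure = ∫ y, f y * (1 : C(Torus, ℂ)) y ∂torusMeasure := by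
  simp

/-- `Y_l` is the space of mean-free functions in `L²(𝕋)` if `l = ±1`, and `L²(𝕋)` otherwise. -/
def spaceY (l : ℤ) : Submodule ℂ L2T where
  carrier := {f | |l| = 1 → ∫ y, f y ∂torusMeasure = 0}
  zero_mem' := fun _ => by rw [integral_eq_integral_mul_one, integral_zero_mul]
  add_mem' := fun {f g} hf hg h => by
    rw [integral_eq_integral_mul_one, integral_add_mul, ← integral_eq_integral_mul_one,
      ← integral_eq_integral_mul_one, hf h, hg h, add_zero]
  smul_mem' := fun c f hf h => by
    rw [integral_eq_integral_mul_one, integral_smul_mul, ← integral_eq_integral_mul_one,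
      hf h, mul_zero]

lemma isClosed_spaceY (l : ℤ) : IsClosed (spaceY l : Set L2T) := by
  have hc : Continuous fun f : L2T => ∫ y, f y ∂torusMeasure := by
    have h : ∀ f : L2T, ∫ y, f y ∂torusMeasure = inner ℂ (fourierLp (T := 2 * Real.pi) 2 0) f := by
      intro f
      rw [L2.inner_def]
      refine integral_congr_ae ?_
      filter_upwards [coeFn_fourierLp (T := 2 * Real.pi) 2 0] with y hy
      rw [hy]
      simp
    simp_rw [h]
    fun_prop
  by_cases h : |l| = 1
  · have : (spaceY l : Set L2T) = {f | ∫ y, f y ∂torusMeasure = 0} := by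
      ext f
      exact ⟨fun hf => hf h, fun hf _ => hf⟩
    rw [this]
    exact isClosed_eq hc continuous_const
  · have : (spaceY l : Set L2T) = Set.univ := by
      ext f
      exact ⟨fun _ => trivial, fun _ h' => absurd h' h⟩
    rw [this]
    exact isClosed_univ

instance completeSpace_spaceY (l : ℤ) : CompleteSpace (spaceY l) :=
  (isClosed_spaceY l).completeSpace_coe

/-- The orthogonal projection `ℚ_l` from `L²(𝕋)` onto `Y_l`. -/
def projQ (l : ℤ) : L2T →L[ℂ] spaceY l := (spaceY l).orthogonalProjectionOnto

/-- The operator `ℚ_l L_{α,l}` in `Y_l`, with domain `D(L_{α,l}) ∩ Y_l`. -/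
def opQL (α : ℝ) (l : ℤ) : spaceY l →ₗ.[ℂ] spaceY l where
  domain := (opL α l).domain.comap (spaceY l).subtype
  toFun := (projQ l : L2T →ₗ[ℂ] spaceY l) ∘ₗ (opL α l).toFun ∘ₗ
    (spaceY l).subtype.restrict (fun _ hu => hu)

end Kolmogorov

end

open MeasureTheory

noncomputable section

namespace Kolmogorov

/-! Put G = (-A_l)⁻¹, b = |αl| and u = G g. Then (z + ℚ_l L) u = T g - g with T compact, so by the
Fredholm alternative (`exists_isBoundedInverse`) everything follows from a priori bounds ‖G g‖ ≤ M
‖T g - g‖.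

The symbol 1 - 1/(n² + l²) of 1 + A_l⁻¹ is at least 1/2 on Y_l, because the one mode where it
vanishes (l = ±1, n = 0) is removed. Moreover M_sin (1 + A_l⁻¹) is symmetric for the form ⟨(1 +
A_l⁻¹)·, ·⟩. Let f = T g - g and pair it with X = (1 + A_l⁻¹) u. The real part loses the shear and,
for Re z ≤ 0, gives the energy bound ‖u'‖² + l²‖u‖² ≤ 2‖f‖‖u‖ (`energy_le`). For z = iλ the
imaginary part gives the bound for |μ| > 1, because |sin| ≤ 1 (`norm_opGY_le_of_one_lt`).

For smaller |μ|, let Ψ be A_l⁻¹ u up to a constant, m = l² - 1 and v = Ψ'' - mΨ = X. The equation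
becomes iαl ((sin - μ) v + μΨ) = u'' - l² u - f, a Rayleigh equation perturbed by viscosity
(`exists_vorticitySol`). Translation by π reduces it to μ > 0. With δ = max(1 - μ, b^{-1/2}), the
critical layer has width d, and sin - μ has size κ = d√δ on it. The balance bκ = d⁻² between shear
and viscosity fixes d, and ‖u‖ ≤ C d² ‖f‖ is the claim in both inner ranges
(`exists_vorticity_bound`).

If the claim fails, the real and imaginary parts ψ of Ψ solve the Rayleigh equation with a small
error, and v varies slowly on the scale d. This is impossible (`exists_rayleigh_threshold`). Testing
with (ψ/2 - cos ψ')/(sin - μ), where 1/(sin - μ) is regularized to (sin - μ)/((sin - μ)² + κ²),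
produces ∫(1 + sin)ψ'², m∫(1 - sin)ψ² and μ∫(1 - sin)ψ²/((sin - μ)² + κ²), all with the same sign
(`coercive_le`). The only term of the wrong sign is the mass of ψ at the critical points. That mass
is small, as testing with a regularized delta shows (`layer_mass_le`). A Hardy inequality
(`LayerScale.hardy`) then makes μψ/(sin - μ) small, and v equals minus this quotient up to errors,
so ‖v‖ is a small fraction of itself.

The spectral bound follows by perturbing the uniform bound C b^{-1/2} off the imaginary axis. -/

/-! ### Integrals over one period -/

/-- The integral over one period. -/
def pint (f : ℝ → ℝ) : ℝ := ∫ x in (0 : ℝ)..(2 * Real.pi), f x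

/-- The `L²` norm over one period. -/
def nrm (f : ℝ → ℝ) : ℝ := √(pint fun x => f x ^ 2)

lemma pint_add {f g : ℝ → ℝ} (hf : Continuous f) (hg : Continuous g) :
    pint (fun x => f x + g x) = pint f + pint g :=
  intervalIntegral.integral_add (hf.intervalIntegrable _ _) (hg.intervalIntegrable _ _)

lemma pint_sub {f g : ℝ → ℝ} (hf : Continuous f) (hg : Continuous g) :
    pint (fun x => f x - g x) = pint f - pint g :=
  intervalIntegral.integral_sub (hf.intervalIntegrable _ _) (hg.intervalIntegrable _ _)

lemma pint_const_mul (c : ℝ) (f : ℝ → ℝ) : pint (fun x => c * f x) = c * pint f :=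
  intervalIntegral.integral_const_mul _ _

lemma pint_neg (f : ℝ → ℝ) : pint (fun x => -f x) = -pint f :=
  intervalIntegral.integral_neg

lemma pint_mono {f g : ℝ → ℝ} (hf : Continuous f) (hg : Continuous g) (h : ∀ x, f x ≤ g x) :
    pint f ≤ pint g :=
  intervalIntegral.integral_mono (by positivity) (hf.intervalIntegrable _ _)
    (hg.intervalIntegrable _ _) h

lemma pint_nonneg {f : ℝ → ℝ} (h : ∀ x, 0 ≤ f x) : 0 ≤ pint f :=
  intervalIntegral.integral_nonneg (by positivity) fun x _ => h x

lemma abs_pint_le {f : ℝ → ℝ} : |pint f| ≤ pint fun x => |f x| :=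
  intervalIntegral.abs_integral_le_integral_abs (by positivity)

lemma nrm_nonneg (f : ℝ → ℝ) : 0 ≤ nrm f := Real.sqrt_nonneg _

lemma nrm_sq (f : ℝ → ℝ) : nrm f ^ 2 = pint fun x => f x ^ 2 :=
  Real.sq_sqrt (pint_nonneg fun _ => sq_nonneg _)

/-- The Cauchy–Schwarz inequality. -/
lemma pint_mul_le {f g : ℝ → ℝ} (hf : Continuous f) (hg : Continuous g) :
    pint (fun x => f x * g x) ≤ nrm f * nrm g := by
  have key : ∀ t : ℝ, 0 ≤ nrm g ^ 2 * (t * t) + (-2 * pint fun x => f x * g x) * t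
      + nrm f ^ 2 := by
    intro t
    have h : 0 ≤ pint fun x => (f x - t * g x) ^ 2 := pint_nonneg fun _ => sq_nonneg _
    have e : (pint fun x => (f x - t * g x) ^ 2)
        = pint fun x => (f x ^ 2 + (t * t) * g x ^ 2) + (-2 * t) * (f x * g x) := by
      congr 1; funext x; ring
    rw [e, pint_add (by fun_prop) (by fun_prop), pint_add (by fun_prop) (by fun_prop),
      pint_const_mul, pint_const_mul, ← nrm_sq, ← nrm_sq] at h
    linarith
  have h := discrim_le_zero key
  rw [discrim] at h
  refine (abs_le_of_sq_le_sq' ?_ (mul_nonneg (nrm_nonneg _) (nrm_nonneg _))).2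
  nlinarith

lemma nrm_abs (f : ℝ → ℝ) : nrm (fun x => |f x|) = nrm f := by
  simp [nrm]

/-- The Cauchy–Schwarz inequality with a pointwise majorant. -/
lemma abs_pint_le_mul {F f g : ℝ → ℝ} {K : ℝ} (hF : Continuous F) (hf : Continuous f)
    (hg : Continuous g) (hK : 0 ≤ K) (h : ∀ x, |F x| ≤ K * (|f x| * |g x|)) :
    |pint F| ≤ K * (nrm f * nrm g) := by
  calc |pint F| ≤ pint fun x => |F x| := abs_pint_le
    _ ≤ pint fun x => K * (|f x| * |g x|) := pint_mono hF.abs (by fun_prop) h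
    _ = K * pint fun x => |f x| * |g x| := pint_const_mul _ _
    _ ≤ K * (nrm (fun x => |f x|) * nrm fun x => |g x|) :=
      mul_le_mul_of_nonneg_left (pint_mul_le hf.abs hg.abs) hK
    _ = _ := by rw [nrm_abs, nrm_abs]

lemma nrm_le_mul {f g : ℝ → ℝ} {K : ℝ} (hf : Continuous f) (hg : Continuous g) (hK : 0 ≤ K)
    (h : ∀ x, |f x| ≤ K * |g x|) : nrm f ≤ K * nrm g := by
  refine Real.sqrt_le_iff.2 ⟨mul_nonneg hK (nrm_nonneg _), ?_⟩
  rw [mul_pow, nrm_sq, ← pint_const_mul]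
  refine pint_mono (by fun_prop) (by fun_prop) fun x => ?_
  rw [← mul_pow]
  exact sq_le_sq.2 (by rw [abs_mul, abs_of_nonneg hK]; exact h x)

lemma nrm_add_le {f g : ℝ → ℝ} (hf : Continuous f) (hg : Continuous g) :
    nrm (fun x => f x + g x) ≤ nrm f + nrm g := by
  refine Real.sqrt_le_iff.2 ⟨add_nonneg (nrm_nonneg _) (nrm_nonneg _), ?_⟩
  have e : (pint fun x => (f x + g x) ^ 2)
      = pint fun x => (f x ^ 2 + g x ^ 2) + 2 * (f x * g x) := by
    congr 1; funext x; ring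
  rw [e, pint_add (by fun_prop) (by fun_prop), pint_add (by fun_prop) (by fun_prop),
    pint_const_mul, ← nrm_sq, ← nrm_sq]
  nlinarith [pint_mul_le hf hg]

lemma pint_deriv_eq_zero {f f' : ℝ → ℝ} (h : ∀ x, HasDerivAt f (f' x) x) (hc : Continuous f')
    (hp : Function.Periodic f (2 * Real.pi)) : pint f' = 0 := by
  rw [pint, intervalIntegral.integral_eq_sub_of_hasDerivAt (fun x _ => h x)
    (hc.intervalIntegrable _ _)]
  have := hp 0
  rw [zero_add] at this
  rw [this, sub_self]

/-- Integration by parts over one period. -/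
lemma pint_deriv_mul {f f' g g' : ℝ → ℝ} (hf : ∀ x, HasDerivAt f (f' x) x)
    (hg : ∀ x, HasDerivAt g (g' x) x) (hf' : Continuous f') (hg' : Continuous g')
    (hfp : Function.Periodic f (2 * Real.pi)) (hgp : Function.Periodic g (2 * Real.pi)) :
    pint (fun x => f' x * g x) = -pint fun x => f x * g' x := by
  have cf : Continuous f := continuous_iff_continuousAt.2 fun x => (hf x).continuousAt
  have cg : Continuous g := continuous_iff_continuousAt.2 fun x => (hg x).continuousAt
  have h := pint_deriv_eq_zero (fun x => (hf x).mul (hg x)) (by fun_prop) (hfp.mul hgp)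
  rw [pint_add (by fun_prop) (by fun_prop)] at h
  linarith

/-! ### The critical layer -/

/-- The parameters of the critical layer of `sin - μ`: it has width `d`, and `κ` is the size of
`sin - μ` on it. -/
structure LayerScale (μ δ κ d : ℝ) : Prop where
  mu_pos : 0 < μ
  d_pos : 0 < d
  κ_pos : 0 < κ
  δ_le : δ ≤ 1
  d_sq_le : d ^ 2 ≤ δ
  κ_sq : κ ^ 2 = d ^ 2 * δ
  dist_le : |1 - μ| ≤ δ
  alt : δ = 1 - μ ∨ κ = δ

/-- The regularized modulus of `sin - μ`. -/
def reg (μ κ x : ℝ) : ℝ := √((Real.sin x - μ) ^ 2 + κ ^ 2)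

namespace LayerScale

variable {μ δ κ d : ℝ}

lemma δ_pos (hs : LayerScale μ δ κ d) : 0 < δ := lt_of_lt_of_le (pow_pos hs.d_pos 2) hs.d_sq_le

lemma mu_le (hs : LayerScale μ δ κ d) : μ ≤ 2 := by
  have := abs_le.1 hs.dist_le
  linarith [hs.δ_le]

lemma κ_le (hs : LayerScale μ δ κ d) : κ ≤ δ :=
  (abs_le_of_sq_le_sq' (by nlinarith [hs.κ_sq, hs.d_sq_le, hs.δ_pos]) hs.δ_pos.le).2

lemma d_sq_le_κ (hs : LayerScale μ δ κ d) : d ^ 2 ≤ κ :=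
  (abs_le_of_sq_le_sq' (by nlinarith [hs.κ_sq, hs.d_sq_le, sq_nonneg d]) hs.κ_pos.le).2

lemma one_le_ratio (hs : LayerScale μ δ κ d) : 1 ≤ δ / κ := (one_le_div hs.κ_pos).2 hs.κ_le

lemma sq_add_pos (hs : LayerScale μ δ κ d) (x : ℝ) : 0 < (Real.sin x - μ) ^ 2 + κ ^ 2 := by
  have := hs.κ_pos
  positivity

lemma reg_sq (hs : LayerScale μ δ κ d) (x : ℝ) : reg μ κ x ^ 2 = (Real.sin x - μ) ^ 2 + κ ^ 2 :=
  Real.sq_sqrt (hs.sq_add_pos x).le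

lemma reg_pos (hs : LayerScale μ δ κ d) (x : ℝ) : 0 < reg μ κ x :=
  Real.sqrt_pos.2 (hs.sq_add_pos x)

lemma κ_le_reg (_hs : LayerScale μ δ κ d) (x : ℝ) : κ ≤ reg μ κ x :=
  Real.le_sqrt_of_sq_le (by nlinarith [sq_nonneg (Real.sin x - μ)])

lemma abs_le_reg (_hs : LayerScale μ δ κ d) (x : ℝ) : |Real.sin x - μ| ≤ reg μ κ x :=
  Real.le_sqrt_of_sq_le (by nlinarith [sq_abs (Real.sin x - μ), sq_nonneg κ])

lemma one_sub_sin_le (hs : LayerScale μ δ κ d) (x : ℝ) :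
    1 - Real.sin x ≤ δ + |Real.sin x - μ| := by
  have h1 := abs_le.1 hs.dist_le
  have h2 := neg_abs_le (Real.sin x - μ)
  linarith

lemma cos_sq_le (hs : LayerScale μ δ κ d) (x : ℝ) :
    Real.cos x ^ 2 ≤ 2 * (δ + |Real.sin x - μ|) := by
  have h1 := hs.one_sub_sin_le x
  nlinarith [Real.sin_sq_add_cos_sq x, Real.sin_le_one x, Real.neg_one_le_sin x]

/-- Since κ² = d²δ and d² ≤ κ, multiplying `cos_sq_le` by d² leaves 2κ² + 2κ|sin - μ|, which is at
most 4((sin - μ)² + κ²). Consequently the weight `reg⁻¹` has logarithmic derivative at most 2/d: it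
varies on the scale d. -/
lemma abs_cos_le (hs : LayerScale μ δ κ d) (x : ℝ) : |Real.cos x| ≤ 2 / d * reg μ κ x := by
  have hd := hs.d_pos
  have h : d * |Real.cos x| ≤ 2 * reg μ κ x := by
    refine (abs_le_of_sq_le_sq' ?_ (by have := hs.reg_pos x; positivity)).2
    have h2 := hs.d_sq_le_κ
    have h3 := hs.cos_sq_le x
    have h4 : d ^ 2 * |Real.sin x - μ| ≤ κ * |Real.sin x - μ| := by gcongr
    rw [mul_pow, mul_pow, hs.reg_sq, sq_abs]
    have h5 : d ^ 2 * Real.cos x ^ 2 ≤ d ^ 2 * (2 * (δ + |Real.sin x - μ|)) := by gcongr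
    nlinarith [hs.κ_sq, sq_nonneg (κ - |Real.sin x - μ|), sq_abs (Real.sin x - μ)]
  rw [div_mul_eq_mul_div, le_div_iff₀ hd]
  linarith

/-- Both δ and |sin - μ| are at most (δ/κ) `reg`. The loss δ/κ ≥ 1 is harmless later, because the
right-hand side of the Rayleigh equation carries a factor κ. -/
lemma one_sub_sin_mul_le (hs : LayerScale μ δ κ d) (x : ℝ) :
    (1 - Real.sin x) * κ ≤ 2 * δ * reg μ κ x := by
  have h1 := hs.one_sub_sin_le x
  have h2 := hs.κ_le_reg x
  have h3 := hs.abs_le_reg x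
  have h4 : κ * |Real.sin x - μ| ≤ δ * reg μ κ x :=
    mul_le_mul hs.κ_le h3 (abs_nonneg _) hs.δ_pos.le
  nlinarith [hs.κ_pos, hs.δ_pos]

lemma cos_sq_mul_le (hs : LayerScale μ δ κ d) (x : ℝ) :
    Real.cos x ^ 2 ≤ 4 * (δ / κ) * reg μ κ x := by
  have h1 := hs.one_sub_sin_mul_le x
  have hk := hs.κ_pos
  have : Real.cos x ^ 2 * κ ≤ 4 * δ * reg μ κ x := by
    nlinarith [Real.sin_sq_add_cos_sq x, Real.sin_le_one x, Real.neg_one_le_sin x,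
      mul_nonneg hk.le (sq_nonneg (1 - Real.sin x))]
  calc Real.cos x ^ 2 ≤ 4 * δ * reg μ κ x / κ := (le_div_iff₀ hk).2 this
    _ = _ := by ring

lemma continuous_reg (μ κ : ℝ) : Continuous (reg μ κ) := by
  unfold reg; fun_prop

end LayerScale

/-! ### The Rayleigh equation with a small right-hand side -/

/-- A solution `ψ` of the Rayleigh equation `(sin - μ) v + μ ψ = h₁ + h₂'`, `v = ψ'' - m ψ`, with a
slowly varying `v` and a small right-hand side, the size of everything being measured by `V`. -/
structure RayleighSol (μ κ d m η V : ℝ) (ψ ψ₁ ψ₂ ψ₃ h₁ h₂ h₂' : ℝ → ℝ) : Prop where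
  m_nonneg : 0 ≤ m
  η_nonneg : 0 ≤ η
  V_nonneg : 0 ≤ V
  per : Function.Periodic ψ (2 * Real.pi)
  per₁ : Function.Periodic ψ₁ (2 * Real.pi)
  per₂ : Function.Periodic ψ₂ (2 * Real.pi)
  perh : Function.Periodic h₂ (2 * Real.pi)
  der : ∀ x, HasDerivAt ψ (ψ₁ x) x
  der₁ : ∀ x, HasDerivAt ψ₁ (ψ₂ x) x
  der₂ : ∀ x, HasDerivAt ψ₂ (ψ₃ x) x
  derh : ∀ x, HasDerivAt h₂ (h₂' x) x
  cont₃ : Continuous ψ₃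
  conth₁ : Continuous h₁
  conth₂' : Continuous h₂'
  eqn : ∀ x, (Real.sin x - μ) * (ψ₂ x - m * ψ x) + μ * ψ x = h₁ x + h₂' x
  h₁_le : nrm h₁ ≤ η * κ * V
  h₂_le : nrm h₂ ≤ η * κ * d * V
  v_le : nrm (fun x => ψ₂ x - m * ψ x) ≤ V
  v₁_le : d * nrm (fun x => ψ₃ x - m * ψ₁ x) ≤ η * V
  ψ₂_le : nrm ψ₂ ≤ V

namespace RayleighSol

variable {ψ ψ₁ ψ₂ ψ₃ h₁ h₂ h₂' : ℝ → ℝ} {μ δ κ d m η V : ℝ}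

lemma cont (h : RayleighSol μ κ d m η V ψ ψ₁ ψ₂ ψ₃ h₁ h₂ h₂') : Continuous ψ :=
  continuous_iff_continuousAt.2 fun x => (h.der x).continuousAt

lemma cont₁ (h : RayleighSol μ κ d m η V ψ ψ₁ ψ₂ ψ₃ h₁ h₂ h₂') : Continuous ψ₁ :=
  continuous_iff_continuousAt.2 fun x => (h.der₁ x).continuousAt

lemma cont₂ (h : RayleighSol μ κ d m η V ψ ψ₁ ψ₂ ψ₃ h₁ h₂ h₂') : Continuous ψ₂ :=
  continuous_iff_continuousAt.2 fun x => (h.der₂ x).continuousAt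

lemma conth₂ (h : RayleighSol μ κ d m η V ψ ψ₁ ψ₂ ψ₃ h₁ h₂ h₂') : Continuous h₂ :=
  continuous_iff_continuousAt.2 fun x => (h.derh x).continuousAt

/-- Testing the equation with a function `φ`. -/
lemma test_le (h : RayleighSol μ κ d m η V ψ ψ₁ ψ₂ ψ₃ h₁ h₂ h₂') (hκ : 0 ≤ κ) (hd : 0 ≤ d)
    {φ φ' : ℝ → ℝ}
    (hφ : ∀ x, HasDerivAt φ (φ' x) x) (hφ' : Continuous φ')
    (hp : Function.Periodic φ (2 * Real.pi)) {a b : ℝ} (ha : nrm φ ≤ a) (hb : nrm φ' ≤ b) :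
    |pint fun x => ((Real.sin x - μ) * (ψ₂ x - m * ψ x) + μ * ψ x) * φ x|
      ≤ η * κ * V * (a + d * b) := by
  have cφ : Continuous φ := continuous_iff_continuousAt.2 fun x => (hφ x).continuousAt
  have c1 := h.conth₁
  have c2 := h.conth₂
  have c3 := h.conth₂'
  -- No bound for `h₂'` is available, so the derivative is moved to φ. The loss 1/d expected from φ'
  -- is paid for by the factor d in `h₂_le`.
  have e : (pint fun x => ((Real.sin x - μ) * (ψ₂ x - m * ψ x) + μ * ψ x) * φ x)
      = (pint fun x => h₁ x * φ x) - pint fun x => h₂ x * φ' x := by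
    rw [sub_eq_add_neg, ← pint_deriv_mul h.derh hφ c3 hφ' h.perh hp,
      ← pint_add (by fun_prop) (by fun_prop)]
    congr 1; funext x; rw [h.eqn]; ring
  rw [e]
  have b1 : |pint fun x => h₁ x * φ x| ≤ 1 * (nrm h₁ * nrm φ) :=
    abs_pint_le_mul (by fun_prop) c1 cφ zero_le_one fun x => by rw [abs_mul, one_mul]
  have b2 : |pint fun x => h₂ x * φ' x| ≤ 1 * (nrm h₂ * nrm φ') :=
    abs_pint_le_mul (by fun_prop) c2 hφ' zero_le_one fun x => by rw [abs_mul, one_mul]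
  have hη := h.η_nonneg
  have hV := h.V_nonneg
  have b3 : nrm h₁ * nrm φ ≤ η * κ * V * a :=
    mul_le_mul h.h₁_le ha (nrm_nonneg _) (by positivity)
  have b4 : nrm h₂ * nrm φ' ≤ η * κ * d * V * b :=
    mul_le_mul h.h₂_le hb (nrm_nonneg _) (by positivity)
  calc _ ≤ |pint fun x => h₁ x * φ x| + |pint fun x => h₂ x * φ' x| := abs_sub _ _
    _ ≤ _ := by linarith

end RayleighSol

/-! ### The regularized weight and its pointwise bounds -/

/-- The weight `((sin - μ)² + κ²)^{-1/2}`. -/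
def wt (μ κ x : ℝ) : ℝ := (reg μ κ x)⁻¹

lemma periodic_wt (μ κ : ℝ) : Function.Periodic (wt μ κ) (2 * Real.pi) := fun x => by
  simp [wt, reg]

namespace LayerScale

variable {μ δ κ d : ℝ}

lemma wt_pos (hs : LayerScale μ δ κ d) (x : ℝ) : 0 < wt μ κ x := inv_pos.2 (hs.reg_pos x)

lemma continuous_wt (hs : LayerScale μ δ κ d) : Continuous (wt μ κ) :=
  (continuous_reg μ κ).inv₀ fun x => (hs.reg_pos x).ne'

lemma wt_sq_mul (hs : LayerScale μ δ κ d) (x : ℝ) :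
    wt μ κ x ^ 2 * ((Real.sin x - μ) ^ 2 + κ ^ 2) = 1 := by
  rw [wt, ← hs.reg_sq, inv_pow, inv_mul_cancel₀ (pow_ne_zero 2 (hs.reg_pos x).ne')]

lemma hasDerivAt_wt (hs : LayerScale μ δ κ d) (x : ℝ) :
    HasDerivAt (wt μ κ) (-((Real.sin x - μ) * Real.cos x * wt μ κ x ^ 3)) x := by
  have h1 : HasDerivAt (fun x => (Real.sin x - μ) ^ 2 + κ ^ 2)
      (2 * (Real.sin x - μ) * Real.cos x) x := by
    have := (((Real.hasDerivAt_sin x).sub_const μ).pow 2).add_const (κ ^ 2)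
    exact this.congr_deriv (by push_cast; ring)
  have h2 := (h1.sqrt (hs.sq_add_pos x).ne').inv (hs.reg_pos x).ne'
  refine h2.congr_deriv ?_
  have h3 : √((Real.sin x - μ) ^ 2 + κ ^ 2) = reg μ κ x := rfl
  have h4 := (hs.reg_pos x).ne'
  simp only [h3, wt]
  field_simp

lemma κ_mul_wt_le (hs : LayerScale μ δ κ d) (x : ℝ) : κ * wt μ κ x ≤ 1 := by
  rw [wt, ← div_eq_mul_inv, div_le_one (hs.reg_pos x)]
  exact hs.κ_le_reg x

lemma wt_le (hs : LayerScale μ δ κ d) (x : ℝ) : wt μ κ x ≤ 1 / κ := by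
  rw [le_div_iff₀ hs.κ_pos, mul_comm]
  exact hs.κ_mul_wt_le x

lemma abs_mul_wt_le (hs : LayerScale μ δ κ d) (x : ℝ) : |(Real.sin x - μ) * wt μ κ x| ≤ 1 := by
  rw [abs_mul, abs_of_pos (hs.wt_pos x), wt, ← div_eq_mul_inv, div_le_one (hs.reg_pos x)]
  exact hs.abs_le_reg x

lemma abs_cos_mul_wt_le (hs : LayerScale μ δ κ d) (x : ℝ) :
    |Real.cos x * wt μ κ x| ≤ 2 / d := by
  rw [abs_mul, abs_of_pos (hs.wt_pos x), wt, ← div_eq_mul_inv, div_le_iff₀ (hs.reg_pos x)]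
  exact hs.abs_cos_le x

lemma cos_sq_mul_wt_le (hs : LayerScale μ δ κ d) (x : ℝ) :
    |Real.cos x ^ 2 * wt μ κ x| ≤ 4 * (δ / κ) := by
  rw [abs_of_nonneg (mul_nonneg (sq_nonneg _) (hs.wt_pos x).le), wt, ← div_eq_mul_inv,
    div_le_iff₀ (hs.reg_pos x)]
  exact hs.cos_sq_mul_le x

lemma one_sub_sin_mul_wt_le (hs : LayerScale μ δ κ d) (x : ℝ) :
    |(1 - Real.sin x) * κ * wt μ κ x| ≤ 2 * δ := by
  have h0 : 0 ≤ (1 - Real.sin x) * κ :=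
    mul_nonneg (by linarith [Real.sin_le_one x]) hs.κ_pos.le
  rw [abs_of_nonneg (mul_nonneg h0 (hs.wt_pos x).le), wt, ← div_eq_mul_inv,
    div_le_iff₀ (hs.reg_pos x)]
  exact hs.one_sub_sin_mul_le x

end LayerScale

lemma abs_le_mul_of_eq {F a f g K : ℝ} (h : F = a * (f * g)) (ha : |a| ≤ K) :
    |F| ≤ K * (|f| * |g|) := by
  rw [h, abs_mul, abs_mul f]
  exact mul_le_mul_of_nonneg_right ha (by positivity)

lemma abs_le_mul_of_eq' {F a f K : ℝ} (h : F = a * f) (ha : |a| ≤ K) : |F| ≤ K * |f| := by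
  rw [h, abs_mul]
  exact mul_le_mul_of_nonneg_right ha (by positivity)

/-! ### Weighted bounds for the first derivative of ψ -/

namespace RayleighSol

variable {ψ ψ₁ ψ₂ ψ₃ h₁ h₂ h₂' : ℝ → ℝ} {μ δ κ d m η V : ℝ}

/-- A weighted bound for `cos · ψ'`. -/
lemma nrm_cos_deriv_le (hs : LayerScale μ δ κ d)
    (h : RayleighSol μ κ d m η V ψ ψ₁ ψ₂ ψ₃ h₁ h₂ h₂') :
    nrm (fun x => Real.cos x * ψ₁ x * wt μ κ x)
      ≤ 11 * (δ / κ) * (nrm (fun x => ψ x * wt μ κ x) + V) := by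
  have cσ := hs.continuous_wt
  have c0 := h.cont
  have c1 := h.cont₁
  have c2 := h.cont₂
  set σ := wt μ κ with hσ
  set X := nrm (fun x => ψ x * σ x) with hX
  set Y := nrm (fun x => Real.cos x * ψ₁ x * σ x) with hY
  have hD := hs.one_le_ratio
  set D := δ / κ
  have hX0 : 0 ≤ X := nrm_nonneg _
  have hY0 : 0 ≤ Y := nrm_nonneg _
  have hV := h.V_nonneg
  -- The integral of this derivative is zero. Its first term gives Y², and each remaining term
  -- contains ψσ times ψ₂ or cos ψ₁ σ. The leftover coefficients are controlled by cos² σ ≤ 4δ/κ, so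
  -- Y² ≤ 4D X V + 10D X Y with D = δ/κ.
  have der : ∀ x, HasDerivAt (fun x => Real.cos x ^ 2 * ψ x * ψ₁ x * σ x ^ 2)
      ((Real.cos x * ψ₁ x * σ x) ^ 2 + Real.cos x ^ 2 * ψ x * ψ₂ x * σ x ^ 2
        - 2 * Real.cos x * Real.sin x * ψ x * ψ₁ x * σ x ^ 2
        - 2 * Real.cos x ^ 3 * (Real.sin x - μ) * ψ x * ψ₁ x * σ x ^ 4) x := by
    intro x
    have := (((((Real.hasDerivAt_cos x).pow 2).mul (h.der x)).mul (h.der₁ x)).mul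
      ((hs.hasDerivAt_wt x).pow 2))
    refine this.congr_deriv ?_
    simp only [← hσ, Pi.pow_apply, Pi.mul_apply]
    push_cast
    ring
  have h0 := pint_deriv_eq_zero der (by fun_prop) (by
    intro x
    simp only [Real.cos_add_two_pi, h.per x, h.per₁ x, hσ, periodic_wt μ κ x])
  rw [pint_sub (by fun_prop) (by fun_prop), pint_sub (by fun_prop) (by fun_prop),
    pint_add (by fun_prop) (by fun_prop), ← nrm_sq, ← hY] at h0
  have b1 : |pint fun x => Real.cos x ^ 2 * ψ x * ψ₂ x * σ x ^ 2| ≤ 4 * D * (X * nrm ψ₂) :=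
    abs_pint_le_mul (by fun_prop) (by fun_prop) c2 (by positivity) fun x =>
      abs_le_mul_of_eq (a := Real.cos x ^ 2 * σ x) (by ring) (hs.cos_sq_mul_wt_le x)
  have b2 : |pint fun x => 2 * Real.cos x * Real.sin x * ψ x * ψ₁ x * σ x ^ 2|
      ≤ 2 * (X * Y) :=
    abs_pint_le_mul (by fun_prop) (by fun_prop) (by fun_prop) (by positivity) fun x =>
      abs_le_mul_of_eq (a := 2 * Real.sin x) (by ring) (by
        rw [abs_mul, abs_two]; linarith [Real.abs_sin_le_one x])
  have b3 : |pint fun x => 2 * Real.cos x ^ 3 * (Real.sin x - μ) * ψ x * ψ₁ x * σ x ^ 4|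
      ≤ (8 * D) * (X * Y) :=
    abs_pint_le_mul (by fun_prop) (by fun_prop) (by fun_prop) (by positivity) fun x =>
      abs_le_mul_of_eq (a := 2 * (Real.cos x ^ 2 * σ x) * ((Real.sin x - μ) * σ x)) (by ring) (by
        rw [abs_mul, abs_mul, abs_two]
        nlinarith [hs.cos_sq_mul_wt_le x, hs.abs_mul_wt_le x,
          abs_nonneg (Real.cos x ^ 2 * σ x), abs_nonneg ((Real.sin x - μ) * σ x)])
  have b4 : X * nrm ψ₂ ≤ X * V := mul_le_mul_of_nonneg_left h.ψ₂_le hX0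
  have key : Y ^ 2 ≤ 4 * D * (X * V) + 10 * D * (X * Y) := by
    have := neg_le_of_abs_le b1
    have := le_of_abs_le b2
    have := le_of_abs_le b3
    have := mul_le_mul_of_nonneg_left b4 (by positivity : 0 ≤ 4 * D)
    have : X * Y ≤ D * (X * Y) := le_mul_of_one_le_left (by positivity) hD
    linarith
  refine (abs_le_of_sq_le_sq' ?_ (by positivity)).2
  have e1 : D * (X * V) ≤ D * (D * (X * V)) :=
    mul_le_mul_of_nonneg_left (le_mul_of_one_le_left (by positivity) hD) (by positivity)
  nlinarith [sq_nonneg (Y - 10 * D * X), mul_nonneg hX0 hV, sq_nonneg (D * V),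
    sq_nonneg (D * X), mul_nonneg (mul_nonneg (by positivity : 0 ≤ D) hX0) hV]

/-- A weighted bound for `ψ'`. -/
lemma nrm_deriv_le (hs : LayerScale μ δ κ d)
    (h : RayleighSol μ κ d m η V ψ ψ₁ ψ₂ ψ₃ h₁ h₂ h₂') :
    nrm (fun x => ψ₁ x * wt μ κ x) ≤ 5 / d * (nrm (fun x => ψ x * wt μ κ x) + V) := by
  have cσ := hs.continuous_wt
  have c0 := h.cont
  have c1 := h.cont₁
  have c2 := h.cont₂
  have hd := hs.d_pos
  set σ := wt μ κ with hσ
  set X := nrm (fun x => ψ x * σ x) with hX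
  set S := nrm (fun x => ψ₁ x * σ x) with hS
  have hX0 : 0 ≤ X := nrm_nonneg _
  have hS0 : 0 ≤ S := nrm_nonneg _
  have hV := h.V_nonneg
  -- The same argument without the factor cos²: the coefficients now cost σ ≤ 1/κ ≤ 1/d² and |cos σ|
  -- ≤ 2/d.
  have der : ∀ x, HasDerivAt (fun x => ψ x * ψ₁ x * σ x ^ 2)
      ((ψ₁ x * σ x) ^ 2 + ψ x * ψ₂ x * σ x ^ 2
        - 2 * Real.cos x * (Real.sin x - μ) * ψ x * ψ₁ x * σ x ^ 4) x := by
    intro x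
    refine (((h.der x).mul (h.der₁ x)).mul ((hs.hasDerivAt_wt x).pow 2)).congr_deriv ?_
    simp only [← hσ, Pi.pow_apply, Pi.mul_apply]
    push_cast
    ring
  have h0 := pint_deriv_eq_zero der (by fun_prop) (by
    intro x
    simp only [h.per x, h.per₁ x, hσ, periodic_wt μ κ x])
  rw [pint_sub (by fun_prop) (by fun_prop),
    pint_add (by fun_prop) (by fun_prop), ← nrm_sq, ← hS] at h0
  have b1 : |pint fun x => ψ x * ψ₂ x * σ x ^ 2| ≤ 1 / κ * (X * nrm ψ₂) :=
    abs_pint_le_mul (by fun_prop) (by fun_prop) c2 (by have := hs.κ_pos; positivity) fun x =>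
      abs_le_mul_of_eq (a := σ x) (by ring)
        (by rw [abs_of_pos (hs.wt_pos x)]; exact hs.wt_le x)
  have b3 : |pint fun x => 2 * Real.cos x * (Real.sin x - μ) * ψ x * ψ₁ x * σ x ^ 4|
      ≤ (2 * (2 / d)) * (X * S) :=
    abs_pint_le_mul (by fun_prop) (by fun_prop) (by fun_prop) (by positivity) fun x =>
      abs_le_mul_of_eq (a := 2 * (Real.cos x * σ x) * ((Real.sin x - μ) * σ x)) (by ring) (by
        rw [abs_mul, abs_mul, abs_two]
        nlinarith [hs.abs_cos_mul_wt_le x, hs.abs_mul_wt_le x,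
          abs_nonneg (Real.cos x * σ x), abs_nonneg ((Real.sin x - μ) * σ x)])
  have b4 : X * nrm ψ₂ ≤ X * V := mul_le_mul_of_nonneg_left h.ψ₂_le hX0
  have hκd : 1 / κ ≤ (1 / d) ^ 2 := by
    rw [div_pow, one_pow]
    exact one_div_le_one_div_of_le (by positivity) hs.d_sq_le_κ
  have b5 : 1 / κ * (X * nrm ψ₂) ≤ (1 / d) ^ 2 * (X * V) :=
    mul_le_mul hκd b4 (mul_nonneg hX0 (nrm_nonneg _)) (by positivity)
  have e2 : (2 : ℝ) * (2 / d) = 4 * (1 / d) := by ring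
  have e5 : 5 / d = 5 * (1 / d) := by ring
  rw [e2] at b3
  rw [e5]
  have ht : 0 ≤ 1 / d := by positivity
  set t := 1 / d
  have key : S ^ 2 ≤ t ^ 2 * (X * V) + 4 * t * (X * S) := by
    have := neg_le_of_abs_le b1
    have := le_of_abs_le b3
    linarith
  refine (abs_le_of_sq_le_sq' ?_ (by positivity)).2
  nlinarith [sq_nonneg (S - 4 * t * X), mul_nonneg hX0 hV, sq_nonneg (t * V),
    sq_nonneg (t * X), mul_nonneg (mul_nonneg (sq_nonneg t) hX0) hV]

end RayleighSol

/-! ### The mass of ψ at the critical points -/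

namespace RayleighSol

variable {ψ ψ₁ ψ₂ ψ₃ h₁ h₂ h₂' : ℝ → ℝ} {μ δ κ d m η V ε : ℝ}

/-- Integrating the square of `v` against the regularized delta function at the critical points. -/
lemma pint_layer_abs_le (hs : LayerScale μ δ κ d) {v : ℝ → ℝ} (cv : Continuous v)
    (hv : nrm v ≤ V) (hε : 0 < ε) (hε1 : ε ≤ 1)
    (hE : nrm (fun x => κ * v x * wt μ κ x) ≤ ε * V) :
    nrm (fun x => √(1 - Real.sin x) * κ * (Real.sin x - μ) * v x * wt μ κ x ^ 2)
      ≤ √(3 * ε * δ) * V := by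
  have cσ := hs.continuous_wt
  set σ := wt μ κ with hσ
  have hV : 0 ≤ V := (nrm_nonneg _).trans hv
  have hδ := hs.δ_pos
  have hκ := hs.κ_pos
  refine Real.sqrt_le_iff.2 ⟨by positivity, ?_⟩
  rw [mul_pow, Real.sq_sqrt (by positivity)]
  have hE2 : (pint fun x => (κ * v x * σ x) ^ 2) ≤ ε ^ 2 * V ^ 2 := by
    rw [← nrm_sq, ← mul_pow]
    exact pow_le_pow_left₀ (nrm_nonneg _) hE 2
  have hv2 : (pint fun x => v x ^ 2) ≤ V ^ 2 := by
    rw [← nrm_sq]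
    exact pow_le_pow_left₀ (nrm_nonneg _) hv 2
  calc (pint fun x => (√(1 - Real.sin x) * κ * (Real.sin x - μ) * v x * σ x ^ 2) ^ 2)
      ≤ pint fun x => (δ + κ / (4 * ε)) * (κ * v x * σ x) ^ 2 + κ * ε * v x ^ 2 := by
        refine pint_mono (by fun_prop) (by fun_prop) fun x => ?_
        have hp : 0 ≤ 1 - Real.sin x := by linarith [Real.sin_le_one x]
        have h1 := hs.one_sub_sin_le x
        have h2 := hs.abs_mul_wt_le x
        have hw : ((Real.sin x - μ) * σ x) ^ 2 ≤ 1 := (sq_le_one_iff_abs_le_one _).2 h2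
        have hσ0 := hs.wt_pos x
        rw [← hσ] at hσ0 h2
        have h3 : |Real.sin x - μ| * σ x ≤ 1 := by rwa [abs_mul, abs_of_pos hσ0] at h2
        -- Young's inequality κσ ≤ (κσ)²/(4ε) + ε: the first part is charged to the layer norm of v,
        -- which is at most εV, and the second to the full norm of v.
        have h4 : |Real.sin x - μ| * (κ * σ x) ^ 2 ≤ κ / (4 * ε) * (κ * σ x) ^ 2 + κ * ε := by
          have h5 : |Real.sin x - μ| * (κ * σ x) ^ 2 ≤ κ * (κ * σ x) := by
            have : 0 ≤ κ * (κ * σ x) := by positivity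
            nlinarith
          have h6 : κ * σ x ≤ (κ * σ x) ^ 2 / (4 * ε) + ε := by
            rw [← sub_nonneg]
            have : (κ * σ x) ^ 2 / (4 * ε) + ε - κ * σ x = (κ * σ x - 2 * ε) ^ 2 / (4 * ε) := by
              field_simp; ring
            rw [this]; positivity
          calc _ ≤ κ * (κ * σ x) := h5
            _ ≤ κ * ((κ * σ x) ^ 2 / (4 * ε) + ε) := by gcongr
            _ = _ := by ring
        have e1 : (√(1 - Real.sin x) * κ * (Real.sin x - μ) * v x * σ x ^ 2) ^ 2
            = (1 - Real.sin x) * (κ * v x * σ x) ^ 2 * ((Real.sin x - μ) * σ x) ^ 2 := by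
          have := Real.sq_sqrt hp
          linear_combination (κ * (Real.sin x - μ) * v x * σ x ^ 2) ^ 2 * this
        rw [e1]
        calc _ ≤ (1 - Real.sin x) * (κ * v x * σ x) ^ 2 * 1 := by gcongr
          _ ≤ (δ + |Real.sin x - μ|) * (κ * v x * σ x) ^ 2 := by rw [mul_one]; gcongr
          _ = δ * (κ * v x * σ x) ^ 2 + v x ^ 2 * (|Real.sin x - μ| * (κ * σ x) ^ 2) := by ring
          _ ≤ δ * (κ * v x * σ x) ^ 2 + v x ^ 2 * (κ / (4 * ε) * (κ * σ x) ^ 2 + κ * ε) := by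
            gcongr
          _ = _ := by ring
    _ = (δ + κ / (4 * ε)) * (pint fun x => (κ * v x * σ x) ^ 2) + κ * ε * pint fun x => v x ^ 2 := by
        rw [pint_add (by fun_prop) (by fun_prop), pint_const_mul, pint_const_mul]
    _ ≤ (δ + κ / (4 * ε)) * (ε ^ 2 * V ^ 2) + κ * ε * V ^ 2 := by gcongr
    _ = (δ * ε ^ 2 + 5 / 4 * κ * ε) * V ^ 2 := by field_simp; ring
    _ ≤ 3 * ε * δ * V ^ 2 := by
        gcongr
        have h1 : κ * ε ≤ δ * ε := mul_le_mul_of_nonneg_right hs.κ_le hε.le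
        have h2 : δ * ε * ε ≤ δ * ε * 1 := by gcongr
        nlinarith [mul_pos hδ hε]

/-- The mass of `ψ` at the critical points is small. -/
lemma layer_mass_le (hs : LayerScale μ δ κ d)
    (h : RayleighSol μ κ d m η V ψ ψ₁ ψ₂ ψ₃ h₁ h₂ h₂') (hε : 0 < ε) (hε1 : ε ≤ 1)
    (hE : nrm (fun x => κ * (ψ₂ x - m * ψ x) * wt μ κ x) ≤ ε * V) :
    μ * nrm (fun x => √(1 - Real.sin x) * κ * ψ x * wt μ κ x ^ 2) ^ 2
      ≤ nrm (fun x => √(1 - Real.sin x) * κ * ψ x * wt μ κ x ^ 2)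
          * ((√(3 * ε * δ) + η * √(2 * δ)) * V)
        + 28 * η * δ * V * (nrm (fun x => ψ x * wt μ κ x) + V) := by
  have cσ := hs.continuous_wt
  have c0 := h.cont
  have c1 := h.cont₁
  have c2 := h.cont₂
  have hd := hs.d_pos
  have hκ := hs.κ_pos
  have hδ := hs.δ_pos
  have hη := h.η_nonneg
  have hS := h.nrm_deriv_le hs
  have hlay := pint_layer_abs_le hs (by fun_prop) h.v_le hε hε1 hE
  set σ := wt μ κ with hσ
  set X := nrm (fun x => ψ x * σ x) with hX
  set J := nrm (fun x => √(1 - Real.sin x) * κ * ψ x * σ x ^ 2) with hJ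
  have hX0 : 0 ≤ X := nrm_nonneg _
  have hJ0 : 0 ≤ J := nrm_nonneg _
  have hV := h.V_nonneg
  have hp : ∀ x, 0 ≤ 1 - Real.sin x := fun x => by linarith [Real.sin_le_one x]
  have hσ0 : ∀ x, 0 < σ x := hs.wt_pos
  -- The test function is ψ times κ²σ⁴, a regularized delta on |sin - μ| ≲ κ, with the weight 1 -
  -- sin that occurs in the coercive identity. The term μψ tested with it is μJ².
  have der : ∀ x, HasDerivAt (fun x => (1 - Real.sin x) * κ ^ 2 * σ x ^ 4 * ψ x)
      ((1 - Real.sin x) * κ ^ 2 * σ x ^ 4 * ψ₁ x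
        + (-(Real.cos x * κ ^ 2 * σ x ^ 4 * ψ x)
        + -(4 * (1 - Real.sin x) * κ ^ 2 * (Real.sin x - μ) * Real.cos x * σ x ^ 6 * ψ x))) x := by
    intro x
    refine (((((Real.hasDerivAt_sin x).const_sub 1).mul_const (κ ^ 2)).mul
      ((hs.hasDerivAt_wt x).pow 4)).mul (h.der x)).congr_deriv ?_
    simp only [← hσ, Pi.pow_apply, Pi.mul_apply]
    push_cast
    ring
  have bm : ∀ x, |(1 - Real.sin x) * κ ^ 2 * σ x ^ 3| ≤ 2 * (δ / κ) := by
    intro x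
    have e : (1 - Real.sin x) * κ ^ 2 * σ x ^ 3
        = ((1 - Real.sin x) * κ * σ x) * (κ * σ x ^ 2) := by ring
    have h1 : |κ * σ x ^ 2| ≤ 1 / κ := by
      rw [abs_of_pos (mul_pos hκ (pow_pos (hσ0 x) 2))]
      calc κ * σ x ^ 2 = (κ * σ x) * σ x := by ring
        _ ≤ 1 * (1 / κ) := mul_le_mul (hs.κ_mul_wt_le x) (hs.wt_le x) (hσ0 x).le zero_le_one
        _ = _ := one_mul _
    rw [e, abs_mul]
    calc _ ≤ 2 * δ * (1 / κ) :=
          mul_le_mul (hs.one_sub_sin_mul_wt_le x) h1 (abs_nonneg _) (by positivity)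
      _ = _ := by ring
  have bφ : nrm (fun x => (1 - Real.sin x) * κ ^ 2 * σ x ^ 4 * ψ x) ≤ √(2 * δ) / κ * J := by
    refine nrm_le_mul (by fun_prop) (by fun_prop) (by positivity) fun x => ?_
    refine abs_le_mul_of_eq' (a := √(1 - Real.sin x) * κ * σ x ^ 2) ?_ ?_
    · linear_combination (-(κ ^ 2 * σ x ^ 4 * ψ x)) * Real.sq_sqrt (hp x)
    · rw [abs_of_nonneg (by have := hσ0 x; positivity)]
      rw [le_div_iff₀ hκ]
      refine Real.le_sqrt_of_sq_le ?_
      have e : (√(1 - Real.sin x) * κ * σ x ^ 2 * κ) ^ 2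
          = ((1 - Real.sin x) * κ * σ x) * (κ * σ x) ^ 3 := by
        linear_combination (κ ^ 4 * σ x ^ 4) * Real.sq_sqrt (hp x)
      rw [e]
      have h1 := (le_abs_self _).trans (hs.one_sub_sin_mul_wt_le x)
      have h2 : (κ * σ x) ^ 3 ≤ 1 :=
        pow_le_one₀ (mul_nonneg hκ.le (hσ0 x).le) (hs.κ_mul_wt_le x)
      calc _ ≤ 2 * δ * 1 :=
            mul_le_mul h1 h2 (pow_nonneg (mul_nonneg hκ.le (hσ0 x).le) 3) (by positivity)
        _ = _ := mul_one _
  -- A factor (δ/κ)/d is lost; the prefactor ηκV·d in `test_le` turns it into ηδV.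
  have bφ' : nrm (fun x => (1 - Real.sin x) * κ ^ 2 * σ x ^ 4 * ψ₁ x
        + (-(Real.cos x * κ ^ 2 * σ x ^ 4 * ψ x)
        + -(4 * (1 - Real.sin x) * κ ^ 2 * (Real.sin x - μ) * Real.cos x * σ x ^ 6 * ψ x)))
      ≤ 28 * (δ / κ) / d * (X + V) := by
    have n1 : nrm (fun x => (1 - Real.sin x) * κ ^ 2 * σ x ^ 4 * ψ₁ x)
        ≤ 2 * (δ / κ) * nrm fun x => ψ₁ x * σ x :=
      nrm_le_mul (by fun_prop) (by fun_prop) (by positivity) fun x =>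
        abs_le_mul_of_eq' (a := (1 - Real.sin x) * κ ^ 2 * σ x ^ 3) (by ring) (bm x)
    have hκσ : ∀ x, (κ * σ x) ^ 2 ≤ 1 := fun x =>
      pow_le_one₀ (mul_nonneg hκ.le (hσ0 x).le) (hs.κ_mul_wt_le x)
    have n2 : nrm (fun x => -(Real.cos x * κ ^ 2 * σ x ^ 4 * ψ x)) ≤ 2 / d * X :=
      nrm_le_mul (by fun_prop) (by fun_prop) (by positivity) fun x =>
        abs_le_mul_of_eq' (a := -((Real.cos x * σ x) * (κ * σ x) ^ 2)) (by ring) (by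
          rw [abs_neg, abs_mul, abs_of_nonneg (sq_nonneg (κ * σ x))]
          calc _ ≤ 2 / d * 1 := mul_le_mul (hs.abs_cos_mul_wt_le x) (hκσ x) (sq_nonneg _)
                (by positivity)
            _ = _ := mul_one _)
    have n3 : nrm (fun x => -(4 * (1 - Real.sin x) * κ ^ 2 * (Real.sin x - μ) * Real.cos x
          * σ x ^ 6 * ψ x)) ≤ 16 * (δ / κ) / d * X :=
      nrm_le_mul (by fun_prop) (by fun_prop) (by positivity) fun x =>
        abs_le_mul_of_eq' (a := -(4 * ((1 - Real.sin x) * κ ^ 2 * σ x ^ 3) *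
            ((Real.cos x * σ x) * ((Real.sin x - μ) * σ x)))) (by ring) (by
          rw [abs_neg, abs_mul, abs_mul, abs_mul (Real.cos x * σ x)]
          have e1 := mul_le_mul (hs.abs_cos_mul_wt_le x) (hs.abs_mul_wt_le x) (abs_nonneg _)
            (by positivity)
          have e2 := mul_le_mul (bm x) e1 (by positivity) (by positivity)
          calc _ = 4 * (|(1 - Real.sin x) * κ ^ 2 * σ x ^ 3| *
                (|Real.cos x * σ x| * |(Real.sin x - μ) * σ x|)) := by
                  rw [abs_of_pos (by norm_num : (0 : ℝ) < 4)]; ring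
            _ ≤ 4 * (2 * (δ / κ) * (2 / d * 1)) := by gcongr
            _ = _ := by ring)
    have hD := hs.one_le_ratio
    have n4 := nrm_add_le (f := fun x => -(Real.cos x * κ ^ 2 * σ x ^ 4 * ψ x))
      (g := fun x => -(4 * (1 - Real.sin x) * κ ^ 2 * (Real.sin x - μ) * Real.cos x
          * σ x ^ 6 * ψ x)) (by fun_prop) (by fun_prop)
    refine (nrm_add_le (by fun_prop) (by fun_prop)).trans ?_
    have n5 : 2 * (δ / κ) * nrm (fun x => ψ₁ x * σ x) ≤ 2 * (δ / κ) * (5 / d * (X + V)) := by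
      gcongr
    have n6 : 2 / d * X ≤ 2 * (δ / κ) / d * X := by gcongr; linarith
    have n7 : 0 ≤ (δ / κ) / d * V := by positivity
    calc _ ≤ 2 * (δ / κ) * (5 / d * (X + V)) + (2 * (δ / κ) / d * X + 16 * (δ / κ) / d * X) := by
          linarith
      _ = 28 * (δ / κ) / d * (X + V) - 18 * ((δ / κ) / d * V) := by ring
      _ ≤ _ := by linarith
  have ht := h.test_le hκ.le hd.le der (by fun_prop) (by
    intro x
    simp only [h.per x, Real.sin_add_two_pi, hσ, periodic_wt μ κ x]) bφ bφ'
  -- The weight 1 - sin is split evenly into square roots, so that the first factor is the one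
  -- bounded by `pint_layer_abs_le` and the second is the density of J.
  have e : (pint fun x => ((Real.sin x - μ) * (ψ₂ x - m * ψ x) + μ * ψ x) *
      ((1 - Real.sin x) * κ ^ 2 * σ x ^ 4 * ψ x))
      = (pint fun x => (√(1 - Real.sin x) * κ * (Real.sin x - μ) * (ψ₂ x - m * ψ x) * σ x ^ 2)
          * (√(1 - Real.sin x) * κ * ψ x * σ x ^ 2)) + μ * J ^ 2 := by
    rw [hJ, nrm_sq, ← pint_const_mul, ← pint_add (by fun_prop) (by fun_prop)]
    congr 1; funext x
    linear_combination (-(κ ^ 2 * σ x ^ 4 * ψ x *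
      ((Real.sin x - μ) * (ψ₂ x - m * ψ x) + μ * ψ x))) * Real.sq_sqrt (hp x)
  rw [e] at ht
  have b1 : |pint fun x => (√(1 - Real.sin x) * κ * (Real.sin x - μ) * (ψ₂ x - m * ψ x) * σ x ^ 2)
          * (√(1 - Real.sin x) * κ * ψ x * σ x ^ 2)| ≤ 1 * (√(3 * ε * δ) * V * J) := by
    refine (abs_pint_le_mul (by fun_prop) (by fun_prop) (by fun_prop) zero_le_one
      fun x => ?_).trans (mul_le_mul_of_nonneg_left (mul_le_mul_of_nonneg_right hlay hJ0)
        zero_le_one)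
    rw [abs_mul, one_mul]
  have h1 := neg_le_of_abs_le b1
  have h2 := le_of_abs_le ht
  have e3 : η * κ * V * (√(2 * δ) / κ * J + d * (28 * (δ / κ) / d * (X + V)))
      = η * √(2 * δ) * V * J + 28 * η * δ * V * (X + V) := by
    field_simp
  rw [e3] at h2
  linarith

end RayleighSol

/-! ### The coercive identity -/

namespace RayleighSol

variable {ψ ψ₁ ψ₂ ψ₃ h₁ h₂ h₂' : ℝ → ℝ} {μ δ κ d m η V ε : ℝ}

/-- The coercive identity, obtained by testing with `(ψ / 2 - cos ψ') / (sin - μ)`. -/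
lemma coercive_le (hs : LayerScale μ δ κ d)
    (h : RayleighSol μ κ d m η V ψ ψ₁ ψ₂ ψ₃ h₁ h₂ h₂') (hε : 0 < ε)
    (hE : nrm (fun x => κ * (ψ₂ x - m * ψ x) * wt μ κ x) ≤ ε * V) :
    1 / 2 * (pint fun x => (1 + Real.sin x) * ψ₁ x ^ 2)
      + μ / 2 * (pint fun x => (1 - Real.sin x) * (ψ x * wt μ κ x) ^ 2)
      ≤ 2 * μ * nrm (fun x => √(1 - Real.sin x) * κ * ψ x * wt μ κ x ^ 2) ^ 2
        + (44 * η + 12 * ε) * δ * V * (nrm (fun x => ψ x * wt μ κ x) + V) := by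
  have cσ := hs.continuous_wt
  have c0 := h.cont
  have c1 := h.cont₁
  have c2 := h.cont₂
  have hd := hs.d_pos
  have hκ := hs.κ_pos
  have hδ := hs.δ_pos
  have hμ := hs.mu_pos
  have hη := h.η_nonneg
  have hm := h.m_nonneg
  have hS := h.nrm_deriv_le hs
  have hY := h.nrm_cos_deriv_le hs
  have hV := h.V_nonneg
  have hrel := hs.wt_sq_mul
  set σ := wt μ κ with hσ
  set X := nrm (fun x => ψ x * σ x) with hX
  set J := nrm (fun x => √(1 - Real.sin x) * κ * ψ x * σ x ^ 2) with hJ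
  set Y := nrm (fun x => Real.cos x * ψ₁ x * σ x) with hYdef
  set S := nrm (fun x => ψ₁ x * σ x) with hSdef
  have hX0 : 0 ≤ X := nrm_nonneg _
  have hY0 : 0 ≤ Y := nrm_nonneg _
  have hp : ∀ x, 0 ≤ 1 - Real.sin x := fun x => by linarith [Real.sin_le_one x]
  have hσ0 : ∀ x, 0 < σ x := hs.wt_pos
  -- (sin - μ)σ² stands in for the singular multiplier 1/(sin - μ).
  have derk : ∀ x, HasDerivAt (fun x => (Real.sin x - μ) * σ x ^ 2)
      (Real.cos x * σ x ^ 2 * (1 - 2 * ((Real.sin x - μ) * σ x) ^ 2)) x := by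
    intro x
    refine ((((Real.hasDerivAt_sin x).sub_const μ).mul
      ((hs.hasDerivAt_wt x).pow 2))).congr_deriv ?_
    simp only [← hσ, Pi.pow_apply]
    push_cast
    ring
  have derφ : ∀ x, HasDerivAt
      (fun x => (Real.sin x - μ) * σ x ^ 2 * (1 / 2 * ψ x - Real.cos x * ψ₁ x))
      (Real.cos x * σ x ^ 2 * (1 - 2 * ((Real.sin x - μ) * σ x) ^ 2)
          * (1 / 2 * ψ x - Real.cos x * ψ₁ x)
        + (Real.sin x - μ) * σ x ^ 2
          * ((1 / 2 + Real.sin x) * ψ₁ x - Real.cos x * ψ₂ x)) x := by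
    intro x
    refine ((derk x).mul (((h.der x).const_mul (1 / 2)).sub
      ((Real.hasDerivAt_cos x).mul (h.der₁ x)))).congr_deriv ?_
    simp only [Pi.sub_apply, Pi.mul_apply]
    ring
  have hk : ∀ x, |(Real.sin x - μ) * σ x| ≤ 1 := hs.abs_mul_wt_le
  have hk' : ∀ x, |1 - 2 * ((Real.sin x - μ) * σ x) ^ 2| ≤ 1 := fun x => by
    have := (sq_le_one_iff_abs_le_one _).2 (hk x)
    rw [abs_le]
    constructor <;> nlinarith [sq_nonneg ((Real.sin x - μ) * σ x)]
  have hc : ∀ x, |Real.cos x * σ x| ≤ 2 / d := hs.abs_cos_mul_wt_le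
  have bφ : nrm (fun x => (Real.sin x - μ) * σ x ^ 2 * (1 / 2 * ψ x - Real.cos x * ψ₁ x))
      ≤ X + Y := by
    have e : (fun x => (Real.sin x - μ) * σ x ^ 2 * (1 / 2 * ψ x - Real.cos x * ψ₁ x))
        = fun x => (Real.sin x - μ) * σ x * (1 / 2) * (ψ x * σ x)
          + (-((Real.sin x - μ) * σ x)) * (Real.cos x * ψ₁ x * σ x) := by funext x; ring
    rw [e]
    have n1 : nrm (fun x => (Real.sin x - μ) * σ x * (1 / 2) * (ψ x * σ x)) ≤ 1 * X :=
      nrm_le_mul (by fun_prop) (by fun_prop) zero_le_one fun x => by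
        refine abs_le_mul_of_eq' rfl ?_
        rw [abs_mul, abs_of_pos (by norm_num : (0 : ℝ) < 1 / 2)]
        linarith [hk x]
    have n2 : nrm (fun x => (-((Real.sin x - μ) * σ x)) * (Real.cos x * ψ₁ x * σ x)) ≤ 1 * Y :=
      nrm_le_mul (by fun_prop) (by fun_prop) zero_le_one fun x =>
        abs_le_mul_of_eq' rfl (by rw [abs_neg]; exact hk x)
    refine (nrm_add_le (by fun_prop) (by fun_prop)).trans ?_
    linarith
  have bφ' : nrm (fun x => Real.cos x * σ x ^ 2 * (1 - 2 * ((Real.sin x - μ) * σ x) ^ 2)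
          * (1 / 2 * ψ x - Real.cos x * ψ₁ x)
        + (Real.sin x - μ) * σ x ^ 2
          * ((1 / 2 + Real.sin x) * ψ₁ x - Real.cos x * ψ₂ x))
      ≤ 32 * (δ / κ) / d * (X + V) := by
    have e : (fun x => Real.cos x * σ x ^ 2 * (1 - 2 * ((Real.sin x - μ) * σ x) ^ 2)
          * (1 / 2 * ψ x - Real.cos x * ψ₁ x)
        + (Real.sin x - μ) * σ x ^ 2
          * ((1 / 2 + Real.sin x) * ψ₁ x - Real.cos x * ψ₂ x))
      = fun x => ((Real.cos x * σ x) * (1 - 2 * ((Real.sin x - μ) * σ x) ^ 2) * (1 / 2)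
            * (ψ x * σ x)
          + -((Real.cos x * σ x) * (1 - 2 * ((Real.sin x - μ) * σ x) ^ 2))
            * (Real.cos x * ψ₁ x * σ x))
        + (((Real.sin x - μ) * σ x) * (1 / 2 + Real.sin x) * (ψ₁ x * σ x)
          + -(((Real.sin x - μ) * σ x) * (Real.cos x * σ x)) * ψ₂ x) := by funext x; ring
    rw [e]
    have hcc : ∀ x, |(Real.cos x * σ x) * (1 - 2 * ((Real.sin x - μ) * σ x) ^ 2)| ≤ 2 / d := by
      intro x
      rw [abs_mul]
      exact (mul_le_mul (hc x) (hk' x) (abs_nonneg _) (by positivity)).trans_eq (mul_one _)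
    have n1 : nrm (fun x => (Real.cos x * σ x) * (1 - 2 * ((Real.sin x - μ) * σ x) ^ 2) * (1 / 2)
            * (ψ x * σ x)) ≤ 1 / d * X :=
      nrm_le_mul (by fun_prop) (by fun_prop) (by positivity) fun x => by
        refine abs_le_mul_of_eq' rfl ?_
        rw [abs_mul, abs_of_pos (by norm_num : (0 : ℝ) < 1 / 2)]
        have := hcc x
        have e : 2 / d = 2 * (1 / d) := by ring
        linarith
    have n2 : nrm (fun x => -((Real.cos x * σ x) * (1 - 2 * ((Real.sin x - μ) * σ x) ^ 2))
            * (Real.cos x * ψ₁ x * σ x)) ≤ 2 / d * Y :=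
      nrm_le_mul (by fun_prop) (by fun_prop) (by positivity) fun x =>
        abs_le_mul_of_eq' rfl (by rw [abs_neg]; exact hcc x)
    have n3 : nrm (fun x => ((Real.sin x - μ) * σ x) * (1 / 2 + Real.sin x) * (ψ₁ x * σ x))
        ≤ 3 / 2 * S :=
      nrm_le_mul (by fun_prop) (by fun_prop) (by positivity) fun x => by
        refine abs_le_mul_of_eq' rfl ?_
        rw [abs_mul]
        have : |1 / 2 + Real.sin x| ≤ 3 / 2 := by
          rw [abs_le]; constructor <;> linarith [Real.sin_le_one x, Real.neg_one_le_sin x]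
        exact (mul_le_mul (hk x) this (abs_nonneg _) zero_le_one).trans_eq (one_mul _)
    have n4 : nrm (fun x => -(((Real.sin x - μ) * σ x) * (Real.cos x * σ x)) * ψ₂ x)
        ≤ 2 / d * nrm ψ₂ :=
      nrm_le_mul (by fun_prop) (by fun_prop) (by positivity) fun x => by
        refine abs_le_mul_of_eq' rfl ?_
        rw [abs_neg, abs_mul]
        exact (mul_le_mul (hk x) (hc x) (abs_nonneg _) zero_le_one).trans_eq (one_mul _)
    have n5 := h.ψ₂_le
    have n6 : 2 / d * nrm ψ₂ ≤ 2 / d * V := by gcongr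
    have n7 : 2 / d * Y ≤ 2 / d * (11 * (δ / κ) * (X + V)) := by gcongr
    have n8 := nrm_add_le (f := fun x => (Real.cos x * σ x)
        * (1 - 2 * ((Real.sin x - μ) * σ x) ^ 2) * (1 / 2) * (ψ x * σ x))
      (g := fun x => -((Real.cos x * σ x) * (1 - 2 * ((Real.sin x - μ) * σ x) ^ 2))
            * (Real.cos x * ψ₁ x * σ x)) (by fun_prop) (by fun_prop)
    have n9 := nrm_add_le (f := fun x => ((Real.sin x - μ) * σ x) * (1 / 2 + Real.sin x)
        * (ψ₁ x * σ x))
      (g := fun x => -(((Real.sin x - μ) * σ x) * (Real.cos x * σ x)) * ψ₂ x)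
      (by fun_prop) (by fun_prop)
    have hD := hs.one_le_ratio
    refine (nrm_add_le (by fun_prop) (by fun_prop)).trans ?_
    have n10 : 10 / d * (X + V) ≤ 10 * (δ / κ) / d * (X + V) := by
      gcongr; linarith
    calc _ ≤ (1 / d * X + 2 / d * (11 * (δ / κ) * (X + V)))
          + (3 / 2 * (5 / d * (X + V)) + 2 / d * V) := by linarith
      _ ≤ 10 / d * (X + V) + 22 * (δ / κ) / d * (X + V) := by
          have : 0 ≤ 1 / d * X := by positivity
          have : 0 ≤ 1 / d * V := by positivity
          have e : 10 / d * (X + V) + 22 * (δ / κ) / d * (X + V)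
              - ((1 / d * X + 2 / d * (11 * (δ / κ) * (X + V)))
                + (3 / 2 * (5 / d * (X + V)) + 2 / d * V))
              = 3 / 2 * (1 / d * X) + 1 / 2 * (1 / d * V) := by ring
          linarith
      _ ≤ 10 * (δ / κ) / d * (X + V) + 22 * (δ / κ) / d * (X + V) := by linarith
      _ = _ := by ring
  have ht := h.test_le hκ.le hd.le derφ (by fun_prop) (by
    intro x
    simp only [h.per x, h.per₁ x, Real.sin_add_two_pi, Real.cos_add_two_pi, hσ,
      periodic_wt μ κ x]) bφ bφ'
  -- In ψ/2 - cos ψ' the coefficients are chosen so that (ψ'' - mψ)(ψ/2 - cos ψ') integrates to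
  -- -½∫(1 + sin)ψ'² - (m/2)∫(1 - sin)ψ². Regularization leaves errors with κ²σ², because (sin -
  -- μ)²σ² = 1 - κ²σ². Those containing v are small by `hE`; the last term, the only quadratic form
  -- in ψ with the opposite sign, is bounded by 2μJ².
  have derΦ : ∀ x, HasDerivAt (fun x => -(1 / 2) * (ψ₁ x * ψ x)
        + 1 / 2 * (Real.cos x * ψ₁ x ^ 2) - m / 2 * (Real.cos x * ψ x ^ 2)
        + μ / 2 * ((Real.sin x - μ) * σ x ^ 2 * (Real.cos x * ψ x ^ 2)))
      (((((((-(((Real.sin x - μ) * (ψ₂ x - m * ψ x) + μ * ψ x)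
          * ((Real.sin x - μ) * σ x ^ 2 * (1 / 2 * ψ x - Real.cos x * ψ₁ x))))
        - 1 / 2 * (κ ^ 2 * σ x ^ 2 * (ψ₂ x - m * ψ x) * ψ x))
        + κ ^ 2 * σ x ^ 2 * Real.cos x * (ψ₂ x - m * ψ x) * ψ₁ x)
        - 1 / 2 * ((1 + Real.sin x) * ψ₁ x ^ 2))
        - m / 2 * ((1 - Real.sin x) * ψ x ^ 2))
        - μ * (1 + μ) / 2 * ((1 - Real.sin x) * (ψ x * σ x) ^ 2))
        + μ * ((1 - Real.sin x) * (1 + Real.sin x) * (κ * ψ x * σ x ^ 2) ^ 2)) x := by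
    intro x
    have t1 := ((h.der₁ x).mul (h.der x)).const_mul (-(1 / 2))
    have t2 := ((Real.hasDerivAt_cos x).mul ((h.der₁ x).pow 2)).const_mul (1 / 2)
    have t3 := ((Real.hasDerivAt_cos x).mul ((h.der x).pow 2)).const_mul (m / 2)
    have t4 := ((derk x).mul ((Real.hasDerivAt_cos x).mul ((h.der x).pow 2))).const_mul (μ / 2)
    refine (((t1.add t2).sub t3).add t4).congr_deriv ?_
    simp only [Pi.pow_apply, Pi.mul_apply]
    push_cast
    linear_combination
      (μ / 2 * σ x ^ 2 * (1 - 2 * ((Real.sin x - μ) * σ x) ^ 2) * ψ x ^ 2)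
        * Real.sin_sq_add_cos_sq x
      + ((ψ₂ x - m * ψ x) * (1 / 2 * ψ x - Real.cos x * ψ₁ x)
        - μ * σ x ^ 2 * ψ x ^ 2 * (1 - Real.sin x) * (1 + Real.sin x)) * hrel x
  have h0 := pint_deriv_eq_zero derΦ (by fun_prop) (by
    intro x
    simp only [h.per x, h.per₁ x, Real.sin_add_two_pi, Real.cos_add_two_pi, hσ,
      periodic_wt μ κ x])
  rw [pint_add (by fun_prop) (by fun_prop), pint_sub (by fun_prop) (by fun_prop),
    pint_sub (by fun_prop) (by fun_prop), pint_sub (by fun_prop) (by fun_prop),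
    pint_add (by fun_prop) (by fun_prop), pint_sub (by fun_prop) (by fun_prop),
    pint_neg, pint_const_mul, pint_const_mul, pint_const_mul, pint_const_mul,
    pint_const_mul] at h0
  have b1 : |pint fun x => κ ^ 2 * σ x ^ 2 * (ψ₂ x - m * ψ x) * ψ x| ≤ κ * (ε * V * X) := by
    refine (abs_pint_le_mul (f := fun x => κ * (ψ₂ x - m * ψ x) * σ x)
      (g := fun x => ψ x * σ x) (by fun_prop) (by fun_prop) (by fun_prop) hκ.le
      fun x => abs_le_mul_of_eq (a := κ) (by ring) (abs_of_pos hκ).le).trans ?_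
    gcongr
  have b2 : |pint fun x => κ ^ 2 * σ x ^ 2 * Real.cos x * (ψ₂ x - m * ψ x) * ψ₁ x|
      ≤ κ * (ε * V * Y) := by
    refine (abs_pint_le_mul (f := fun x => κ * (ψ₂ x - m * ψ x) * σ x)
      (g := fun x => Real.cos x * ψ₁ x * σ x) (by fun_prop) (by fun_prop) (by fun_prop) hκ.le
      fun x => abs_le_mul_of_eq (a := κ) (by ring) (abs_of_pos hκ).le).trans ?_
    gcongr
  have b3 : (pint fun x => (1 - Real.sin x) * (1 + Real.sin x) * (κ * ψ x * σ x ^ 2) ^ 2)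
      ≤ 2 * J ^ 2 := by
    rw [hJ, nrm_sq, ← pint_const_mul]
    refine pint_mono (by fun_prop) (by fun_prop) fun x => ?_
    have e : 2 * (√(1 - Real.sin x) * κ * ψ x * σ x ^ 2) ^ 2
        = (1 - Real.sin x) * 2 * (κ * ψ x * σ x ^ 2) ^ 2 := by
      linear_combination (2 * (κ * ψ x * σ x ^ 2) ^ 2) * Real.sq_sqrt (hp x)
    rw [e]
    have := hp x
    gcongr
    linarith
  have b4 : 0 ≤ pint fun x => (1 - Real.sin x) * ψ x ^ 2 :=
    pint_nonneg fun x => mul_nonneg (hp x) (sq_nonneg _)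
  have b5 : 0 ≤ pint fun x => (1 - Real.sin x) * (ψ x * σ x) ^ 2 :=
    pint_nonneg fun x => mul_nonneg (hp x) (sq_nonneg _)
  have b6 : μ / 2 * (pint fun x => (1 - Real.sin x) * (ψ x * σ x) ^ 2)
      ≤ μ * (1 + μ) / 2 * (pint fun x => (1 - Real.sin x) * (ψ x * σ x) ^ 2) := by
    gcongr
    nlinarith
  have b7 := mul_nonneg hm b4
  have b8 := mul_le_mul_of_nonneg_left b3 hμ.le
  have b9 := neg_le_of_abs_le b1
  have b10 := le_of_abs_le b2
  have b11 := neg_le_of_abs_le ht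
  have b12 : κ * (ε * V * Y) ≤ κ * (ε * V * (11 * (δ / κ) * (X + V))) := by gcongr
  have b13 : κ * (ε * V * X) ≤ δ * (ε * V * X) := by
    have := hs.κ_le
    gcongr
  have b14 : η * κ * V * (X + Y + d * (32 * (δ / κ) / d * (X + V)))
      ≤ η * κ * V * (X + 11 * (δ / κ) * (X + V) + d * (32 * (δ / κ) / d * (X + V))) := by
    gcongr
  have b15 : η * κ * V * (X + 11 * (δ / κ) * (X + V) + d * (32 * (δ / κ) / d * (X + V)))
      = η * V * (κ * X) + 43 * η * δ * V * (X + V) := by field_simp; ring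
  have b16 : κ * (ε * V * (11 * (δ / κ) * (X + V))) = 11 * ε * δ * V * (X + V) := by
    field_simp
  have b17 : η * V * (κ * X) ≤ η * V * (δ * X) := by
    have := hs.κ_le
    gcongr
  have b18 : 0 ≤ δ * (η * V * V) := by positivity
  have b19 : 0 ≤ δ * (ε * V * V) := by positivity
  have b20 : 0 ≤ δ * (ε * V * X) := by positivity
  linarith

end RayleighSol

/-! ### A Hardy inequality at the maximum of the sine -/

lemma two_mul_le_of_mul_eq_sq {a b c x y : ℝ} (ha : 0 ≤ a) (hb : 0 ≤ b) (h : a * b = c ^ 2) :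
    2 * (c * x * y) ≤ a * x ^ 2 + b * y ^ 2 := by
  have hc : c ^ 2 = (√a * √b) ^ 2 := by
    rw [mul_pow, Real.sq_sqrt ha, Real.sq_sqrt hb, h]
  have h1 := Real.sq_sqrt ha
  have h2 := Real.sq_sqrt hb
  rcases sq_eq_sq_iff_eq_or_eq_neg.1 hc with h3 | h3
  · have e : a * x ^ 2 + b * y ^ 2 - 2 * (c * x * y) = (√a * x - √b * y) ^ 2 := by
      rw [h3]; linear_combination (-x ^ 2) * h1 + (-y ^ 2) * h2
    nlinarith [sq_nonneg (√a * x - √b * y)]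
  · have e : a * x ^ 2 + b * y ^ 2 - 2 * (c * x * y) = (√a * x + √b * y) ^ 2 := by
      rw [h3]; linear_combination (-x ^ 2) * h1 + (-y ^ 2) * h2
    nlinarith [sq_nonneg (√a * x + √b * y)]

/-- A Hardy-type inequality for the weight `(sin - μ)² + κ²`. -/
lemma LayerScale.hardy {μ δ κ d : ℝ} (hs : LayerScale μ δ κ d) {ψ ψ₁ : ℝ → ℝ}
    (hp : Function.Periodic ψ (2 * Real.pi)) (der : ∀ x, HasDerivAt ψ (ψ₁ x) x)
    (c1 : Continuous ψ₁) :
    δ * nrm (fun x => ψ x * wt μ κ x) ^ 2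
      ≤ 9 * (pint fun x => (1 + Real.sin x) * ψ₁ x ^ 2)
        + 56 * pint fun x => (1 - Real.sin x) * (ψ x * wt μ κ x) ^ 2 := by
  have cσ := hs.continuous_wt
  have c0 : Continuous ψ := continuous_iff_continuousAt.2 fun x => (der x).continuousAt
  have hδ := hs.δ_pos
  have hrel := hs.wt_sq_mul
  have hσ0 := hs.wt_pos
  set σ := wt μ κ with hσ
  have p0 : ∀ x, 0 ≤ 1 - Real.sin x := fun x => by linarith [Real.sin_le_one x]
  have q0 : ∀ x, 0 < δ + (1 - Real.sin x) := fun x => by linarith [p0 x]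
  -- The weight τ = 1/(δ + 1 - sin) is a surrogate for σ without critical points. It satisfies τ² ≤
  -- 2σ², and σ² ≤ 9τ² where 1 - sin < δ/2.
  obtain ⟨τ, hτ⟩ : ∃ τ : ℝ → ℝ, τ = fun x => (δ + (1 - Real.sin x))⁻¹ := ⟨_, rfl⟩
  have cτ : Continuous τ := by
    rw [hτ]
    exact Continuous.inv₀ (by fun_prop) fun x => (q0 x).ne'
  have hτ1 : ∀ x, τ x * (δ + (1 - Real.sin x)) = 1 := fun x => by
    rw [hτ]; exact inv_mul_cancel₀ (q0 x).ne'
  have hτ0 : ∀ x, 0 < τ x := fun x => by rw [hτ]; exact inv_pos.2 (q0 x)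
  have dτ : ∀ x, HasDerivAt τ (Real.cos x * τ x ^ 2) x := by
    intro x
    rw [hτ]
    refine ((((Real.hasDerivAt_sin x).const_sub 1).const_add δ).inv (q0 x).ne').congr_deriv ?_
    have := (q0 x).ne'
    simp only
    field_simp
  -- The function cos τ vanishes at the maximum of sin, and its derivative produces δτ² up to a term
  -- weighted by 1 - sin. The cross term is split using cos² = (1 + sin)(1 - sin), which is why the
  -- two degenerate weights suffice.
  have dΦ : ∀ x, HasDerivAt (fun x => -(Real.cos x * τ x * ψ x ^ 2))
      (((δ * (ψ x * τ x) ^ 2) - (1 + δ) * ((1 - Real.sin x) * (ψ x * τ x) ^ 2))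
        - 2 * (Real.cos x * ψ₁ x * (ψ x * τ x))) x := by
    intro x
    refine ((((Real.hasDerivAt_cos x).mul (dτ x)).mul ((der x).pow 2)).neg).congr_deriv ?_
    simp only [Pi.pow_apply, Pi.mul_apply]
    push_cast
    linear_combination (-(τ x ^ 2 * ψ x ^ 2)) * Real.sin_sq_add_cos_sq x
      + (-(Real.sin x * τ x * ψ x ^ 2)) * hτ1 x
  have h0 := pint_deriv_eq_zero dΦ (by fun_prop) (by
    intro x
    simp only [hτ, Real.sin_add_two_pi, Real.cos_add_two_pi, hp x])
  rw [pint_sub (by fun_prop) (by fun_prop), pint_sub (by fun_prop) (by fun_prop),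
    pint_const_mul, pint_const_mul, pint_const_mul] at h0
  have hab : ∀ x, (1 + Real.sin x) * (1 - Real.sin x) = Real.cos x ^ 2 := fun x => by
    nlinarith [Real.sin_sq_add_cos_sq x]
  have b1 : 2 * (pint fun x => Real.cos x * ψ₁ x * (ψ x * τ x))
      ≤ (pint fun x => (1 + Real.sin x) * ψ₁ x ^ 2)
        + pint fun x => (1 - Real.sin x) * (ψ x * τ x) ^ 2 := by
    rw [← pint_const_mul, ← pint_add (by fun_prop) (by fun_prop)]
    refine pint_mono (by fun_prop) (by fun_prop) fun x => ?_
    exact two_mul_le_of_mul_eq_sq (by linarith [Real.neg_one_le_sin x]) (p0 x) (hab x)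
  have hτσ : ∀ x, τ x ^ 2 ≤ 2 * σ x ^ 2 := by
    intro x
    have h1 : (Real.sin x - μ) ^ 2 + κ ^ 2 ≤ 2 * (δ + (1 - Real.sin x)) ^ 2 := by
      have := abs_le.1 hs.dist_le
      have h2 : (Real.sin x - μ) ^ 2 ≤ (δ + (1 - Real.sin x)) ^ 2 :=
        sq_le_sq' (by linarith) (by linarith [p0 x])
      have h3 : κ ^ 2 ≤ (δ + (1 - Real.sin x)) ^ 2 :=
        pow_le_pow_left₀ hs.κ_pos.le (by linarith [hs.κ_le, p0 x]) 2
      linarith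
    calc τ x ^ 2 = τ x ^ 2 * (σ x ^ 2 * ((Real.sin x - μ) ^ 2 + κ ^ 2)) := by
          rw [hrel x, mul_one]
      _ ≤ τ x ^ 2 * (σ x ^ 2 * (2 * (δ + (1 - Real.sin x)) ^ 2)) := by gcongr
      _ = 2 * σ x ^ 2 * (τ x * (δ + (1 - Real.sin x))) ^ 2 := by ring
      _ = 2 * σ x ^ 2 := by rw [hτ1]; ring
  have b2 : (pint fun x => (1 - Real.sin x) * (ψ x * τ x) ^ 2)
      ≤ 2 * pint fun x => (1 - Real.sin x) * (ψ x * σ x) ^ 2 := by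
    rw [← pint_const_mul]
    refine pint_mono (by fun_prop) (by fun_prop) fun x => ?_
    calc (1 - Real.sin x) * (ψ x * τ x) ^ 2 = (1 - Real.sin x) * ψ x ^ 2 * τ x ^ 2 := by ring
      _ ≤ (1 - Real.sin x) * ψ x ^ 2 * (2 * σ x ^ 2) :=
        mul_le_mul_of_nonneg_left (hτσ x) (mul_nonneg (p0 x) (sq_nonneg _))
      _ = _ := by ring
  have b2' : 0 ≤ pint fun x => (1 - Real.sin x) * (ψ x * τ x) ^ 2 :=
    pint_nonneg fun x => mul_nonneg (p0 x) (sq_nonneg _)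
  -- Where 1 - sin ≥ δ/2 the first term suffices. Otherwise either δ = 1 - μ and sin - μ ≥ δ/2, or κ
  -- = δ; in both cases σ ≤ 3τ.
  have hστ : ∀ x, δ * σ x ^ 2 ≤ 2 * (1 - Real.sin x) * σ x ^ 2 + 9 * δ * τ x ^ 2 := by
    intro x
    rcases le_or_gt (δ / 2) (1 - Real.sin x) with hc | hc
    · have : δ * σ x ^ 2 ≤ 2 * (1 - Real.sin x) * σ x ^ 2 := by gcongr; linarith
      have : 0 ≤ 9 * δ * τ x ^ 2 := by positivity
      linarith
    · have h1 : (δ + (1 - Real.sin x)) ^ 2 ≤ 9 * ((Real.sin x - μ) ^ 2 + κ ^ 2) := by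
        have h2 : (δ + (1 - Real.sin x)) ^ 2 ≤ (3 / 2 * δ) ^ 2 :=
          pow_le_pow_left₀ (q0 x).le (by linarith) 2
        rcases hs.alt with h3 | h3
        · have h4 : (δ / 2) ^ 2 ≤ (Real.sin x - μ) ^ 2 :=
            pow_le_pow_left₀ (by positivity) (by linarith) 2
          nlinarith [sq_nonneg κ]
        · rw [h3]
          nlinarith [sq_nonneg (Real.sin x - μ)]
      have h2 : σ x ^ 2 ≤ 9 * τ x ^ 2 := by
        calc σ x ^ 2 = σ x ^ 2 * (τ x * (δ + (1 - Real.sin x))) ^ 2 := by rw [hτ1]; ring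
          _ = σ x ^ 2 * τ x ^ 2 * (δ + (1 - Real.sin x)) ^ 2 := by ring
          _ ≤ σ x ^ 2 * τ x ^ 2 * (9 * ((Real.sin x - μ) ^ 2 + κ ^ 2)) := by gcongr
          _ = 9 * τ x ^ 2 * (σ x ^ 2 * ((Real.sin x - μ) ^ 2 + κ ^ 2)) := by ring
          _ = _ := by rw [hrel, mul_one]
      have : 0 ≤ 2 * (1 - Real.sin x) * σ x ^ 2 :=
        mul_nonneg (mul_nonneg zero_le_two (p0 x)) (sq_nonneg _)
      nlinarith
  have b3 : δ * nrm (fun x => ψ x * σ x) ^ 2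
      ≤ 2 * (pint fun x => (1 - Real.sin x) * (ψ x * σ x) ^ 2)
        + 9 * (δ * pint fun x => (ψ x * τ x) ^ 2) := by
    rw [nrm_sq, ← pint_const_mul, ← pint_const_mul, ← pint_const_mul, ← pint_const_mul,
      ← pint_add (by fun_prop) (by fun_prop)]
    refine pint_mono (by fun_prop) (by fun_prop) fun x => ?_
    have := mul_le_mul_of_nonneg_right (hστ x) (sq_nonneg (ψ x))
    nlinarith
  have b4 : (1 + δ) * (pint fun x => (1 - Real.sin x) * (ψ x * τ x) ^ 2)
      ≤ 2 * pint fun x => (1 - Real.sin x) * (ψ x * τ x) ^ 2 := by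
    gcongr
    linarith [hs.δ_le]
  linarith

/-! ### Control of v by ψ/(sin - μ) -/

namespace RayleighSol

variable {ψ ψ₁ ψ₂ ψ₃ h₁ h₂ h₂' : ℝ → ℝ} {μ δ κ d m η V ε : ℝ}

/-- The bound of `v` by the singular part `μ ψ / (sin - μ)`. -/
lemma sq_nrm_le (hs : LayerScale μ δ κ d)
    (h : RayleighSol μ κ d m η V ψ ψ₁ ψ₂ ψ₃ h₁ h₂ h₂')
    (hE : nrm (fun x => κ * (ψ₂ x - m * ψ x) * wt μ κ x) ≤ ε * V) :
    nrm (fun x => ψ₂ x - m * ψ x) ^ 2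
      ≤ (ε ^ 2 + 3 * η + η ^ 2) * V ^ 2 + μ * nrm (fun x => ψ x * wt μ κ x) * V := by
  have cσ := hs.continuous_wt
  have c0 := h.cont
  have c1 := h.cont₁
  have c2 := h.cont₂
  have c3 := h.cont₃
  have hd := hs.d_pos
  have hκ := hs.κ_pos
  have hμ := hs.mu_pos
  have hη := h.η_nonneg
  have hV := h.V_nonneg
  have hrel := hs.wt_sq_mul
  have hv := h.v_le
  have hv1 := h.v₁_le
  set σ := wt μ κ with hσ
  set X := nrm (fun x => ψ x * σ x) with hX
  have hX0 : 0 ≤ X := nrm_nonneg _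
  have hσ0 : ∀ x, 0 < σ x := hs.wt_pos
  have hk : ∀ x, |(Real.sin x - μ) * σ x| ≤ 1 := hs.abs_mul_wt_le
  have hk' : ∀ x, |1 - 2 * ((Real.sin x - μ) * σ x) ^ 2| ≤ 1 := fun x => by
    have := (sq_le_one_iff_abs_le_one _).2 (hk x)
    rw [abs_le]
    constructor <;> nlinarith [sq_nonneg ((Real.sin x - μ) * σ x)]
  have hσκ : ∀ x, |σ x| ≤ 1 / κ := fun x => by rw [abs_of_pos (hσ0 x)]; exact hs.wt_le x
  -- The test function is the regularization of v/(sin - μ). Since (sin - μ)²σ² = 1 - κ²σ², it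
  -- recovers the square norm of v minus that of κvσ.
  have der : ∀ x, HasDerivAt (fun x => (Real.sin x - μ) * σ x ^ 2 * (ψ₂ x - m * ψ x))
      ((Real.cos x * σ x) * (σ x * (1 - 2 * ((Real.sin x - μ) * σ x) ^ 2)) * (ψ₂ x - m * ψ x)
        + (Real.sin x - μ) * σ x * σ x * (ψ₃ x - m * ψ₁ x)) x := by
    intro x
    refine ((((Real.hasDerivAt_sin x).sub_const μ).mul
      ((hs.hasDerivAt_wt x).pow 2)).mul ((h.der₂ x).sub ((h.der x).const_mul m))).congr_deriv ?_
    simp only [← hσ, Pi.pow_apply, Pi.mul_apply, Pi.sub_apply]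
    push_cast
    ring
  have bφ : nrm (fun x => (Real.sin x - μ) * σ x ^ 2 * (ψ₂ x - m * ψ x)) ≤ 1 / κ * V := by
    refine (nrm_le_mul (g := fun x => ψ₂ x - m * ψ x) (by fun_prop) (by fun_prop)
      (by positivity : 0 ≤ 1 / κ) fun x => abs_le_mul_of_eq'
        (a := (Real.sin x - μ) * σ x * σ x) (by ring) ?_).trans (by gcongr)
    rw [abs_mul]
    exact (mul_le_mul (hk x) (hσκ x) (abs_nonneg _) zero_le_one).trans_eq (one_mul _)
  have bφ' : nrm (fun x => (Real.cos x * σ x) * (σ x * (1 - 2 * ((Real.sin x - μ) * σ x) ^ 2))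
          * (ψ₂ x - m * ψ x)
        + (Real.sin x - μ) * σ x * σ x * (ψ₃ x - m * ψ₁ x))
      ≤ 2 / d * (1 / κ) * V + 1 / κ * (η * V / d) := by
    refine (nrm_add_le (by fun_prop) (by fun_prop)).trans (add_le_add ?_ ?_)
    · refine (nrm_le_mul (g := fun x => ψ₂ x - m * ψ x) (by fun_prop) (by fun_prop)
        (by positivity : 0 ≤ 2 / d * (1 / κ)) fun x => abs_le_mul_of_eq' rfl ?_).trans (by gcongr)
      rw [abs_mul, abs_mul (σ x)]
      have h1 := mul_le_mul (hσκ x) (hk' x) (abs_nonneg _) (by positivity)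
      rw [mul_one] at h1
      exact mul_le_mul (hs.abs_cos_mul_wt_le x) h1 (by positivity) (by positivity)
    · refine (nrm_le_mul (g := fun x => ψ₃ x - m * ψ₁ x) (by fun_prop) (by fun_prop)
        (by positivity : 0 ≤ 1 / κ) fun x => abs_le_mul_of_eq' rfl ?_).trans ?_
      · rw [abs_mul]
        exact (mul_le_mul (hk x) (hσκ x) (abs_nonneg _) zero_le_one).trans_eq (one_mul _)
      · gcongr
        rw [le_div_iff₀ hd]
        linarith
  have ht := h.test_le hκ.le hd.le der (by fun_prop) (by
    intro x
    simp only [h.per x, h.per₂ x, Real.sin_add_two_pi, hσ, periodic_wt μ κ x]) bφ bφ'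
  have e : (pint fun x => ((Real.sin x - μ) * (ψ₂ x - m * ψ x) + μ * ψ x) *
      ((Real.sin x - μ) * σ x ^ 2 * (ψ₂ x - m * ψ x)))
      = nrm (fun x => ψ₂ x - m * ψ x) ^ 2 - nrm (fun x => κ * (ψ₂ x - m * ψ x) * σ x) ^ 2
        + μ * pint fun x => (Real.sin x - μ) * σ x ^ 2 * ψ x * (ψ₂ x - m * ψ x) := by
    rw [nrm_sq, nrm_sq, ← pint_sub (by fun_prop) (by fun_prop), ← pint_const_mul,
      ← pint_add (by fun_prop) (by fun_prop)]
    congr 1; funext x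
    linear_combination (ψ₂ x - m * ψ x) ^ 2 * hrel x
  rw [e] at ht
  have b1 : |pint fun x => (Real.sin x - μ) * σ x ^ 2 * ψ x * (ψ₂ x - m * ψ x)|
      ≤ 1 * (X * V) := by
    refine (abs_pint_le_mul (f := fun x => ψ x * σ x) (g := fun x => ψ₂ x - m * ψ x)
      (by fun_prop) (by fun_prop) (by fun_prop) zero_le_one
      fun x => abs_le_mul_of_eq (a := (Real.sin x - μ) * σ x) (by ring) (hk x)).trans ?_
    gcongr
  have b2 := mul_le_mul_of_nonneg_left (neg_le_of_abs_le b1) hμ.le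
  have b3 := le_of_abs_le ht
  have b4 := pow_le_pow_left₀ (nrm_nonneg _) hE 2
  have b5 : η * κ * V * (1 / κ * V + d * (2 / d * (1 / κ) * V + 1 / κ * (η * V / d)))
      = (3 * η + η ^ 2) * V ^ 2 := by field_simp; ring
  nlinarith

end RayleighSol

/-! ### A Sobolev inequality and the size of the critical layer -/

lemma pint_mono_on {f g : ℝ → ℝ} (hf : Continuous f) (hg : Continuous g)
    (h : ∀ x ∈ Set.Icc 0 (2 * Real.pi), f x ≤ g x) : pint f ≤ pint g :=
  intervalIntegral.integral_mono_on (by positivity) (hf.intervalIntegrable _ _)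
    (hg.intervalIntegrable _ _) h

lemma pint_const (c : ℝ) : pint (fun _ => c) = 2 * Real.pi * c := by
  simp [pint]

/-- The one-dimensional Sobolev inequality on one period. -/
lemma sq_le_of_hasDerivAt {v v₁ : ℝ → ℝ} (hv : ∀ x, HasDerivAt v (v₁ x) x) (hc : Continuous v₁)
    {x : ℝ} (hx : x ∈ Set.Icc 0 (2 * Real.pi)) :
    v x ^ 2 ≤ nrm v ^ 2 + 2 * (nrm v * nrm v₁) := by
  have cv : Continuous v := continuous_iff_continuousAt.2 fun x => (hv x).continuousAt
  have hpi := Real.two_pi_pos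
  -- Within the period v² changes by at most 2∫|v v₁|. Averaging over y then gives the claim, the
  -- factor 1/(2π) ≤ 1 in front of the square norm being dropped.
  have h1 : ∀ y ∈ Set.Icc 0 (2 * Real.pi), v x ^ 2 ≤ v y ^ 2 + 2 * (nrm v * nrm v₁) := by
    intro y hy
    have e : ∫ t in y..x, 2 * (v t * v₁ t) = v x ^ 2 - v y ^ 2 := by
      refine intervalIntegral.integral_eq_sub_of_hasDerivAt (f := fun t => v t ^ 2)
        (fun t _ => ?_) ((by fun_prop : Continuous fun t => 2 * (v t * v₁ t)).intervalIntegrable _ _)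
      refine ((hv t).pow 2).congr_deriv ?_
      push_cast; ring
    obtain ⟨F, hF⟩ : ∃ F : ℝ → ℝ, F = fun t => |2 * (v t * v₁ t)| := ⟨_, rfl⟩
    have cF : Continuous F := by rw [hF]; fun_prop
    have hF0 : ∀ t, 0 ≤ F t := fun t => by rw [hF]; exact abs_nonneg _
    have b1 : |∫ t in y..x, 2 * (v t * v₁ t)| ≤ |∫ t in y..x, F t| := by
      rw [hF]
      exact intervalIntegral.norm_integral_le_abs_integral_norm (f := fun t => 2 * (v t * v₁ t))
    have b2 : |∫ t in y..x, F t| ≤ |∫ t in (0 : ℝ)..(2 * Real.pi), F t| := by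
      refine intervalIntegral.abs_integral_mono_interval ?_ (Filter.Eventually.of_forall hF0)
        (cF.intervalIntegrable _ _)
      rw [Set.uIoc_of_le hpi.le]
      exact Set.Ioc_subset_Ioc (le_min hy.1 hx.1) (max_le hy.2 hx.2)
    have b3 : |∫ t in (0 : ℝ)..(2 * Real.pi), F t| ≤ 2 * (nrm v * nrm v₁) :=
      abs_pint_le_mul (F := F) cF cv hc zero_le_two
        fun t => by rw [hF, abs_abs, abs_mul, abs_mul, abs_two]
    have := le_abs_self (∫ t in y..x, 2 * (v t * v₁ t))
    linarith
  have h2 : pint (fun _ => v x ^ 2) ≤ pint fun y => v y ^ 2 + 2 * (nrm v * nrm v₁) :=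
    pint_mono_on (by fun_prop) (by fun_prop) h1
  rw [pint_add (by fun_prop) (by fun_prop), pint_const, pint_const, ← nrm_sq] at h2
  have h3 : (1 : ℝ) ≤ 2 * Real.pi := by linarith [Real.pi_gt_three]
  have h4 : nrm v ^ 2 ≤ 2 * Real.pi * nrm v ^ 2 := le_mul_of_one_le_left (sq_nonneg _) h3
  have h5 : 2 * Real.pi * v x ^ 2 ≤ 2 * Real.pi * (nrm v ^ 2 + 2 * (nrm v * nrm v₁)) := by
    linarith
  exact le_of_mul_le_mul_left h5 hpi

/-- A Poisson-like kernel of width `d` centred at `b` has mass at most `π² d`. -/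
lemma pint_kernel_le {d : ℝ} (hd : 0 < d) (b : ℝ) :
    (pint fun y => d ^ 2 / (Real.sin ((y - b) / 2) ^ 2 + d ^ 2)) ≤ Real.pi ^ 2 * d := by
  have hq : ∀ z : ℝ, 0 < Real.sin (z / 2) ^ 2 + d ^ 2 := fun z => by positivity
  have per : Function.Periodic (fun y => d ^ 2 / (Real.sin (y / 2) ^ 2 + d ^ 2))
      (2 * Real.pi) := by
    intro y
    have : (y + 2 * Real.pi) / 2 = y / 2 + Real.pi := by ring
    simp only [this, Real.sin_add_pi, neg_sq]
  have e1 : (pint fun y => d ^ 2 / (Real.sin ((y - b) / 2) ^ 2 + d ^ 2))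
      = ∫ y in (-Real.pi)..Real.pi, d ^ 2 / (Real.sin (y / 2) ^ 2 + d ^ 2) := by
    rw [pint, intervalIntegral.integral_comp_sub_right
      (fun y => d ^ 2 / (Real.sin (y / 2) ^ 2 + d ^ 2)) b]
    have := per.intervalIntegral_add_eq (0 - b) (-Real.pi)
    rw [show 0 - b + 2 * Real.pi = 2 * Real.pi - b by ring,
      show -Real.pi + 2 * Real.pi = Real.pi by ring] at this
    exact this
  have hπ := Real.pi_pos
  rw [e1]
  calc (∫ y in (-Real.pi)..Real.pi, d ^ 2 / (Real.sin (y / 2) ^ 2 + d ^ 2))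
      ≤ ∫ y in (-Real.pi)..Real.pi, 1 / (1 + (y / (Real.pi * d)) ^ 2) := by
        refine intervalIntegral.integral_mono_on (by linarith)
          (Continuous.intervalIntegrable (Continuous.div (by fun_prop) (by fun_prop)
            fun y => (hq y).ne') _ _)
          (Continuous.intervalIntegrable (Continuous.div (by fun_prop) (by fun_prop)
            fun y => by positivity) _ _) fun y hy => ?_
        have h1 : |y / 2| ≤ Real.pi / 2 := by
          rw [abs_le]; constructor <;> linarith [hy.1, hy.2]
        -- Jordan's inequality gives |sin(y/2)| ≥ |y|/π on the recentred period, so the kernel lies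
        -- below a Cauchy density with an arctangent primitive.
        have h2 := Real.mul_abs_le_abs_sin h1
        have h3 : (y / Real.pi) ^ 2 ≤ Real.sin (y / 2) ^ 2 := by
          rw [← sq_abs (Real.sin _), ← sq_abs (y / Real.pi)]
          refine pow_le_pow_left₀ (abs_nonneg _) (le_trans (le_of_eq ?_) h2) 2
          rw [abs_div, abs_div, abs_two, abs_of_pos hπ]
          field_simp
        rw [div_le_div_iff₀ (hq y) (by positivity), one_mul]
        have e : d ^ 2 * (1 + (y / (Real.pi * d)) ^ 2) = d ^ 2 + (y / Real.pi) ^ 2 := by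
          field_simp
        rw [e]
        linarith
    _ = (Real.pi * d) * (Real.arctan (1 / d) - Real.arctan (-(1 / d))) := by
        have h := intervalIntegral.integral_comp_div (a := -Real.pi) (b := Real.pi)
          (fun t => 1 / (1 + t ^ 2)) (c := Real.pi * d) (by positivity)
        rw [h, integral_one_div_one_add_sq, smul_eq_mul]
        congr 3 <;> field_simp
    _ ≤ Real.pi * d * Real.pi := by
        gcongr
        rw [Real.arctan_neg]
        linarith [Real.arctan_lt_pi_div_two (1 / d)]
    _ = _ := by ring

namespace LayerScale

variable {μ δ κ d : ℝ}

/-- With θ = arcsin μ and μ ≤ 1, the critical points are θ and π - θ, and |sin x - sin θ| = 2PQ for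
the half-angle sines P, Q of the distances to them. The smaller one, M, measures the distance to the
nearer point. The larger one, L, is at least (cos θ)/2, since cos θ ≤ P + Q. For μ > 1 `arcsin`
takes the value π/2, and |sin x - 1| ≤ |sin x - μ|. -/
lemma layer_le_kernel (hs : LayerScale μ δ κ d) (x : ℝ) :
    (κ * wt μ κ x) ^ 2
      ≤ 2 * (d ^ 2 / (Real.sin ((x - Real.arcsin μ) / 2) ^ 2 + d ^ 2)
        + d ^ 2 / (Real.sin ((x - (Real.pi - Real.arcsin μ)) / 2) ^ 2 + d ^ 2)) := by
  have hd := hs.d_pos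
  have hκ := hs.κ_pos
  have hδ := hs.δ_pos
  obtain ⟨P, hP⟩ : ∃ P, P = |Real.sin ((x - Real.arcsin μ) / 2)| := ⟨_, rfl⟩
  obtain ⟨Q, hQ⟩ : ∃ Q, Q = |Real.sin ((x - (Real.pi - Real.arcsin μ)) / 2)| := ⟨_, rfl⟩
  have hP0 : 0 ≤ P := hP ▸ abs_nonneg _
  have hQ0 : 0 ≤ Q := hQ ▸ abs_nonneg _
  rw [← sq_abs (Real.sin ((x - Real.arcsin μ) / 2)),
    ← sq_abs (Real.sin ((x - (Real.pi - Real.arcsin μ)) / 2)), ← hP, ← hQ]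
  have hQ' : Q = |Real.cos ((x + Real.arcsin μ) / 2)| := by
    rw [hQ, show (x - (Real.pi - Real.arcsin μ)) / 2 = (x + Real.arcsin μ) / 2 - Real.pi / 2 by
      ring, Real.sin_sub_pi_div_two, abs_neg]
  have hw : 2 * (P * Q) ≤ |Real.sin x - μ| := by
    have e : Real.sin x - Real.sin (Real.arcsin μ)
        = 2 * (Real.sin ((x - Real.arcsin μ) / 2) * Real.cos ((x + Real.arcsin μ) / 2)) := by
      rw [Real.sin_sub_sin]; ring
    have e2 : 2 * (P * Q) = |Real.sin x - Real.sin (Real.arcsin μ)| := by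
      rw [e, abs_mul, abs_mul, abs_two, ← hP, ← hQ']
    rw [e2]
    rcases le_or_gt μ 1 with h1 | h1
    · rw [Real.sin_arcsin (by linarith [hs.mu_pos]) h1]
    · rw [Real.arcsin_of_one_le h1.le, Real.sin_pi_div_two]
      rw [abs_of_nonpos (by linarith [Real.sin_le_one x]),
        abs_of_nonpos (by linarith [Real.sin_le_one x])]
      linarith
  have hcos : Real.cos (Real.arcsin μ) ≤ P + Q := by
    have e : Real.arcsin μ = (x + Real.arcsin μ) / 2 - (x - Real.arcsin μ) / 2 := by ring
    have h1 : Real.cos (Real.arcsin μ) = Real.cos ((x + Real.arcsin μ) / 2)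
        * Real.cos ((x - Real.arcsin μ) / 2) + Real.sin ((x + Real.arcsin μ) / 2)
        * Real.sin ((x - Real.arcsin μ) / 2) := by
      rw [← Real.cos_sub, ← e]
    rw [h1, hP, hQ']
    have h2 : Real.cos ((x + Real.arcsin μ) / 2) * Real.cos ((x - Real.arcsin μ) / 2)
        ≤ |Real.cos ((x + Real.arcsin μ) / 2)| * 1 := by
      refine (le_abs_self _).trans ?_
      rw [abs_mul]
      gcongr
      exact Real.abs_cos_le_one _
    have h3 : Real.sin ((x + Real.arcsin μ) / 2) * Real.sin ((x - Real.arcsin μ) / 2)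
        ≤ 1 * |Real.sin ((x - Real.arcsin μ) / 2)| := by
      refine (le_abs_self _).trans ?_
      rw [abs_mul]
      gcongr
      exact Real.abs_sin_le_one _
    linarith
  have key : ∀ M L : ℝ, 0 ≤ M → M ≤ L → 2 * (M * L) ≤ |Real.sin x - μ| →
      Real.cos (Real.arcsin μ) ≤ M + L →
      (κ * wt μ κ x) ^ 2 ≤ 2 * (d ^ 2 / (M ^ 2 + d ^ 2)) := by
    intro M L hM hML h1 h2
    have hq := hs.sq_add_pos x
    have e : (κ * wt μ κ x) ^ 2 = κ ^ 2 / ((Real.sin x - μ) ^ 2 + κ ^ 2) := by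
      rw [eq_div_iff hq.ne']
      linear_combination κ ^ 2 * hs.wt_sq_mul x
    have hw2 : (2 * (M * L)) ^ 2 ≤ (Real.sin x - μ) ^ 2 := by
      rw [← sq_abs (Real.sin x - μ)]
      exact pow_le_pow_left₀ (by have := hM.trans hML; positivity) h1 2
    rw [e, ← mul_div_assoc, div_le_div_iff₀ hq (by positivity)]
    -- If δ = 1 - μ, then δ ≤ 1 - μ² = cos² θ ≤ 4L², hence |sin - μ| ≥ M√δ. If κ = δ, then κ = d²,
    -- and L ≥ M already gives |sin - μ| ≥ 2M².
    rcases hs.alt with h3 | h3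
    · have h4 : δ ≤ (M + L) ^ 2 := by
        have h5 : Real.cos (Real.arcsin μ) ^ 2 ≤ (M + L) ^ 2 :=
          pow_le_pow_left₀ (Real.cos_arcsin_nonneg μ) h2 2
        have h6 : Real.cos (Real.arcsin μ) ^ 2 = 1 - μ ^ 2 := by
          have := Real.sin_sq_add_cos_sq (Real.arcsin μ)
          rw [Real.sin_arcsin (by linarith [hs.mu_pos]) (by linarith)] at this
          linarith
        nlinarith [hs.mu_pos]
      have h7 : δ ≤ 4 * L ^ 2 := h4.trans (by nlinarith)
      have h8 : M ^ 2 * δ ≤ (Real.sin x - μ) ^ 2 := by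
        refine le_trans ?_ hw2
        nlinarith [sq_nonneg M]
      rw [hs.κ_sq]
      have h9 : d ^ 2 * (M ^ 2 * δ) ≤ d ^ 2 * (Real.sin x - μ) ^ 2 := by gcongr
      nlinarith [mul_nonneg (sq_nonneg d) (sq_nonneg (Real.sin x - μ)),
        mul_nonneg (sq_nonneg d) (mul_nonneg (sq_nonneg d) hδ.le)]
    · have h4 : κ = d ^ 2 := by
        have := hs.κ_sq
        rw [← h3] at this
        exact mul_right_cancel₀ hκ.ne' (by rw [← sq, this])
      have h5 : 4 * M ^ 4 ≤ (Real.sin x - μ) ^ 2 := by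
        refine le_trans ?_ hw2
        have : M ^ 2 ≤ M * L := by nlinarith
        nlinarith [sq_nonneg M]
      rw [h4]
      have h6 : d ^ 2 * (4 * M ^ 4) ≤ d ^ 2 * (Real.sin x - μ) ^ 2 := by gcongr
      have h7 : 0 ≤ d ^ 2 * (d ^ 2 - M ^ 2) ^ 2 := by positivity
      have h8 : 0 ≤ d ^ 2 * (M ^ 2) ^ 2 := by positivity
      nlinarith
  have p1 : 0 ≤ d ^ 2 / (P ^ 2 + d ^ 2) := by positivity
  have p2 : 0 ≤ d ^ 2 / (Q ^ 2 + d ^ 2) := by positivity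
  rcases le_total P Q with h | h
  · linarith [key P Q hP0 h hw hcos]
  · linarith [key Q P hQ0 h (by rwa [mul_comm Q P]) (by rwa [add_comm])]

/-- The two kernels of mass π²d, with the factor 2, give 4π²d ≤ 40d. -/
lemma pint_layer_le (hs : LayerScale μ δ κ d) : (pint fun x => (κ * wt μ κ x) ^ 2) ≤ 40 * d := by
  have cσ := hs.continuous_wt
  have hd := hs.d_pos
  have cK : ∀ b : ℝ, Continuous fun y => d ^ 2 / (Real.sin ((y - b) / 2) ^ 2 + d ^ 2) := fun b =>
    Continuous.div (by fun_prop) (by fun_prop) fun y => by positivity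
  have c1 := cK (Real.arcsin μ)
  have c2 := cK (Real.pi - Real.arcsin μ)
  have h1 := pint_mono (by fun_prop) (by fun_prop) hs.layer_le_kernel
  rw [pint_const_mul, pint_add c1 c2] at h1
  have h2 := pint_kernel_le hd (Real.arcsin μ)
  have h3 := pint_kernel_le hd (Real.pi - Real.arcsin μ)
  have h4 : Real.pi ^ 2 ≤ 10 := by
    nlinarith [Real.pi_lt_d2, Real.pi_pos]
  nlinarith

end LayerScale

/-! ### Smallness of v in the layer and the bootstrap -/

namespace RayleighSol

variable {ψ ψ₁ ψ₂ ψ₃ h₁ h₂ h₂' : ℝ → ℝ} {μ δ κ d m η V ε : ℝ}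

/-- A slowly varying v cannot concentrate in the layer: its supremum, bounded by the Sobolev
inequality, meets a layer of mass 40d. Since d ≤ η and d‖v'‖ ≤ ηV, the square is at most 120ηV², and
120 ≤ 11². -/
lemma layer_v_le (hs : LayerScale μ δ κ d)
    (h : RayleighSol μ κ d m η V ψ ψ₁ ψ₂ ψ₃ h₁ h₂ h₂') (hdη : d ≤ η) :
    nrm (fun x => κ * (ψ₂ x - m * ψ x) * wt μ κ x) ≤ 11 * √η * V := by
  have cσ := hs.continuous_wt
  have c0 := h.cont
  have c1 := h.cont₁
  have c2 := h.cont₂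
  have c3 := h.cont₃
  have hd := hs.d_pos
  have hη := h.η_nonneg
  have hV := h.V_nonneg
  have hv := h.v_le
  have hv1 := h.v₁_le
  refine Real.sqrt_le_iff.2 ⟨by positivity, ?_⟩
  set M := nrm (fun x => ψ₂ x - m * ψ x) ^ 2
    + 2 * (nrm (fun x => ψ₂ x - m * ψ x) * nrm fun x => ψ₃ x - m * ψ₁ x) with hM
  have hM0 : 0 ≤ M := by
    have := nrm_nonneg (fun x => ψ₂ x - m * ψ x)
    have := nrm_nonneg (fun x => ψ₃ x - m * ψ₁ x)
    positivity
  have b1 : (pint fun x => (κ * (ψ₂ x - m * ψ x) * wt μ κ x) ^ 2)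
      ≤ M * pint fun x => (κ * wt μ κ x) ^ 2 := by
    rw [← pint_const_mul]
    refine pint_mono_on (by fun_prop) (by fun_prop) fun x hx => ?_
    have := sq_le_of_hasDerivAt (fun x => (h.der₂ x).sub ((h.der x).const_mul m)) (by fun_prop) hx
    calc (κ * (ψ₂ x - m * ψ x) * wt μ κ x) ^ 2
        = (ψ₂ x - m * ψ x) ^ 2 * (κ * wt μ κ x) ^ 2 := by ring
      _ ≤ M * (κ * wt μ κ x) ^ 2 := mul_le_mul_of_nonneg_right this (sq_nonneg _)
  have b2 : M * d ≤ 3 * η * V ^ 2 := by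
    have n0 := nrm_nonneg (fun x => ψ₂ x - m * ψ x)
    have e1 : nrm (fun x => ψ₂ x - m * ψ x) ^ 2 ≤ V ^ 2 := pow_le_pow_left₀ n0 hv 2
    have e2 : nrm (fun x => ψ₂ x - m * ψ x) * (d * nrm fun x => ψ₃ x - m * ψ₁ x)
        ≤ V * (η * V) := mul_le_mul hv hv1
          (mul_nonneg hd.le (nrm_nonneg _)) hV
    have e3 : nrm (fun x => ψ₂ x - m * ψ x) ^ 2 * d ≤ V ^ 2 * η :=
      mul_le_mul e1 hdη hd.le (sq_nonneg _)
    rw [hM]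
    nlinarith
  have b3 := mul_le_mul_of_nonneg_left hs.pint_layer_le hM0
  rw [mul_pow, mul_pow, Real.sq_sqrt hη]
  nlinarith [mul_nonneg hη (sq_nonneg V)]

/-- The algebra combining the estimates of the quantities `X`, `J`, `a`, `b`. -/
lemma rayleigh_bootstrap {a b X J N : ℝ} (hε : 0 < ε) (hε1 : ε ≤ 1) (hη : 0 ≤ η)
    (hsq : ε ^ 2 = 121 * η) (hηε : η ≤ ε) (hV : 0 ≤ V) (hμ : 0 < μ) (hμ2 : μ ≤ 2) (hδ : 0 < δ)
    (ha : 0 ≤ a) (hX : 0 ≤ X)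
    (hJ : μ * J ^ 2 ≤ J * ((√(3 * ε * δ) + η * √(2 * δ)) * V) + 28 * η * δ * V * (X + V))
    (hN : 1 / 2 * a + μ / 2 * b ≤ 2 * μ * J ^ 2 + (44 * η + 12 * ε) * δ * V * (X + V))
    (hH : δ * X ^ 2 ≤ 9 * a + 56 * b)
    (hF : N ≤ (ε ^ 2 + 3 * η + η ^ 2) * V ^ 2 + μ * X * V) :
    N ≤ 30000 * √ε * V ^ 2 := by
  obtain ⟨A, hA⟩ : ∃ A, A = √(3 * ε * δ) + η * √(2 * δ) := ⟨_, rfl⟩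
  rw [← hA] at hJ
  have hη2 : η ^ 2 ≤ ε := (pow_le_of_le_one hη (hηε.trans hε1) two_ne_zero).trans hηε
  have hA2 : A ^ 2 ≤ 10 * ε * δ := by
    have s1 := Real.sq_sqrt (by positivity : 0 ≤ 3 * ε * δ)
    have s2 := Real.sq_sqrt (by positivity : 0 ≤ 2 * δ)
    have : A ^ 2 ≤ 2 * √(3 * ε * δ) ^ 2 + 2 * (η ^ 2 * √(2 * δ) ^ 2) := by
      rw [hA]; nlinarith [sq_nonneg (√(3 * ε * δ) - η * √(2 * δ))]
    rw [s1, s2] at this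
    nlinarith [mul_le_mul_of_nonneg_right hη2 hδ.le]
  -- Only μX enters `hF`. Multiplying the other estimates by powers of μ makes the constants
  -- independent of a lower bound for μ.
  obtain ⟨Z, hZ⟩ : ∃ Z, Z = μ * X := ⟨_, rfl⟩
  have hZ0 : 0 ≤ Z := hZ ▸ by positivity
  have hμXV : μ * (X + V) ≤ Z + 2 * V := by
    rw [hZ, mul_add]
    gcongr
  have hJ2 : (μ * J) ^ 2 ≤ A ^ 2 * V ^ 2 + 56 * ε * δ * V * (Z + 2 * V) := by
    have e1 := mul_le_mul_of_nonneg_left hJ hμ.le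
    have e2 : 28 * η * δ * V * (μ * (X + V)) ≤ 28 * ε * δ * V * (Z + 2 * V) := by
      gcongr
    have e3 : (μ * J) ^ 2 ≤ μ * J * (A * V) + 28 * η * δ * V * (μ * (X + V)) := by
      calc (μ * J) ^ 2 = μ * (μ * J ^ 2) := by ring
        _ ≤ _ := e1
        _ = _ := by ring
    have e4 : 2 * (μ * J * (A * V)) ≤ (μ * J) ^ 2 + (A * V) ^ 2 := by
      linarith [two_mul_le_add_sq (μ * J) (A * V)]
    linarith [mul_pow A V 2]
  have hN2 : μ * (1 / 2 * a + μ / 2 * b) ≤ 2 * (μ * J) ^ 2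
      + 56 * ε * δ * V * (Z + 2 * V) := by
    have e1 := mul_le_mul_of_nonneg_left hN hμ.le
    have e2 : (44 * η + 12 * ε) * δ * V * (μ * (X + V)) ≤ 56 * ε * δ * V * (Z + 2 * V) := by
      gcongr
      linarith
    calc _ ≤ _ := e1
      _ = 2 * (μ * J) ^ 2 + (44 * η + 12 * ε) * δ * V * (μ * (X + V)) := by ring
      _ ≤ _ := by linarith
  have hZ2 : δ * Z ^ 2 ≤ δ * (112 * ε * (20 * V ^ 2 + 168 * V * (Z + 2 * V))) := by
    have e1 : δ * Z ^ 2 ≤ μ ^ 2 * (9 * a + 56 * b) := by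
      calc δ * Z ^ 2 = μ ^ 2 * (δ * X ^ 2) := by rw [hZ]; ring
        _ ≤ _ := mul_le_mul_of_nonneg_left hH (sq_nonneg μ)
    have e2 : μ ^ 2 * (9 * a + 56 * b) ≤ 112 * (μ * (1 / 2 * a + μ / 2 * b)) := by
      have h0 := mul_nonneg hμ.le ha
      have : μ * (μ * a) ≤ 2 * (μ * a) := mul_le_mul_of_nonneg_right hμ2 h0
      calc _ = 9 * (μ * (μ * a)) + 56 * (μ ^ 2 * b) := by ring
        _ ≤ 56 * (μ * a) + 56 * (μ ^ 2 * b) := by linarith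
        _ = _ := by ring
    have e3 : A ^ 2 * V ^ 2 ≤ 10 * ε * δ * V ^ 2 := by gcongr
    calc δ * Z ^ 2 ≤ 112 * (2 * (10 * ε * δ * V ^ 2 + 56 * ε * δ * V * (Z + 2 * V))
          + 56 * ε * δ * V * (Z + 2 * V)) := by linarith
      _ = _ := by ring
  have hZ3 := le_of_mul_le_mul_left hZ2 hδ
  have hr0 : 0 < √ε := Real.sqrt_pos.2 hε
  have hr := Real.sq_sqrt hε.le
  have hr1 : √ε ≤ 1 := Real.sqrt_le_one.2 hε1
  -- `hZ3` reads Z² ≲ ε(V² + VZ); absorbing the linear term, with 18816 = 112 · 168, leaves Z = O(√ε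
  -- V).
  have hZ4 : Z ≤ 20000 * √ε * V := by
    refine (abs_le_of_sq_le_sq' ?_ (by positivity)).2
    rw [mul_pow, mul_pow, hr]
    have e1 : 2 * (Z * (18816 * ε * V)) ≤ Z ^ 2 + (18816 * ε * V) ^ 2 := by
      linarith [two_mul_le_add_sq Z (18816 * ε * V)]
    have e2 : ε * ε * V ^ 2 ≤ 1 * ε * V ^ 2 := by gcongr
    have e3 : 0 ≤ ε * V ^ 2 := by positivity
    linarith
  have hZV : Z * V ≤ 20000 * √ε * V * V := mul_le_mul_of_nonneg_right hZ4 hV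
  have hεr : ε ≤ √ε := by
    calc ε = √ε * √ε := by rw [← sq, hr]
      _ ≤ √ε * 1 := by gcongr
      _ = √ε := mul_one _
  have hε2 : ε ^ 2 ≤ ε := pow_le_of_le_one hε.le hε1 two_ne_zero
  have e2 : (ε ^ 2 + 3 * η + η ^ 2) * V ^ 2 ≤ 5 * √ε * V ^ 2 := by
    gcongr
    linarith
  rw [← hZ] at hF
  have e3 : 0 ≤ √ε * V ^ 2 := by positivity
  linarith

/-- The quantitative absence of solutions of the Rayleigh equation. -/
lemma sq_nrm_le_sqrt (hs : LayerScale μ δ κ d)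
    (h : RayleighSol μ κ d m η V ψ ψ₁ ψ₂ ψ₃ h₁ h₂ h₂') (hdη : d ≤ η) (hη1 : 121 * η ≤ 1) :
    nrm (fun x => ψ₂ x - m * ψ x) ^ 2 ≤ 30000 * √(11 * √η) * V ^ 2 := by
  have hη : 0 < η := hs.d_pos.trans_le hdη
  have hE := h.layer_v_le hs hdη
  obtain ⟨ε, hεdef⟩ : ∃ ε, ε = 11 * √η := ⟨_, rfl⟩
  rw [← hεdef] at hE ⊢
  have hε : 0 < ε := by rw [hεdef]; positivity
  have hsq : ε ^ 2 = 121 * η := by rw [hεdef, mul_pow, Real.sq_sqrt hη.le]; norm_num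
  have hε1 : ε ≤ 1 := by nlinarith
  have hηε : η ≤ ε := by nlinarith
  have hV := h.V_nonneg
  have hμ := hs.mu_pos
  have hμ2 := hs.mu_le
  have hδ := hs.δ_pos
  have hJ := h.layer_mass_le hs hε hε1 hE
  have hN := h.coercive_le hs hε hE
  have hH := hs.hardy h.per h.der h.cont₁
  have hF := h.sq_nrm_le hs hE
  have ha : 0 ≤ pint fun x => (1 + Real.sin x) * ψ₁ x ^ 2 :=
    pint_nonneg fun x => mul_nonneg (by linarith [Real.neg_one_le_sin x]) (sq_nonneg _)
  have hX : 0 ≤ nrm fun x => ψ x * wt μ κ x := nrm_nonneg _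
  exact rayleigh_bootstrap hε hε1 hη.le hsq hηε hV hμ hμ2 hδ ha hX hJ hN hH hF

end RayleighSol

/-- The smallness parameter of the resolvent estimate. -/
theorem exists_rayleigh_threshold : ∃ η : ℝ, 0 < η ∧ η ≤ 1 ∧
    ∀ {μ δ κ d m V : ℝ} {ψ ψ₁ ψ₂ ψ₃ h₁ h₂ h₂' : ℝ → ℝ}, LayerScale μ δ κ d → d ≤ η →
      RayleighSol μ κ d m η V ψ ψ₁ ψ₂ ψ₃ h₁ h₂ h₂' →
      nrm (fun x => ψ₂ x - m * ψ x) ^ 2 ≤ V ^ 2 / 16 := by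
  -- This η makes √(11√η) equal to 1/480000, and 30000/480000 = 1/16.
  refine ⟨((1 / 480000) ^ 2 / 11) ^ 2, by norm_num, by norm_num, ?_⟩
  intro μ δ κ d m V ψ ψ₁ ψ₂ ψ₃ h₁ h₂ h₂' hs hd h
  have := h.sq_nrm_le_sqrt hs hd (by norm_num)
  rw [Real.sqrt_sq (by norm_num), mul_div_cancel₀ _ (by norm_num : (11 : ℝ) ≠ 0),
    Real.sqrt_sq (by norm_num)] at this
  linarith

/-! ### The a priori estimate for complex valued functions -/

/-- The `L²` norm of a complex valued function over one period. -/
def cnrm (f : ℝ → ℂ) : ℝ := nrm fun x => ‖f x‖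

lemma cnrm_nonneg (f : ℝ → ℂ) : 0 ≤ cnrm f := nrm_nonneg _

lemma cnrm_sq (f : ℝ → ℂ) : cnrm f ^ 2 = pint fun x => ‖f x‖ ^ 2 := nrm_sq _

lemma cnrm_sq_eq {f : ℝ → ℂ} (hf : Continuous f) :
    cnrm f ^ 2 = nrm (fun x => (f x).re) ^ 2 + nrm (fun x => (f x).im) ^ 2 := by
  rw [cnrm_sq, nrm_sq, nrm_sq, ← pint_add (by fun_prop) (by fun_prop)]
  congr 1; funext x
  rw [← Complex.normSq_eq_norm_sq, Complex.normSq_apply]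
  ring

lemma cnrm_const_mul (c : ℂ) (f : ℝ → ℂ) : cnrm (fun x => c * f x) = ‖c‖ * cnrm f := by
  rw [cnrm, nrm]
  simp only [norm_mul, mul_pow]
  rw [pint_const_mul, Real.sqrt_mul (sq_nonneg _), Real.sqrt_sq (norm_nonneg _)]
  rfl

lemma cnrm_sub_le {f g : ℝ → ℂ} (hf : Continuous f) (hg : Continuous g) :
    cnrm (fun x => f x - g x) ≤ cnrm f + cnrm g := by
  refine le_trans ?_ (nrm_add_le hf.norm hg.norm)
  refine (nrm_le_mul (g := fun x => ‖f x‖ + ‖g x‖) (by fun_prop) (by fun_prop) zero_le_one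
    fun x => ?_).trans_eq (one_mul _)
  rw [abs_of_nonneg (norm_nonneg _), abs_of_nonneg (by positivity), one_mul]
  exact norm_sub_le _ _

lemma nrm_apply_le {f : ℝ → ℂ} (hf : Continuous f) {T : ℂ →L[ℝ] ℝ} (hT : ∀ z, |T z| ≤ ‖z‖) :
    nrm (fun x => T (f x)) ≤ cnrm f := by
  refine (nrm_le_mul (g := fun x => ‖f x‖) (by fun_prop) (by fun_prop) zero_le_one
    fun x => ?_).trans_eq (one_mul _)
  rw [abs_norm, one_mul]
  exact hT _

/-- A smooth solution of `i β ((sin - μ) v + μ Ψ) = U'' - L U - F`, `v = Ψ'' - m Ψ`. -/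
structure VorticitySol (μ β m L : ℝ) (Ψ Ψ₁ Ψ₂ Ψ₃ U U₁ U₂ F : ℝ → ℂ) : Prop where
  m_nonneg : 0 ≤ m
  L_nonneg : 0 ≤ L
  per : Function.Periodic Ψ (2 * Real.pi)
  per₁ : Function.Periodic Ψ₁ (2 * Real.pi)
  per₂ : Function.Periodic Ψ₂ (2 * Real.pi)
  per₃ : Function.Periodic Ψ₃ (2 * Real.pi)
  perU : Function.Periodic U (2 * Real.pi)
  perU₁ : Function.Periodic U₁ (2 * Real.pi)
  perF : Function.Periodic F (2 * Real.pi)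
  der : ∀ x, HasDerivAt Ψ (Ψ₁ x) x
  der₁ : ∀ x, HasDerivAt Ψ₁ (Ψ₂ x) x
  der₂ : ∀ x, HasDerivAt Ψ₂ (Ψ₃ x) x
  derU₁ : ∀ x, HasDerivAt U₁ (U₂ x) x
  cont₃ : Continuous Ψ₃
  contU : Continuous U
  contU₂ : Continuous U₂
  contF : Continuous F
  eqn : ∀ x : ℝ, Complex.I * β * (((Real.sin x - μ : ℝ) : ℂ) * (Ψ₂ x - m * Ψ x) + μ * Ψ x)
    = U₂ x - L * U x - F x
  U_le : cnrm U ≤ 2 * cnrm fun x => Ψ₂ x - m * Ψ x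
  Ψ₂_le : cnrm Ψ₂ ≤ 2 * cnrm fun x => Ψ₂ x - m * Ψ x
  v₁_le : cnrm (fun x => Ψ₃ x - m * Ψ₁ x) ≤ cnrm U₁
  energy : cnrm U₁ ^ 2 + L * cnrm U ^ 2 ≤ 2 * (cnrm F * cnrm U)

namespace VorticitySol

variable {μ δ κ d β m L η : ℝ} {Ψ Ψ₁ Ψ₂ Ψ₃ U U₁ U₂ F : ℝ → ℂ}

/-- A real linear functional turns a solution of the vorticity equation into a solution of the
Rayleigh equation. -/
lemma rayleighSol (hs : LayerScale μ δ κ d)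
    (h : VorticitySol μ β m L Ψ Ψ₁ Ψ₂ Ψ₃ U U₁ U₂ F) (hβ : |β| * (κ * d ^ 2) = 1)
    (hη : 0 < η) (hη1 : η ≤ 1) (hF : cnrm F * d ^ 2 ≤ η ^ 2 / 4 * cnrm U) (hU : 0 < cnrm U)
    {T : ℂ →L[ℝ] ℝ} (hT : ∀ z, |T z| ≤ ‖z‖) :
    RayleighSol μ κ d m η (2 * cnrm fun x => Ψ₂ x - m * Ψ x)
      (fun x => T (Ψ x)) (fun x => T (Ψ₁ x)) (fun x => T (Ψ₂ x)) (fun x => T (Ψ₃ x))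
      (fun x => T ((Complex.I * β)⁻¹ * (-L * U x - F x)))
      (fun x => T ((Complex.I * β)⁻¹ * U₁ x)) (fun x => T ((Complex.I * β)⁻¹ * U₂ x)) := by
  have c0 : Continuous Ψ := continuous_iff_continuousAt.2 fun x => (h.der x).continuousAt
  have c1 : Continuous Ψ₁ := continuous_iff_continuousAt.2 fun x => (h.der₁ x).continuousAt
  have c2 : Continuous Ψ₂ := continuous_iff_continuousAt.2 fun x => (h.der₂ x).continuousAt
  have c3 := h.cont₃
  have cU := h.contU
  have cU₁ : Continuous U₁ := continuous_iff_continuousAt.2 fun x => (h.derU₁ x).continuousAt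
  have cU₂ := h.contU₂
  have cF := h.contF
  have hd := hs.d_pos
  have hκ := hs.κ_pos
  have hβ0 : 0 < |β| := by
    rcases (abs_nonneg β).lt_or_eq with h0 | h0
    · exact h0
    · rw [← h0, zero_mul] at hβ; exact absurd hβ zero_ne_one
  have hβne : β ≠ 0 := abs_pos.1 hβ0
  have hIβ : Complex.I * (β : ℂ) ≠ 0 :=
    mul_ne_zero Complex.I_ne_zero (Complex.ofReal_ne_zero.2 hβne)
  have hinv : ‖(Complex.I * (β : ℂ))⁻¹‖ = κ * d ^ 2 := by
    rw [norm_inv, norm_mul, Complex.norm_I, one_mul, Complex.norm_real, Real.norm_eq_abs]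
    exact inv_eq_of_mul_eq_one_right hβ
  have hL := h.L_nonneg
  have hTs : ∀ (r : ℝ) (z : ℂ), T (r * z) = r * T z := fun r z => by
    rw [← Complex.real_smul, map_smul, smul_eq_mul]
  have hTd : ∀ {f : ℝ → ℂ} {f' : ℂ} {x : ℝ}, HasDerivAt f f' x →
      HasDerivAt (fun x => T (f x)) (T f') x := fun {f f' x} hf =>
    T.hasFDerivAt.comp_hasDerivAt x hf
  have hv : ∀ x, T (Ψ₂ x) - m * T (Ψ x) = T (Ψ₂ x - m * Ψ x) := fun x => by
    rw [map_sub, hTs]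
  have hv₁ : ∀ x, T (Ψ₃ x) - m * T (Ψ₁ x) = T (Ψ₃ x - m * Ψ₁ x) := fun x => by
    rw [map_sub, hTs]
  have nF := cnrm_nonneg F
  have nU₁ := cnrm_nonneg U₁
  -- The assumed failure ‖F‖d² ≤ (η²/4)‖U‖ enters the energy inequality: U varies slowly on the
  -- scale d and, in `eLU`, L‖U‖ ≤ 2‖F‖. Together with |β|⁻¹ = κd² this makes both parts of the
  -- right-hand side small.
  have eU₁ : d * cnrm U₁ ≤ η * cnrm U := by
    refine (abs_le_of_sq_le_sq' ?_ (by positivity)).2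
    have h1 : cnrm U₁ ^ 2 ≤ 2 * (cnrm F * cnrm U) := by
      have := h.energy
      have : 0 ≤ L * cnrm U ^ 2 := by positivity
      linarith
    calc (d * cnrm U₁) ^ 2 = d ^ 2 * cnrm U₁ ^ 2 := by ring
      _ ≤ d ^ 2 * (2 * (cnrm F * cnrm U)) := by gcongr
      _ = 2 * (cnrm F * d ^ 2) * cnrm U := by ring
      _ ≤ 2 * (η ^ 2 / 4 * cnrm U) * cnrm U := by gcongr
      _ ≤ (η * cnrm U) ^ 2 := by nlinarith [sq_nonneg (η * cnrm U)]
  have eLU : L * cnrm U ≤ 2 * cnrm F := by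
    have h1 : L * cnrm U * cnrm U ≤ 2 * cnrm F * cnrm U := by
      have := h.energy
      nlinarith [sq_nonneg (cnrm U₁)]
    exact le_of_mul_le_mul_right h1 hU
  refine
    { m_nonneg := h.m_nonneg
      η_nonneg := hη.le
      V_nonneg := mul_nonneg zero_le_two (cnrm_nonneg _)
      per := fun x => by simp only [h.per x]
      per₁ := fun x => by simp only [h.per₁ x]
      per₂ := fun x => by simp only [h.per₂ x]
      perh := fun x => by simp only [h.perU₁ x]
      der := fun x => hTd (h.der x)
      der₁ := fun x => hTd (h.der₁ x)
      der₂ := fun x => hTd (h.der₂ x)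
      derh := fun x => hTd ((h.derU₁ x).const_mul _)
      cont₃ := by fun_prop
      conth₁ := by fun_prop
      conth₂' := by fun_prop
      eqn := fun x => ?_
      h₁_le := ?_
      h₂_le := ?_
      v_le := ?_
      v₁_le := ?_
      ψ₂_le := (nrm_apply_le c2 hT).trans h.Ψ₂_le }
  · rw [hv, ← hTs, ← hTs, ← map_add, ← map_add]
    congr 1
    rw [← mul_add, eq_inv_mul_iff_mul_eq₀ hIβ, h.eqn]
    ring
  · refine (nrm_apply_le (by fun_prop) hT).trans ?_
    rw [cnrm_const_mul, hinv]
    have e1 := cnrm_sub_le (f := fun x => -(L : ℂ) * U x) (by fun_prop) cF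
    rw [cnrm_const_mul, norm_neg, Complex.norm_real, Real.norm_eq_abs, abs_of_nonneg hL] at e1
    calc κ * d ^ 2 * cnrm (fun x => -(L : ℂ) * U x - F x)
        ≤ κ * d ^ 2 * (3 * cnrm F) := by gcongr; linarith
      _ = κ * (3 * (cnrm F * d ^ 2)) := by ring
      _ ≤ κ * (3 * (η ^ 2 / 4 * cnrm U)) := by gcongr
      _ ≤ κ * (η * cnrm U) := by
        refine mul_le_mul_of_nonneg_left ?_ hκ.le
        have : η ^ 2 * cnrm U ≤ η * cnrm U := by
          gcongr
          exact pow_le_of_le_one hη.le hη1 two_ne_zero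
        have : 0 ≤ η ^ 2 * cnrm U := by positivity
        linarith
      _ = η * κ * cnrm U := by ring
      _ ≤ _ := by gcongr; exact h.U_le
  · refine (nrm_apply_le (by fun_prop) hT).trans ?_
    rw [cnrm_const_mul, hinv]
    calc κ * d ^ 2 * cnrm U₁ = κ * d * (d * cnrm U₁) := by ring
      _ ≤ κ * d * (η * cnrm U) := by gcongr
      _ = η * κ * d * cnrm U := by ring
      _ ≤ _ := by gcongr; exact h.U_le
  · simp only [hv]
    refine (nrm_apply_le (by fun_prop) hT).trans ?_
    linarith [cnrm_nonneg fun x => Ψ₂ x - m * Ψ x]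
  · simp only [hv₁]
    calc _ ≤ d * cnrm (fun x => Ψ₃ x - m * Ψ₁ x) := by
          gcongr; exact nrm_apply_le (by fun_prop) hT
      _ ≤ d * cnrm U₁ := by gcongr; exact h.v₁_le
      _ ≤ η * cnrm U := eU₁
      _ ≤ _ := by gcongr; exact h.U_le

lemma cnrm_shift {f : ℝ → ℂ} (hf : Function.Periodic f (2 * Real.pi)) (a : ℝ) :
    cnrm (fun x => f (x + a)) = cnrm f := by
  rw [cnrm, cnrm, nrm, nrm, pint, pint,
    intervalIntegral.integral_comp_add_right (fun x => ‖f x‖ ^ 2) a]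
  have hp : Function.Periodic (fun x => ‖f x‖ ^ 2) (2 * Real.pi) := fun x => by
    simp only [hf x]
  have := hp.intervalIntegral_add_eq (0 + a) 0
  rw [zero_add (2 * Real.pi)] at this
  rw [← this]
  congr 2
  ring

lemma periodic_shift {f : ℝ → ℂ} (hf : Function.Periodic f (2 * Real.pi)) (a : ℝ) :
    Function.Periodic (fun x => f (x + a)) (2 * Real.pi) := fun x => by
  have := hf (x + a)
  simp only
  rw [← this]
  congr 1
  ring

/-- Translation by half a period changes the sign of `μ`. -/
lemma shift_pi (h : VorticitySol μ β m L Ψ Ψ₁ Ψ₂ Ψ₃ U U₁ U₂ F) :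
    VorticitySol (-μ) (-β) m L (fun x => Ψ (x + Real.pi)) (fun x => Ψ₁ (x + Real.pi))
      (fun x => Ψ₂ (x + Real.pi)) (fun x => Ψ₃ (x + Real.pi)) (fun x => U (x + Real.pi))
      (fun x => U₁ (x + Real.pi)) (fun x => U₂ (x + Real.pi)) (fun x => F (x + Real.pi)) := by
  have hc {f : ℝ → ℂ} (hf : Continuous f) : Continuous fun x => f (x + Real.pi) := by fun_prop
  have pv : Function.Periodic (fun x => Ψ₂ x - m * Ψ x) (2 * Real.pi) := fun x => by
    simp only [h.per x, h.per₂ x]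
  have pv₁ : Function.Periodic (fun x => Ψ₃ x - m * Ψ₁ x) (2 * Real.pi) := fun x => by
    simp only [h.per₁ x, h.per₃ x]
  have ev := cnrm_shift pv Real.pi
  have ev₁ := cnrm_shift pv₁ Real.pi
  exact
    { m_nonneg := h.m_nonneg
      L_nonneg := h.L_nonneg
      per := periodic_shift h.per _
      per₁ := periodic_shift h.per₁ _
      per₂ := periodic_shift h.per₂ _
      per₃ := periodic_shift h.per₃ _
      perU := periodic_shift h.perU _
      perU₁ := periodic_shift h.perU₁ _
      perF := periodic_shift h.perF _
      der := fun x => (h.der (x + Real.pi)).comp_add_const x Real.pi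
      der₁ := fun x => (h.der₁ (x + Real.pi)).comp_add_const x Real.pi
      der₂ := fun x => (h.der₂ (x + Real.pi)).comp_add_const x Real.pi
      derU₁ := fun x => (h.derU₁ (x + Real.pi)).comp_add_const x Real.pi
      cont₃ := hc h.cont₃
      contU := hc h.contU
      contU₂ := hc h.contU₂
      contF := hc h.contF
      eqn := fun x => by
        have := h.eqn (x + Real.pi)
        rw [Real.sin_add_pi] at this
        rw [← this]
        push_cast
        ring
      U_le := by rw [ev, cnrm_shift h.perU]; exact h.U_le
      Ψ₂_le := by rw [ev, cnrm_shift h.per₂]; exact h.Ψ₂_le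
      v₁_le := by rw [ev₁, cnrm_shift h.perU₁]; exact h.v₁_le
      energy := by
        rw [cnrm_shift h.perU₁, cnrm_shift h.perU, cnrm_shift h.perF]
        exact h.energy }

end VorticitySol

/-- The a priori estimate for smooth solutions of the vorticity equation. -/
theorem exists_vorticity_bound : ∃ η : ℝ, 0 < η ∧ η ≤ 1 ∧
    ∀ {μ δ κ d β m L : ℝ} {Ψ Ψ₁ Ψ₂ Ψ₃ U U₁ U₂ F : ℝ → ℂ}, μ ≠ 0 →
      LayerScale |μ| δ κ d → d ≤ η → |β| * (κ * d ^ 2) = 1 →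
      VorticitySol μ β m L Ψ Ψ₁ Ψ₂ Ψ₃ U U₁ U₂ F →
      η ^ 2 / 4 * cnrm U ≤ cnrm F * d ^ 2 := by
  obtain ⟨η, hη, hη1, H⟩ := exists_rayleigh_threshold
  have pos : ∀ {μ δ κ d β m L : ℝ} {Ψ Ψ₁ Ψ₂ Ψ₃ U U₁ U₂ F : ℝ → ℂ},
      LayerScale μ δ κ d → d ≤ η → |β| * (κ * d ^ 2) = 1 →
      VorticitySol μ β m L Ψ Ψ₁ Ψ₂ Ψ₃ U U₁ U₂ F →
      η ^ 2 / 4 * cnrm U ≤ cnrm F * d ^ 2 := by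
    intro μ δ κ d β m L Ψ Ψ₁ Ψ₂ Ψ₃ U U₁ U₂ F hs hd hβ h
    -- The real and imaginary parts are Rayleigh solutions with V = 2‖v‖, so each contributes at
    -- most V²/16 = ‖v‖²/4 to ‖v‖². Hence ‖v‖² ≤ ‖v‖²/2, which forces v = 0 and, by `U_le`, U = 0.
    by_contra! hlt
    have hU : 0 < cnrm U := by
      have h1 : 0 ≤ cnrm F * d ^ 2 := mul_nonneg (cnrm_nonneg _) (sq_nonneg _)
      exact pos_of_mul_pos_right (h1.trans_lt hlt) (by positivity)
    have hre := H hs hd (h.rayleighSol hs hβ hη hη1 hlt.le hU (T := Complex.reCLM)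
      Complex.abs_re_le_norm)
    have him := H hs hd (h.rayleighSol hs hβ hη hη1 hlt.le hU (T := Complex.imCLM)
      Complex.abs_im_le_norm)
    have c0 : Continuous Ψ := continuous_iff_continuousAt.2 fun x => (h.der x).continuousAt
    have c2 : Continuous Ψ₂ := continuous_iff_continuousAt.2 fun x => (h.der₂ x).continuousAt
    have e := cnrm_sq_eq (f := fun x => Ψ₂ x - m * Ψ x) (by fun_prop)
    simp only [Complex.reCLM_apply, Complex.imCLM_apply] at hre him
    simp only [Complex.sub_re, Complex.sub_im, Complex.re_ofReal_mul, Complex.im_ofReal_mul] at e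
    have hv := h.U_le
    nlinarith
  refine ⟨η, hη, hη1, ?_⟩
  intro μ δ κ d β m L Ψ Ψ₁ Ψ₂ Ψ₃ U U₁ U₂ F hμ hs hd hβ h
  rcases lt_or_gt_of_ne hμ with h0 | h0
  · rw [abs_of_neg h0] at hs
    have := pos hs hd (by rwa [abs_neg]) h.shift_pi
    rwa [VorticitySol.cnrm_shift h.perU, VorticitySol.cnrm_shift h.perF] at this
  · rw [abs_of_pos h0] at hs
    exact pos hs hd hβ h

/-! ### Fourier multipliers on `L²(𝕋)` -/

/-- The Fourier coefficients of `f ∈ L²(𝕋)`. -/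
abbrev fc (f : L2T) (n : ℤ) : ℂ := (fourierBasis (T := 2 * Real.pi)).repr f n

/-- The Fourier monomials in `L²(𝕋)`. -/
abbrev eT (n : ℤ) : L2T := fourierLp (T := 2 * Real.pi) 2 n

lemma ext_fc {f g : L2T} (h : ∀ n, fc f n = fc g n) : f = g := by
  apply (fourierBasis (T := 2 * Real.pi)).repr.injective
  ext n
  exact h n

lemma fc_eq_integral (f : L2T) (n : ℤ) :
    fc f n = ∫ y, f y * fourier (-n) y ∂torusMeasure := by
  rw [fc, fourierBasis_repr, fourierCoeff]
  simp only [smul_eq_mul, mul_comm]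

lemma fc_eq_inner (f : L2T) (n : ℤ) : fc f n = inner ℂ (eT n) f := by
  rw [fc, HilbertBasis.repr_apply_apply, coe_fourierBasis]

lemma fc_add (f g : L2T) (n : ℤ) : fc (f + g) n = fc f n + fc g n := by simp [fc]

lemma fc_sub (f g : L2T) (n : ℤ) : fc (f - g) n = fc f n - fc g n := by simp [fc]

lemma fc_neg (f : L2T) (n : ℤ) : fc (-f) n = -fc f n := by simp [fc]

lemma fc_smul (c : ℂ) (f : L2T) (n : ℤ) : fc (c • f) n = c * fc f n := by simp [fc]

lemma hasSum_fc (f : L2T) : HasSum (fun n => fc f n • eT n) f := by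
  have := (fourierBasis (T := 2 * Real.pi)).hasSum_repr f
  rwa [coe_fourierBasis] at this

lemma fc_eT (m n : ℤ) : fc (eT m) n = if n = m then 1 else 0 := by
  rw [fc_eq_inner]
  exact orthonormal_iff_ite.1 orthonormal_fourier n m

/-- The bounded multiplication operator on `ℓ²(ℤ)`. -/
def lpMul (a : ℤ → ℂ) (ha : ∀ n, ‖a n‖ ≤ 1) :
    lp (fun _ : ℤ => ℂ) 2 →L[ℂ] lp (fun _ : ℤ => ℂ) 2 :=
  LinearMap.mkContinuous
    { toFun := fun f => ⟨fun n => a n * f n, (lp.memℓp f).norm.mono fun n => by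
        rw [norm_mul]
        exact mul_le_of_le_one_left (norm_nonneg _) (ha n)⟩
      map_add' := fun f g => by
        ext n
        exact mul_add _ _ _
      map_smul' := fun c f => by
        ext n
        simp [mul_left_comm] } 1 fun f => by
      rw [one_mul]
      refine lp.norm_mono two_ne_zero fun n => ?_
      change ‖a n * f n‖ ≤ ‖f n‖
      rw [norm_mul]
      exact mul_le_of_le_one_left (norm_nonneg _) (ha n)

lemma lpMul_apply (a : ℤ → ℂ) (ha : ∀ n, ‖a n‖ ≤ 1) (f : lp (fun _ : ℤ => ℂ) 2) (n : ℤ) :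
    lpMul a ha f n = a n * f n := rfl

/-- The bounded operator on `L²(𝕋)` which multiplies the Fourier coefficients by `a`. -/
def fmul (a : ℤ → ℂ) (ha : ∀ n, ‖a n‖ ≤ 1) : L2T →L[ℂ] L2T :=
  ((fourierBasis (T := 2 * Real.pi)).repr.symm.toContinuousLinearEquiv :
      lp (fun _ : ℤ => ℂ) 2 →L[ℂ] L2T) ∘L lpMul a ha ∘L
    ((fourierBasis (T := 2 * Real.pi)).repr.toContinuousLinearEquiv :
      L2T →L[ℂ] lp (fun _ : ℤ => ℂ) 2)

lemma fc_fmul (a : ℤ → ℂ) (ha : ∀ n, ‖a n‖ ≤ 1) (f : L2T) (n : ℤ) :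
    fc (fmul a ha f) n = a n * fc f n := by
  simp [fc, fmul, lpMul_apply]

/-- The symbol of `-A_l`. -/
def symb (l n : ℤ) : ℝ := (n : ℝ) ^ 2 + (l : ℝ) ^ 2

lemma one_le_symb {l : ℤ} (hl : l ≠ 0) (n : ℤ) : 1 ≤ symb l n := by
  have h1 : (1 : ℝ) ≤ (l : ℝ) ^ 2 := by
    have : 0 < l ^ 2 := by positivity
    exact_mod_cast this
  have := sq_nonneg (n : ℝ)
  unfold symb
  linarith

lemma symb_pos {l : ℤ} (hl : l ≠ 0) (n : ℤ) : 0 < symb l n :=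
  zero_lt_one.trans_le (one_le_symb hl n)

lemma norm_inv_symb_le {l : ℤ} (hl : l ≠ 0) (n : ℤ) : ‖((symb l n : ℝ) : ℂ)⁻¹‖ ≤ 1 := by
  rw [norm_inv, Complex.norm_real, Real.norm_of_nonneg (symb_pos hl n).le]
  exact inv_le_one_of_one_le₀ (one_le_symb hl n)

/-- The operator `(-A_l)⁻¹`. -/
def opG {l : ℤ} (hl : l ≠ 0) : L2T →L[ℂ] L2T :=
  fmul (fun n => ((symb l n : ℝ) : ℂ)⁻¹) (norm_inv_symb_le hl)

lemma fc_opG {l : ℤ} (hl : l ≠ 0) (f : L2T) (n : ℤ) :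
    fc (opG hl f) n = ((symb l n : ℝ) : ℂ)⁻¹ * fc f n := fc_fmul _ _ _ _

lemma symb_ne_zero {l : ℤ} (hl : l ≠ 0) (n : ℤ) : ((symb l n : ℝ) : ℂ) ≠ 0 :=
  Complex.ofReal_ne_zero.2 (symb_pos hl n).ne'

lemma opG_injective {l : ℤ} (hl : l ≠ 0) {f g : L2T} (h : opG hl f = opG hl g) : f = g := by
  refine ext_fc fun n => ?_
  have := congrArg (fun u => fc u n) h
  simp only [fc_opG] at this
  exact mul_left_cancel₀ (inv_ne_zero (symb_ne_zero hl n)) this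

lemma summable_inv_symb {l : ℤ} (hl : l ≠ 0) : Summable fun n => (symb l n)⁻¹ := by
  have h1 : Summable fun n : ℤ => 1 / (n : ℝ) ^ 2 := Real.summable_one_div_int_pow.2 one_lt_two
  refine Summable.of_norm_bounded_eventually h1 ?_
  filter_upwards [(Set.finite_singleton (0 : ℤ)).compl_mem_cofinite] with n hn
  have hn0 : (n : ℝ) ≠ 0 := Int.cast_ne_zero.2 hn
  rw [Real.norm_of_nonneg (inv_nonneg.2 (symb_pos hl n).le), ← one_div]
  refine one_div_le_one_div_of_le (by positivity) ?_
  unfold symb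
  linarith [sq_nonneg (l : ℝ)]

/-- The rank-one Fourier components have norms 1/(n² + l²), which are summable. The operator is thus
a norm limit of finite-rank operators. -/
lemma isCompactOperator_opG {l : ℤ} (hl : l ≠ 0) : IsCompactOperator (opG hl) := by
  let F : ℤ → L2T →L[ℂ] L2T := fun n =>
    (((symb l n : ℝ) : ℂ)⁻¹ • innerSL ℂ (eT n)).smulRight (eT n)
  have hFa : ∀ n f, F n f = fc (opG hl f) n • eT n := fun n f => by
    rw [fc_opG, fc_eq_inner]
    rfl
  have hnorm : ∀ n, ‖F n‖ = (symb l n)⁻¹ := fun n => by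
    have h1 : ‖eT n‖ = 1 := orthonormal_fourier.1 n
    rw [ContinuousLinearMap.norm_smulRight_apply, norm_smul, innerSL_apply_norm, h1, norm_inv,
      Complex.norm_real, Real.norm_of_nonneg (symb_pos hl n).le]
    ring
  have hsum : Summable F := by
    refine Summable.of_norm ?_
    simp only [hnorm]
    exact summable_inv_symb hl
  have heq : ∑' n, F n = opG hl := by
    ext1 f
    have h1 : HasSum (fun n => F n f) ((∑' n, F n) f) :=
      hsum.hasSum.mapL (ContinuousLinearMap.apply ℂ L2T f)
    simp only [hFa] at h1
    exact h1.unique (hasSum_fc _)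
  have hlim := hsum.hasSum
  rw [heq] at hlim
  refine isCompactOperator_of_tendsto hlim (Filter.Eventually.of_forall fun s => ?_)
  have hF : ∀ n, IsCompactOperator (F n) := fun n => by
    have h1 : IsCompactOperator (((symb l n : ℝ) : ℂ)⁻¹ • innerSL ℂ (eT n) : L2T →L[ℂ] ℂ) :=
      isCompactOperator_of_locallyCompactSpace_dom _
    exact h1.continuous_comp (g := fun c : ℂ => c • eT n) (by fun_prop)
  change ⇑(∑ n ∈ s, F n) ∈ {f | IsCompactOperator f}
  induction s using Finset.cons_induction with
  | empty => exact isCompactOperator_zero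
  | cons n s hn ih =>
    rw [Finset.sum_cons]
    exact (hF n).add ih

/-! ### Integrals over the torus and weak derivatives -/

lemma integral_torus (f : Torus → ℂ) :
    ∫ y, f y ∂torusMeasure = ((2 * Real.pi)⁻¹ : ℝ) • ∫ x in (0 : ℝ)..(2 * Real.pi), f x := by
  rw [AddCircle.integral_haarAddCircle, ← AddCircle.intervalIntegral_preimage (2 * Real.pi) 0,
    zero_add]

lemma IsWeakDeriv.fc_eq {f g : L2T} (h : IsWeakDeriv f g) (n : ℤ) :
    fc g n = Complex.I * n * fc f n := by
  have h1 := h _ _ (contDiff_fourier_torus (-n)) (hasDerivAt_fourier_torus (-n))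
  rw [fc_eq_integral, fc_eq_integral]
  have e : ∀ y, f y * ((Complex.I * ((-n : ℤ) : ℂ)) • (fourier (-n) : C(Torus, ℂ))) y
      = -(Complex.I * n) * (f y * fourier (-n) y) := fun y => by
    simp only [ContinuousMap.smul_apply, smul_eq_mul]
    push_cast
    ring
  simp only [e] at h1
  rw [integral_const_mul] at h1
  linear_combination h1

lemma fc_toLp_deriv {φ ψ : C(Torus, ℂ)}
    (h : ∀ x : ℝ, HasDerivAt (fun x : ℝ => φ (x : Torus)) (ψ (x : Torus)) x) (n : ℤ) :
    fc (ContinuousMap.toLp 2 torusMeasure ℂ ψ) n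
      = Complex.I * n * fc (ContinuousMap.toLp 2 torusMeasure ℂ φ) n := by
  have e : ∀ θ : C(Torus, ℂ), fc (ContinuousMap.toLp 2 torusMeasure ℂ θ) n
      = ∫ y, θ y * fourier (-n) y ∂torusMeasure := fun θ => by
    rw [fc_eq_integral]
    refine integral_congr_ae ?_
    filter_upwards [ContinuousMap.coeFn_toLp (p := 2) (𝕜 := ℂ) torusMeasure θ] with y hy
    rw [hy]
  rw [e, e, integral_torus, integral_torus]
  have hd : ∀ x : ℝ, HasDerivAt
      (fun x : ℝ => φ (x : Torus) * (fourier (-n) : C(Torus, ℂ)) (x : Torus))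
      (ψ (x : Torus) * (fourier (-n) : C(Torus, ℂ)) (x : Torus)
        - Complex.I * n * (φ (x : Torus) * (fourier (-n) : C(Torus, ℂ)) (x : Torus))) x := by
    intro x
    refine ((h x).mul (hasDerivAt_fourier_torus (-n) x)).congr_deriv ?_
    simp only [ContinuousMap.smul_apply, smul_eq_mul]
    push_cast
    ring
  have cc : ∀ θ : C(Torus, ℂ), Continuous fun x : ℝ => θ (x : Torus) := fun θ =>
    θ.continuous.comp (AddCircle.continuous_mk' _)
  have c1 := cc φ
  have c2 := cc ψ
  have c3 := cc (fourier (-n))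
  have h1 := intervalIntegral.integral_eq_sub_of_hasDerivAt (a := 0) (b := 2 * Real.pi)
    (fun x _ => hd x) (Continuous.intervalIntegrable (by fun_prop) _ _)
  rw [intervalIntegral.integral_sub (Continuous.intervalIntegrable (by fun_prop) _ _)
    (Continuous.intervalIntegrable (by fun_prop) _ _), intervalIntegral.integral_const_mul] at h1
  have h2 : ((2 * Real.pi : ℝ) : Torus) = ((0 : ℝ) : Torus) := by
    rw [AddCircle.coe_period]; rfl
  rw [h2, sub_self, sub_eq_zero] at h1
  rw [h1, mul_smul_comm]

/-- By Parseval both integrals are sums over Fourier modes, and conjugation changes the sign of the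
factor in. -/
lemma isWeakDeriv_of_fc {f g : L2T} (h : ∀ n : ℤ, fc g n = Complex.I * n * fc f n) :
    IsWeakDeriv f g := by
  intro φ ψ _ hψ
  have key : ∀ (k : L2T) (θ : C(Torus, ℂ)), ∫ y, k y * θ y ∂torusMeasure
      = ∑' n, starRingEnd ℂ (fc (ContinuousMap.toLp 2 torusMeasure ℂ (star θ)) n) * fc k n := by
    intro k θ
    have h1 : ∫ y, k y * θ y ∂torusMeasure
        = inner ℂ (ContinuousMap.toLp 2 torusMeasure ℂ (star θ)) k := by
      rw [L2.inner_def]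
      refine integral_congr_ae ?_
      filter_upwards [ContinuousMap.coeFn_toLp (p := 2) (𝕜 := ℂ) torusMeasure (star θ)] with y hy
      rw [hy]
      simp
    rw [h1, ← HilbertBasis.tsum_inner_mul_inner (fourierBasis (T := 2 * Real.pi))]
    congr 1
    funext n
    rw [fc_eq_inner, fc_eq_inner, coe_fourierBasis, inner_conj_symm]
  have hstar : ∀ x : ℝ, HasDerivAt (fun x : ℝ => (star φ) (x : Torus)) ((star ψ) (x : Torus)) x :=
    fun x => (hψ x).star
  rw [key, key, ← tsum_neg]
  congr 1
  funext n
  rw [fc_toLp_deriv hstar, h]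
  simp only [map_mul, Complex.conj_I, map_intCast]
  ring

/-! ### The operators on the Fourier side -/

variable {l : ℤ}

/-- The bridge from weak derivatives to Fourier multipliers: on mode n the operator ∂² - l² is -(n²
+ l²), so the domain W^{2,2} is exactly the range of G. -/
lemma mem_graphA_iff (hl : l ≠ 0) (u w : L2T) : (u, w) ∈ graphA l ↔ u = -opG hl w := by
  constructor
  · rintro ⟨u', u'', h1, h2, h3⟩
    change w = u'' - ((l : ℂ) ^ 2) • u at h3
    refine ext_fc fun n => ?_
    rw [fc_neg, fc_opG, h3, fc_sub, fc_smul, h2.fc_eq, h1.fc_eq]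
    have hs := symb_ne_zero hl n
    field_simp
    simp only [symb]
    push_cast
    linear_combination ((n : ℂ) ^ 2 * fc u n) * Complex.I_sq
  · intro hu
    have hb : ∀ n : ℤ, ‖Complex.I * n * ((symb l n : ℝ) : ℂ)⁻¹‖ ≤ 1 := fun n => by
      rw [norm_mul, norm_mul, Complex.norm_I, one_mul, norm_inv, Complex.norm_real,
        Real.norm_of_nonneg (symb_pos hl n).le, Complex.norm_intCast, ← div_eq_mul_inv,
        div_le_one (symb_pos hl n)]
      have h1 : (1 : ℝ) ≤ (l : ℝ) ^ 2 := by
        have : 0 < l ^ 2 := by positivity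
        exact_mod_cast this
      unfold symb
      nlinarith [sq_abs (n : ℝ), sq_nonneg (|(n : ℝ)| - 1)]
    refine ⟨-fmul _ hb w, w + ((l : ℂ) ^ 2) • u, isWeakDeriv_of_fc fun n => ?_,
      isWeakDeriv_of_fc fun n => ?_, by simp⟩
    · rw [fc_neg, fc_fmul]
      change _ = Complex.I * n * fc u n
      rw [hu, fc_neg, fc_opG]
      ring
    · rw [fc_neg, fc_fmul, hu, fc_add, fc_smul, fc_neg, fc_opG]
      have hs := symb_ne_zero hl n
      field_simp
      simp only [symb]
      push_cast
      linear_combination ((n : ℂ) ^ 2 * fc w n) * Complex.I_sq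

lemma opG_mem_opA_domain (hl : l ≠ 0) (g : L2T) : opG hl g ∈ (opA l).domain := by
  refine LinearPMap.mem_domain_of_mem_graph (y := -g) ?_
  rw [opA_graph, mem_graphA_iff hl]
  simp

lemma opA_opG (hl : l ≠ 0) (g : L2T) (h : opG hl g ∈ (opA l).domain) :
    opA l ⟨opG hl g, h⟩ = -g := by
  have h1 := LinearPMap.mem_graph (opA l) ⟨opG hl g, h⟩
  rw [opA_graph, mem_graphA_iff hl, ← map_neg] at h1
  exact (neg_eq_iff_eq_neg.1 (opG_injective hl h1).symm)

lemma exists_eq_opG (hl : l ≠ 0) {u : L2T} (h : u ∈ (opA l).domain) : ∃ g, u = opG hl g := by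
  have h1 := LinearPMap.mem_graph (opA l) ⟨u, h⟩
  rw [opA_graph, mem_graphA_iff hl, ← map_neg] at h1
  exact ⟨_, h1⟩

lemma ker_opA (hl : l ≠ 0) : LinearMap.ker (opA l).toFun = ⊥ := by
  rw [LinearMap.ker_eq_bot']
  rintro ⟨u, hu⟩ h
  obtain ⟨g, rfl⟩ := exists_eq_opG hl hu
  have h1 := opA_opG hl g hu
  rw [LinearPMap.toFun_eq_coe] at h
  rw [h, zero_eq_neg] at h1
  simp [h1]

lemma mem_inverse_domain (hl : l ≠ 0) (f : L2T) : f ∈ (opA l).inverse.domain := by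
  rw [LinearPMap.inverse_domain]
  refine ⟨⟨opG hl (-f), opG_mem_opA_domain hl _⟩, ?_⟩
  rw [LinearPMap.toFun_eq_coe, opA_opG, neg_neg]

lemma opA_inverse_apply (hl : l ≠ 0) (f : L2T) (h : f ∈ (opA l).inverse.domain) :
    (opA l).inverse ⟨f, h⟩ = -opG hl f := by
  have h1 := LinearPMap.inverse_apply_eq (ker_opA hl) (y := ⟨f, h⟩)
    (x := ⟨opG hl (-f), opG_mem_opA_domain hl _⟩) (by rw [opA_opG, neg_neg])
  exact h1.trans (map_neg _ _)

lemma mem_opLambda_domain (hl : l ≠ 0) (f : L2T) : f ∈ (opLambda l).domain :=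
  mem_inverse_domain hl f

lemma opLambda_apply (hl : l ≠ 0) (f : L2T) (h : f ∈ (opLambda l).domain) :
    opLambda l ⟨f, h⟩ = mulSin (f - opG hl f) := by
  have h1 : opLambda l ⟨f, h⟩ = mulSin (f + (opA l).inverse ⟨f, mem_inverse_domain hl f⟩) := rfl
  rw [h1, opA_inverse_apply hl, ← sub_eq_add_neg]

lemma mem_opL_domain (hl : l ≠ 0) (α : ℝ) {u : L2T} :
    u ∈ (opL α l).domain ↔ u ∈ (opA l).domain :=
  ⟨fun h => h.1, fun h => ⟨h, mem_opLambda_domain hl u⟩⟩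

lemma opL_opG (hl : l ≠ 0) (α : ℝ) (g : L2T) (h : opG hl g ∈ (opL α l).domain) :
    opL α l ⟨opG hl g, h⟩
      = -g - (Complex.I * α * l) • mulSin (opG hl g - opG hl (opG hl g)) := by
  have h1 : opL α l ⟨opG hl g, h⟩ = opA l ⟨opG hl g, opG_mem_opA_domain hl g⟩
      - (Complex.I * α * l) • opLambda l ⟨opG hl g, mem_opLambda_domain hl _⟩ := rfl
  rw [h1, opA_opG hl, opLambda_apply hl]

/-! ### Multiplication by `sin` -/

lemma coeFn_mulSin (f : L2T) :
    mulSin f =ᵐ[torusMeasure] fun y => (sinT y : ℂ) * f y := (memLp_sin_mul f).coeFn_toLp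

lemma norm_sinT_le (y : Torus) : ‖(sinT y : ℂ)‖ ≤ 1 := by
  induction y using QuotientAddGroup.induction_on with
  | H x =>
    rw [Complex.norm_real]
    exact Real.abs_sin_le_one x

lemma norm_mulSin_le (f : L2T) : ‖mulSin f‖ ≤ ‖f‖ := by
  refine Lp.norm_le_norm_of_ae_le ?_
  filter_upwards [coeFn_mulSin f] with y hy
  rw [hy, norm_mul]
  exact mul_le_of_le_one_left (norm_nonneg _) (norm_sinT_le y)

/-- Multiplication by `sin` as a bounded operator. -/
def mulSinL : L2T →L[ℂ] L2T :=
  mulSin.mkContinuous 1 fun f => by rw [one_mul]; exact norm_mulSin_le f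

lemma inner_mulSin_left (f g : L2T) : inner ℂ (mulSin f) g = inner ℂ f (mulSin g) := by
  rw [L2.inner_def, L2.inner_def]
  refine integral_congr_ae ?_
  filter_upwards [coeFn_mulSin f, coeFn_mulSin g] with y hf hg
  rw [hf, hg]
  simp
  ring

/-- Thanks to this the shear drops out of the real part of the pairing with X. -/
lemma im_inner_mulSin (f : L2T) : (inner ℂ f (mulSin f)).im = 0 := by
  have h := inner_conj_symm (𝕜 := ℂ) f (mulSin f)
  rw [inner_mulSin_left] at h
  exact Complex.conj_eq_iff_im.1 h

/-! ### The space `Y_l` and the projection -/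

lemma mem_spaceY_iff {f : L2T} : f ∈ spaceY l ↔ (|l| = 1 → fc f 0 = 0) := by
  have : ∫ y, f y ∂torusMeasure = fc f 0 := by
    rw [fc_eq_integral]
    simp
  rw [← this]
  rfl

lemma opG_mem_spaceY (hl : l ≠ 0) {f : L2T} (hf : f ∈ spaceY l) : opG hl f ∈ spaceY l := by
  rw [mem_spaceY_iff] at hf ⊢
  intro h
  rw [fc_opG, hf h, mul_zero]

/-- The symbol of G has no zeros, so a vanishing mean passes back from G f to f. Hence every element
of the domain of ℚ_l L is in the range of `opGY`. -/
lemma mem_spaceY_of_opG (hl : l ≠ 0) {f : L2T} (hf : opG hl f ∈ spaceY l) : f ∈ spaceY l := by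
  rw [mem_spaceY_iff] at hf ⊢
  intro h
  have := hf h
  rw [fc_opG] at this
  exact (mul_eq_zero.1 this).resolve_left (inv_ne_zero (symb_ne_zero hl 0))

lemma projQ_coe (f : spaceY l) : projQ l f = f :=
  Submodule.orthogonalProjectionOnto_mem_subspace_eq_self f

lemma projQ_of_mem {f : L2T} (hf : f ∈ spaceY l) : (projQ l f : L2T) = f :=
  congrArg Subtype.val (projQ_coe ⟨f, hf⟩)

lemma inner_projQ (f : spaceY l) (h : L2T) : inner ℂ (f : L2T) (projQ l h : L2T)
    = inner ℂ (f : L2T) h :=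
  Submodule.inner_orthogonalProjectionOnto_eq_of_mem_left f h

/-- The projection removes the mean value if `|l| = 1`. -/
lemma projQ_eq (f : L2T) : (projQ l f : L2T) = f - (if |l| = 1 then fc f 0 else 0) • eT 0 := by
  split_ifs with h
  · have h1 : f - fc f 0 • eT 0 ∈ spaceY l := by
      rw [mem_spaceY_iff]
      intro _
      rw [fc_sub, fc_smul, fc_eT]
      simp
    have h2 : projQ l (eT 0) = 0 := by
      rw [projQ, Submodule.orthogonalProjectionOnto_eq_zero_iff, Submodule.mem_orthogonal']
      intro u hu
      rw [← fc_eq_inner]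
      exact mem_spaceY_iff.1 hu h
    have h3 := projQ_of_mem h1
    rwa [map_sub, map_smul, h2, smul_zero, sub_zero] at h3
  · rw [zero_smul, sub_zero]
    exact projQ_of_mem (mem_spaceY_iff.2 fun habs => absurd habs h)

/-! ### Reduction to a compact perturbation of the identity -/

/-- The restriction of `(-A_l)⁻¹` to `Y_l`. -/
def opGY (hl : l ≠ 0) : spaceY l →L[ℂ] spaceY l :=
  projQ l ∘L opG hl ∘L (spaceY l).subtypeL

lemma coe_opGY (hl : l ≠ 0) (g : spaceY l) : (opGY hl g : L2T) = opG hl g :=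
  projQ_of_mem (opG_mem_spaceY hl g.2)

/-- The operator `u ↦ (I + A_l⁻¹) u` after `(-A_l)⁻¹`. -/
def opX (hl : l ≠ 0) : spaceY l →L[ℂ] L2T :=
  (opG hl - opG hl ∘L opG hl) ∘L (spaceY l).subtypeL

lemma opX_apply (hl : l ≠ 0) (g : spaceY l) : opX hl g = opG hl g - opG hl (opG hl g) := rfl

lemma opX_mem (hl : l ≠ 0) (g : spaceY l) : opX hl g ∈ spaceY l :=
  Submodule.sub_mem _ (opG_mem_spaceY hl g.2) (opG_mem_spaceY hl (opG_mem_spaceY hl g.2))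

/-- The compact operator `T` with `(z + ℚ_l L_{α,l}) (-A_l)⁻¹ = T - 1`. -/
def opT (α : ℝ) (hl : l ≠ 0) (z : ℂ) : spaceY l →L[ℂ] spaceY l :=
  z • opGY hl - (Complex.I * α * l) • projQ l ∘L mulSinL ∘L opX hl

lemma opT_apply (α : ℝ) (hl : l ≠ 0) (z : ℂ) (g : spaceY l) :
    opT α hl z g = z • opGY hl g - (Complex.I * α * l) • projQ l (mulSin (opX hl g)) := rfl

lemma isCompactOperator_opGY (hl : l ≠ 0) : IsCompactOperator (opGY hl) :=
  ((isCompactOperator_opG hl).comp_clm (spaceY l).subtypeL).clm_comp (projQ l)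

lemma isCompactOperator_opX (hl : l ≠ 0) : IsCompactOperator (opX hl) :=
  ((isCompactOperator_opG hl).sub ((isCompactOperator_opG hl).comp_clm (opG hl))).comp_clm
    (spaceY l).subtypeL

lemma isCompactOperator_opT (α : ℝ) (hl : l ≠ 0) (z : ℂ) : IsCompactOperator (opT α hl z) :=
  ((isCompactOperator_opGY hl).smul z).sub
    ((((isCompactOperator_opX hl).clm_comp mulSinL).clm_comp (projQ l)).smul _)

lemma opGY_mem_domain (α : ℝ) (hl : l ≠ 0) (z : ℂ) (g : spaceY l) :
    opGY hl g ∈ (shift z (opQL α l)).domain := by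
  change (opGY hl g : L2T) ∈ (opL α l).domain
  rw [coe_opGY, mem_opL_domain hl]
  exact opG_mem_opA_domain hl _

lemma shift_opQL_opGY (α : ℝ) (hl : l ≠ 0) (z : ℂ) (g : spaceY l)
    (h : opGY hl g ∈ (shift z (opQL α l)).domain) :
    shift z (opQL α l) ⟨opGY hl g, h⟩ = opT α hl z g - g := by
  have h' : (opGY hl g : L2T) ∈ (opL α l).domain := h
  have h0 : shift z (opQL α l) ⟨opGY hl g, h⟩
      = z • opGY hl g + projQ l (opL α l ⟨(opGY hl g : L2T), h'⟩) := rfl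
  have h1 : ∀ (u : L2T) (hu : u ∈ (opL α l).domain), u = opG hl g → opL α l ⟨u, hu⟩
      = -g - (Complex.I * α * l) • mulSin (opX hl g) := by
    rintro u hu rfl
    rw [opL_opG hl, opX_apply]
  rw [h0, h1 _ _ (coe_opGY hl g), map_sub, map_neg, projQ_coe, map_smul, opT_apply]
  abel

lemma exists_eq_opGY (α : ℝ) (hl : l ≠ 0) (z : ℂ) {u : spaceY l}
    (hu : u ∈ (shift z (opQL α l)).domain) : ∃ g, u = opGY hl g := by
  change (u : L2T) ∈ (opL α l).domain at hu
  rw [mem_opL_domain hl] at hu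
  obtain ⟨g, hg⟩ := exists_eq_opG hl hu
  have hgY : g ∈ spaceY l := mem_spaceY_of_opG hl (hg ▸ u.2)
  refine ⟨⟨g, hgY⟩, Subtype.ext ?_⟩
  rw [coe_opGY, hg]

lemma opGY_injective (hl : l ≠ 0) : Function.Injective (opGY hl) := by
  intro a b h
  have := congrArg (fun u : spaceY l => (u : L2T)) h
  simp only [coe_opGY] at this
  exact Subtype.ext (opG_injective hl this)

/-- An a priori estimate yields a bounded inverse. -/
lemma exists_isBoundedInverse (α : ℝ) (hl : l ≠ 0) (z : ℂ) {M : ℝ}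
    (hM : ∀ g : spaceY l, ‖opGY hl g‖ ≤ M * ‖opT α hl z g - g‖) :
    ∃ R : spaceY l →L[ℂ] spaceY l, IsBoundedInverse (shift z (opQL α l)) R ∧
      ∀ f, ‖R f‖ ≤ M * ‖f‖ := by
  -- By the Fredholm alternative it is enough to exclude the eigenvalue 1. If T g = g, the a priori
  -- bound gives G g = 0, hence g = 0.
  have hres : (1 : ℂ) ∈ resolventSet ℂ (opT α hl z) := by
    refine ((isCompactOperator_opT α hl z).hasEigenvalue_or_mem_resolventSet
      one_ne_zero).resolve_left fun h => ?_
    obtain ⟨g, hg⟩ := h.exists_hasEigenvector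
    have h1 : opT α hl z g = g := by simpa using hg.apply_eq_smul
    have h2 := hM g
    rw [h1, sub_self, norm_zero, mul_zero] at h2
    have h3 : opGY hl g = opGY hl 0 := by
      rw [map_zero]
      exact norm_le_zero_iff.1 h2
    exact hg.2 (opGY_injective hl h3)
  obtain ⟨V, hV⟩ := spectrum.mem_resolventSet_iff.1 hres
  rw [map_one] at hV
  have hV' : ∀ g, V.1 g = g - opT α hl z g := fun g => by rw [hV]; rfl
  have hr : ∀ f, V.1 (V⁻¹.1 f) = f := fun f => by
    have h1 : (V.1 * V⁻¹.1) f = f := by rw [Units.mul_inv]; rfl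
    exact h1
  have hl' : ∀ g, V⁻¹.1 (V.1 g) = g := fun g => by
    have h1 : (V⁻¹.1 * V.1) g = g := by rw [Units.inv_mul]; rfl
    exact h1
  refine ⟨-(opGY hl ∘L V⁻¹.1), ⟨fun f => ?_, ?_⟩, fun f => ?_⟩
  · have h1 : (-(opGY hl ∘L V⁻¹.1)) f = opGY hl (-V⁻¹.1 f) := by
      rw [map_neg]
      rfl
    rw [h1]
    refine ⟨opGY_mem_domain α hl z _, ?_⟩
    rw [shift_opQL_opGY, map_neg, neg_sub_neg, ← hV', hr]
  · rintro ⟨u, hu⟩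
    obtain ⟨g, rfl⟩ := exists_eq_opGY α hl z hu
    rw [shift_opQL_opGY]
    change -opGY hl (V⁻¹.1 (opT α hl z g - g)) = opGY hl g
    rw [← neg_sub, ← hV', map_neg, hl', map_neg, neg_neg]
  · change ‖-opGY hl (V⁻¹.1 f)‖ ≤ _
    rw [norm_neg]
    refine (hM _).trans_eq ?_
    rw [← neg_sub, norm_neg, ← hV', hr]

/-- Since ζ - S = -((-ζ) + S), this passes from the sign convention of the resolvent bounds to that
of the spectrum. -/
lemma IsBoundedInverse.neg {E : Type*} [NormedAddCommGroup E] [NormedSpace ℂ E]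
    {S : E →ₗ.[ℂ] E} {R : E →L[ℂ] E} {ζ : ℂ} (h : IsBoundedInverse (shift (-ζ) S) R) :
    IsBoundedInverse (shift ζ (-S)) (-R) := by
  have key : ∀ (u : E) (hu : u ∈ (shift (-ζ) S).domain) (hu' : -u ∈ (shift ζ (-S)).domain),
      shift ζ (-S) ⟨-u, hu'⟩ = shift (-ζ) S ⟨u, hu⟩ := fun u hu hu' => by
    have h1 : shift ζ (-S) ⟨-u, hu'⟩ = ζ • (-u) + -S ⟨-u, hu'⟩ := rfl
    have h2 : shift (-ζ) S ⟨u, hu⟩ = (-ζ) • u + S ⟨u, hu⟩ := rfl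
    have h3 : S ⟨-u, hu'⟩ = -S ⟨u, hu⟩ := by
      rw [← LinearPMap.map_neg]
      rfl
    rw [h1, h2, h3, neg_neg, smul_neg, neg_smul]
  refine ⟨fun f => ?_, ?_⟩
  · obtain ⟨hd, he⟩ := h.1 f
    have hd' : -R f ∈ (shift ζ (-S)).domain := Submodule.neg_mem _ hd
    exact ⟨hd', (key _ hd hd').trans he⟩
  · rintro ⟨u, hu⟩
    have hd : -u ∈ (shift (-ζ) S).domain := Submodule.neg_mem _ hu
    have h1 := h.2 ⟨-u, hd⟩
    rw [← key (-u) hd (by rwa [neg_neg])] at h1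
    simp only [neg_neg] at h1
    change -R _ = u
    rw [h1]
    exact neg_neg u

/-! ### Parseval identities and the energy estimate -/

variable {l : ℤ}

lemma hasSum_inner_fc {a b : L2T} {c : ℤ → ℂ} {p q : ℤ → ℝ} (ha : ∀ n, fc a n = p n * c n)
    (hb : ∀ n, fc b n = q n * c n) :
    HasSum (fun n => ((p n * q n * ‖c n‖ ^ 2 : ℝ) : ℂ)) (inner ℂ a b) := by
  have h := (fourierBasis (T := 2 * Real.pi)).hasSum_inner_mul_inner a b
  refine h.congr_fun fun n => ?_
  rw [coe_fourierBasis, ← inner_conj_symm a, ← fc_eq_inner, ← fc_eq_inner, ha, hb, map_mul,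
    Complex.conj_ofReal]
  push_cast
  rw [← Complex.conj_mul' (c n)]
  ring

lemma im_inner_fc {a b : L2T} {c : ℤ → ℂ} {p q : ℤ → ℝ} (ha : ∀ n, fc a n = p n * c n)
    (hb : ∀ n, fc b n = q n * c n) : (inner ℂ a b).im = 0 := by
  have h := Complex.hasSum_im (hasSum_inner_fc ha hb)
  simp only [Complex.ofReal_im] at h
  exact h.unique hasSum_zero

/-- Quadratic forms of real multipliers are compared symbol by symbol, and only on the modes that
are present. Membership in Y_l enters through this restriction. -/
lemma re_inner_le_of_fc {a b a' b' : L2T} {c : ℤ → ℂ} {p q p' q' : ℤ → ℝ}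
    (ha : ∀ n, fc a n = p n * c n) (hb : ∀ n, fc b n = q n * c n)
    (ha' : ∀ n, fc a' n = p' n * c n) (hb' : ∀ n, fc b' n = q' n * c n) (k : ℝ)
    (h : ∀ n, c n ≠ 0 → p n * q n ≤ k * (p' n * q' n)) :
    (inner ℂ a b).re ≤ k * (inner ℂ a' b').re := by
  have h1 := Complex.hasSum_re (hasSum_inner_fc ha hb)
  have h2 := (Complex.hasSum_re (hasSum_inner_fc ha' hb')).mul_left k
  simp only [Complex.ofReal_re] at h1 h2
  refine hasSum_le (fun n => ?_) h1 h2
  by_cases hc : c n = 0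
  · simp [hc]
  · rw [← mul_assoc]
    exact mul_le_mul_of_nonneg_right (h n hc) (sq_nonneg _)

/-- For l ≠ 0 the only value of n² + l² below 2 occurs at |l| = 1, n = 0. That mode is the kernel of
1 + A_l⁻¹, and Y_l excludes it. -/
lemma two_le_symb (hl : l ≠ 0) {g : L2T} (hg : g ∈ spaceY l) {n : ℤ} (hn : fc g n ≠ 0) :
    2 ≤ symb l n := by
  have h : (2 : ℤ) ≤ n ^ 2 + l ^ 2 := by
    by_cases h1 : |l| = 1
    · have hn0 : n ≠ 0 := by
        rintro rfl
        exact hn (mem_spaceY_iff.1 hg h1)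
      have : 0 < n ^ 2 := by positivity
      have : 0 < l ^ 2 := by positivity
      omega
    · have h2 : 2 ≤ |l| := by
        have := abs_pos.2 hl
        omega
      nlinarith [sq_abs l, sq_nonneg n]
  unfold symb
  exact_mod_cast h

lemma inv_symb_bounds (hl : l ≠ 0) {g : spaceY l} {n : ℤ} (hn : fc (g : L2T) n ≠ 0) :
    0 < (symb l n)⁻¹ ∧ (symb l n)⁻¹ ≤ 1 / 2 := by
  have h := two_le_symb hl g.2 hn
  refine ⟨inv_pos.2 (by linarith), ?_⟩
  rw [← one_div]
  exact one_div_le_one_div_of_le two_pos h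

section Symbols

variable (hl : l ≠ 0) (g : spaceY l)

lemma fc_self_eq (f : L2T) (n : ℤ) : fc f n = ((1 : ℝ) : ℂ) * fc f n := by simp

lemma fc_opG_eq (f : L2T) (n : ℤ) : fc (opG hl f) n = (((symb l n)⁻¹ : ℝ) : ℂ) * fc f n := by
  rw [fc_opG]
  push_cast
  rfl

lemma fc_opX_eq (n : ℤ) :
    fc (opX hl g) n = (((symb l n)⁻¹ - (symb l n)⁻¹ ^ 2 : ℝ) : ℂ) * fc (g : L2T) n := by
  rw [opX_apply, fc_sub, fc_opG hl (opG hl g), fc_opG hl g]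
  push_cast
  ring

lemma norm_sq_eq_re_inner (f : L2T) : ‖f‖ ^ 2 = (inner ℂ f f).re := by
  rw [inner_self_eq_norm_sq_to_K]
  norm_cast

lemma two_mul_norm_opG_sq_le :
    2 * ‖opG hl g‖ ^ 2 ≤ (inner ℂ (opG hl g) (g : L2T)).re := by
  have := re_inner_le_of_fc (fc_opG_eq hl g) (fc_opG_eq hl g) (fc_opG_eq hl g)
    (fc_self_eq (g : L2T)) (1 / 2) fun n hn => by
      obtain ⟨h1, h2⟩ := inv_symb_bounds hl hn
      nlinarith
  rw [norm_sq_eq_re_inner]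
  linarith

lemma re_inner_opG_le_opX :
    (inner ℂ (opG hl g) (g : L2T)).re ≤ 2 * (inner ℂ (opX hl g) (g : L2T)).re :=
  re_inner_le_of_fc (fc_opG_eq hl g) (fc_self_eq (g : L2T)) (fc_opX_eq hl g)
    (fc_self_eq (g : L2T)) 2 fun n hn => by
      obtain ⟨h1, h2⟩ := inv_symb_bounds hl hn
      nlinarith

lemma norm_opX_sq_le : ‖opX hl g‖ ^ 2 ≤ (inner ℂ (opX hl g) (opG hl g)).re := by
  have := re_inner_le_of_fc (fc_opX_eq hl g) (fc_opX_eq hl g) (fc_opX_eq hl g)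
    (fc_opG_eq hl g) 1 fun n hn => by
      obtain ⟨h1, h2⟩ := inv_symb_bounds hl hn
      rw [one_mul]
      refine mul_le_mul_of_nonneg_left ?_ ?_ <;> nlinarith
  rw [norm_sq_eq_re_inner]
  linarith

lemma norm_opG_sq_le : ‖opG hl g‖ ^ 2 ≤ 2 * (inner ℂ (opX hl g) (opG hl g)).re := by
  rw [norm_sq_eq_re_inner]
  refine re_inner_le_of_fc (fc_opG_eq hl g) (fc_opG_eq hl g) (fc_opX_eq hl g)
    (fc_opG_eq hl g) 2 fun n hn => ?_
  obtain ⟨h1, h2⟩ := inv_symb_bounds hl hn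
  rw [← mul_assoc]
  refine mul_le_mul_of_nonneg_right ?_ h1.le
  nlinarith

lemma norm_opX_le : ‖opX hl g‖ ≤ ‖opG hl g‖ := by
  have h := norm_opX_sq_le hl g
  have h1 := (Complex.re_le_norm _).trans (norm_inner_le_norm (𝕜 := ℂ) (opX hl g) (opG hl g))
  nlinarith [norm_nonneg (opX hl g), norm_nonneg (opG hl g)]

lemma re_inner_opX_opG_nonneg : 0 ≤ (inner ℂ (opX hl g) (opG hl g)).re :=
  (sq_nonneg _).trans (norm_opX_sq_le hl g)

lemma norm_opGY : ‖opGY hl g‖ = ‖opG hl g‖ := by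
  rw [← coe_opGY]
  rfl

variable (α : ℝ) (z : ℂ)

lemma coe_opT_sub : ((opT α hl z g - g : spaceY l) : L2T)
    = z • opG hl g - (Complex.I * α * l) • (projQ l (mulSin (opX hl g)) : L2T) - g := by
  rw [opT_apply, Submodule.coe_sub, Submodule.coe_sub, Submodule.coe_smul, Submodule.coe_smul,
    coe_opGY]

/-- Pairing with X = (1 + A_l⁻¹)u instead of u turns the shear into the symmetric expression ⟨X, sin
X⟩. The projection disappears because X lies in Y_l. -/
lemma inner_opX_opT_sub : inner ℂ (opX hl g) ((opT α hl z g - g : spaceY l) : L2T)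
    = z * inner ℂ (opX hl g) (opG hl g)
      - Complex.I * α * l * inner ℂ (opX hl g) (mulSin (opX hl g))
      - inner ℂ (opX hl g) (g : L2T) := by
  rw [coe_opT_sub, inner_sub_right, inner_sub_right, inner_smul_right, inner_smul_right,
    inner_projQ ⟨opX hl g, opX_mem hl g⟩]

lemma re_inner_opX_opT_sub : (inner ℂ (opX hl g) ((opT α hl z g - g : spaceY l) : L2T)).re
    = z.re * (inner ℂ (opX hl g) (opG hl g)).re - (inner ℂ (opX hl g) (g : L2T)).re := by
  have h1 := im_inner_fc (fc_opX_eq hl g) (fc_opG_eq hl g)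
  have h2 := im_inner_mulSin (opX hl g)
  rw [inner_opX_opT_sub]
  simp [h1, h2]

lemma im_inner_opX_opT_sub : (inner ℂ (opX hl g) ((opT α hl z g - g : spaceY l) : L2T)).im
    = z.im * (inner ℂ (opX hl g) (opG hl g)).re
      - α * l * (inner ℂ (opX hl g) (mulSin (opX hl g))).re := by
  have h1 := im_inner_fc (fc_opX_eq hl g) (fc_opG_eq hl g)
  have h2 := im_inner_mulSin (opX hl g)
  have h3 := im_inner_fc (fc_opX_eq hl g) (fc_self_eq (g : L2T))
  rw [inner_opX_opT_sub]
  simp [h1, h2, h3]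

lemma norm_inner_opX_opT_sub_le :
    ‖inner ℂ (opX hl g) ((opT α hl z g - g : spaceY l) : L2T)‖
      ≤ ‖opT α hl z g - g‖ * ‖opG hl g‖ := by
  refine (norm_inner_le_norm _ _).trans ?_
  rw [mul_comm]
  exact mul_le_mul_of_nonneg_left (norm_opX_le hl g) (norm_nonneg _)

variable {z}

/-- The energy estimate. -/
lemma energy_le (hz : z.re ≤ 0) : (inner ℂ (opG hl g) (g : L2T)).re
    ≤ 2 * (‖opT α hl z g - g‖ * ‖opG hl g‖) := by
  have h1 := re_inner_opX_opT_sub hl g α z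
  have h2 := norm_inner_opX_opT_sub_le hl g α z
  have h3 := Complex.abs_re_le_norm (inner ℂ (opX hl g) ((opT α hl z g - g : spaceY l) : L2T))
  have h4 := re_inner_opG_le_opX hl g
  have h5 := neg_le_of_abs_le (h3.trans h2)
  have h6 := mul_nonpos_of_nonpos_of_nonneg hz (re_inner_opX_opG_nonneg hl g)
  linarith

/-- The dissipative estimate. -/
lemma norm_opGY_le_of_re_nonpos (hz : z.re ≤ 0) : ‖opGY hl g‖ ≤ 1 * ‖opT α hl z g - g‖ := by
  have h1 := energy_le hl g α hz
  have h2 := two_mul_norm_opG_sq_le hl g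
  rw [norm_opGY, one_mul]
  rcases (norm_nonneg (opG hl g)).eq_or_lt with h | h
  · rw [← h]
    exact norm_nonneg _
  · nlinarith

/-- The estimate outside the numerical range of the shear. -/
lemma norm_opGY_le_of_one_lt {μ : ℝ} (hμ : 1 < |μ|) (hβ : α * l ≠ 0)
    (hz : z = Complex.I * (α * l * μ : ℝ)) :
    ‖opGY hl g‖ ≤ 2 / (|α * l| * (|μ| - 1)) * ‖opT α hl z g - g‖ := by
  have h1 := im_inner_opX_opT_sub hl g α z
  have h2 := norm_inner_opX_opT_sub_le hl g α z
  have h3 := Complex.abs_im_le_norm (inner ℂ (opX hl g) ((opT α hl z g - g : spaceY l) : L2T))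
  have h4 := norm_opX_sq_le hl g
  have h5 := norm_opG_sq_le hl g
  have h6 : |(inner ℂ (opX hl g) (mulSin (opX hl g))).re| ≤ ‖opX hl g‖ ^ 2 := by
    refine (Complex.abs_re_le_norm _).trans ((norm_inner_le_norm _ _).trans ?_)
    rw [sq]
    exact mul_le_mul_of_nonneg_left (norm_mulSin_le _) (norm_nonneg _)
  set A := (inner ℂ (opX hl g) (opG hl g)).re
  set s := (inner ℂ (opX hl g) (mulSin (opX hl g))).re
  have hA : 0 ≤ A := re_inner_opX_opG_nonneg hl g
  have hzim : z.im = α * l * μ := by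
    rw [hz]
    simp
  rw [h1, hzim, show α * l * μ * A - α * l * s = α * l * (μ * A - s) by ring, abs_mul] at h3
  -- Here |s| ≤ ‖X‖² ≤ A, so the imaginary part of the pairing is at least |αl|(|μ| - 1)A in
  -- modulus.
  have h7 : |μ| * A - A ≤ |μ * A - s| := by
    have := abs_sub_abs_le_abs_sub (μ * A) s
    rw [abs_mul, abs_of_nonneg hA] at this
    linarith
  have hb : 0 < |α * l| := abs_pos.2 hβ
  have hpos : 0 < |α * l| * (|μ| - 1) := mul_pos hb (by linarith)
  rw [norm_opGY, div_mul_eq_mul_div, le_div_iff₀ hpos]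
  have h8 : |α * l| * (|μ| - 1) * ‖opG hl g‖ ^ 2 ≤ 2 * (‖opT α hl z g - g‖ * ‖opG hl g‖) := by
    have h9 : |α * l| * (|μ| * A - A) ≤ |α * l| * |μ * A - s| :=
      mul_le_mul_of_nonneg_left h7 hb.le
    have h10 := mul_le_mul_of_nonneg_left h5 hpos.le
    nlinarith
  rcases (norm_nonneg (opG hl g)).eq_or_lt with h | h
  · rw [← h]
    have := norm_nonneg (opT α hl z g - g)
    linarith
  · nlinarith

end Symbols

/-! ### Trigonometric polynomials -/

variable {l : ℤ}

/-- The class of a continuous function in `L²(𝕋)`. -/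
abbrev toL2 (φ : C(Torus, ℂ)) : L2T := ContinuousMap.toLp 2 torusMeasure ℂ φ

lemma hasSum_norm_fc_sq (f : L2T) : HasSum (fun n => ‖fc f n‖ ^ 2) (‖f‖ ^ 2) := by
  have h := Complex.hasSum_re (hasSum_inner_fc (fc_self_eq f) (fc_self_eq f))
  simp only [Complex.ofReal_re, one_mul] at h
  rwa [norm_sq_eq_re_inner]

lemma norm_le_of_fc {f g : L2T} {k : ℝ} (hk : 0 ≤ k) (h : ∀ n, ‖fc f n‖ ≤ k * ‖fc g n‖) :
    ‖f‖ ≤ k * ‖g‖ := by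
  refine le_of_sq_le_sq ?_ (by positivity)
  rw [mul_pow]
  refine hasSum_le (fun n => ?_) (hasSum_norm_fc_sq f) ((hasSum_norm_fc_sq g).mul_left (k ^ 2))
  rw [← mul_pow]
  exact pow_le_pow_left₀ (norm_nonneg _) (h n) 2

lemma continuous_coe_comp (φ : C(Torus, ℂ)) : Continuous fun x : ℝ => φ (x : Torus) :=
  φ.continuous.comp (AddCircle.continuous_mk' _)

lemma periodic_coe_comp (φ : C(Torus, ℂ)) :
    Function.Periodic (fun x : ℝ => φ (x : Torus)) (2 * Real.pi) := fun x => by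
  change φ ((x + 2 * Real.pi : ℝ) : Torus) = φ (x : Torus)
  rw [AddCircle.coe_add_period]

lemma cnrm_coe_comp (φ : C(Torus, ℂ)) :
    cnrm (fun x : ℝ => φ (x : Torus)) = √(2 * Real.pi) * ‖toL2 φ‖ := by
  have h : cnrm (fun x : ℝ => φ (x : Torus)) ^ 2 = 2 * Real.pi * ‖toL2 φ‖ ^ 2 := by
    have h1 : ((‖toL2 φ‖ ^ 2 : ℝ) : ℂ) = ∫ y, ((‖φ y‖ ^ 2 : ℝ) : ℂ) ∂torusMeasure := by
      have h0 : ((‖toL2 φ‖ ^ 2 : ℝ) : ℂ) = inner ℂ (toL2 φ) (toL2 φ) := by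
        rw [inner_self_eq_norm_sq_to_K]
        push_cast
        rfl
      rw [h0, L2.inner_def]
      refine integral_congr_ae ?_
      filter_upwards [ContinuousMap.coeFn_toLp (p := 2) (𝕜 := ℂ) torusMeasure φ] with y hy
      rw [hy, inner_self_eq_norm_sq_to_K]
      push_cast
      rfl
    rw [integral_torus, intervalIntegral.integral_ofReal, Complex.real_smul,
      ← Complex.ofReal_mul] at h1
    have h2 := Complex.ofReal_injective h1
    rw [h2, cnrm_sq, pint]
    field_simp
  rw [← Real.sqrt_sq (cnrm_nonneg _), h, Real.sqrt_mul (by positivity),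
    Real.sqrt_sq (norm_nonneg _)]

/-- The trigonometric polynomial with coefficients `a n`, `n ∈ s`. -/
def trigPoly (s : Finset ℤ) (a : ℤ → ℂ) : C(Torus, ℂ) := ∑ n ∈ s, a n • fourier n

lemma trigPoly_apply (s : Finset ℤ) (a : ℤ → ℂ) (y : Torus) :
    trigPoly s a y = ∑ n ∈ s, a n * fourier n y := by
  simp [trigPoly, ContinuousMap.sum_apply]

lemma hasDerivAt_trigPoly {s : Finset ℤ} {a b : ℤ → ℂ} (h : ∀ n, b n = Complex.I * n * a n)
    (x : ℝ) : HasDerivAt (fun x : ℝ => trigPoly s a (x : Torus)) (trigPoly s b (x : Torus)) x := by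
  simp only [trigPoly_apply]
  refine HasDerivAt.fun_sum fun n _ => ?_
  refine ((hasDerivAt_fourier_torus n x).const_mul (a n)).congr_deriv ?_
  rw [h, ContinuousMap.smul_apply, smul_eq_mul]
  ring

lemma toL2_trigPoly (s : Finset ℤ) (a : ℤ → ℂ) : toL2 (trigPoly s a) = ∑ n ∈ s, a n • eT n := by
  rw [toL2, trigPoly, map_sum]
  refine Finset.sum_congr rfl fun n _ => ?_
  rw [map_smul]

lemma fc_sum_smul_eT (s : Finset ℤ) (a : ℤ → ℂ) (n : ℤ) :
    fc (∑ k ∈ s, a k • eT k) n = if n ∈ s then a n else 0 := by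
  rw [fc_eq_inner, inner_sum]
  simp only [inner_smul_right, ← fc_eq_inner, fc_eT, mul_ite, mul_one, mul_zero]
  exact Finset.sum_ite_eq s n a

/-- Multiplication of a continuous function by `sin`. -/
def sinC : C(Torus, ℂ) := ⟨fun y => (sinT y : ℂ), Complex.continuous_ofReal.comp sinT.continuous⟩

lemma toL2_sinC_mul (φ : C(Torus, ℂ)) : toL2 (sinC * φ) = mulSin (toL2 φ) := by
  refine Lp.ext ?_
  filter_upwards [ContinuousMap.coeFn_toLp (p := 2) (𝕜 := ℂ) torusMeasure (sinC * φ),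
    ContinuousMap.coeFn_toLp (p := 2) (𝕜 := ℂ) torusMeasure φ, coeFn_mulSin (toL2 φ)]
    with y h1 h2 h3
  rw [h1, h3, h2]
  rfl

/-- U is G g, and Ψ is A_l⁻¹ U minus the constant a/μ. The constant absorbs the mean a removed by
ℚ_l; it leaves v unchanged because m = l² - 1 is zero for |l| = 1, and a = 0 otherwise. The division
by a requires μ ≠ 0 in the denominator, and finite Fourier support makes every function smooth. -/
lemma exists_vorticitySol (α : ℝ) (hl : l ≠ 0) {μ : ℝ} (hμ : μ ≠ 0) (g : spaceY l)
    {s : Finset ℤ} (hs : ∀ n ∉ s, fc (g : L2T) n = 0) :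
    ∃ Ψ Ψ₁ Ψ₂ Ψ₃ U U₁ U₂ F : ℝ → ℂ,
      VorticitySol μ (α * l) ((l : ℝ) ^ 2 - 1) ((l : ℝ) ^ 2) Ψ Ψ₁ Ψ₂ Ψ₃ U U₁ U₂ F ∧
      cnrm U = √(2 * Real.pi) * ‖opGY hl g‖ ∧
      cnrm F = √(2 * Real.pi) * ‖opT α hl (Complex.I * (α * l * μ : ℝ)) g - g‖ := by
  have hl1 : (1 : ℝ) ≤ (l : ℝ) ^ 2 := by
    have : 0 < l ^ 2 := by positivity
    exact_mod_cast this
  set N : ℤ → ℂ := fun n => ((symb l n : ℝ) : ℂ) with hN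
  have hN0 : ∀ n, N n ≠ 0 := symb_ne_zero hl
  have hNe : ∀ n, N n = (n : ℂ) ^ 2 + (l : ℂ) ^ 2 := fun n => by simp [hN, symb]
  set P : (ℤ → ℂ) → C(Torus, ℂ) := fun p => trigPoly s fun n => p n * fc (g : L2T) n with hP
  have fcP : ∀ p n, fc (toL2 (P p)) n = p n * fc (g : L2T) n := fun p n => by
    rw [hP, toL2_trigPoly, fc_sum_smul_eT]
    split_ifs with h
    · rfl
    · rw [hs n h, mul_zero]
  have derP : ∀ {p q : ℤ → ℂ}, (∀ n, q n = Complex.I * n * p n) → ∀ x : ℝ,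
      HasDerivAt (fun x : ℝ => P p (x : Torus)) (P q (x : Torus)) x := fun h x =>
    hasDerivAt_trigPoly (fun n => by rw [h]; ring) x
  have linP : ∀ {p q r : ℤ → ℂ} (c : ℂ), (∀ n, r n = p n - c * q n) → ∀ y : Torus,
      P r y = P p y - c * P q y := fun c h y => by
    simp only [hP, trigPoly_apply, Finset.mul_sum, ← Finset.sum_sub_distrib]
    refine Finset.sum_congr rfl fun n _ => ?_
    rw [h]
    ring
  set pU : ℤ → ℂ := fun n => (N n)⁻¹ with hpU
  set pU₁ : ℤ → ℂ := fun n => Complex.I * n * (N n)⁻¹ with hpU₁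
  set pU₂ : ℤ → ℂ := fun n => Complex.I * n * (Complex.I * n * (N n)⁻¹) with hpU₂
  set p0 : ℤ → ℂ := fun n => -(N n)⁻¹ ^ 2 with hp0
  set p1 : ℤ → ℂ := fun n => Complex.I * n * (-(N n)⁻¹ ^ 2) with hp1
  set p2 : ℤ → ℂ := fun n => Complex.I * n * (Complex.I * n * (-(N n)⁻¹ ^ 2)) with hp2
  set p3 : ℤ → ℂ := fun n => Complex.I * n * (Complex.I * n * (Complex.I * n * (-(N n)⁻¹ ^ 2)))
    with hp3
  set pX : ℤ → ℂ := fun n => (N n)⁻¹ - (N n)⁻¹ ^ 2 with hpX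
  have eU : toL2 (P pU) = opG hl g := ext_fc fun n => by rw [fcP, fc_opG]
  have eX : toL2 (P pX) = opX hl g := ext_fc fun n => by
    rw [fcP, fc_opX_eq]
    push_cast
    rfl
  have e1 : toL2 (P fun _ => 1) = g := ext_fc fun n => by rw [fcP, one_mul]
  set a : ℂ := if |l| = 1 then fc (mulSin (opX hl g)) 0 else 0 with ha
  set z : ℂ := Complex.I * (α * l * μ : ℝ) with hz
  set F : C(Torus, ℂ) := z • P pU - (Complex.I * α * l) • (sinC * P pX - a • fourier 0)
    - P fun _ => 1 with hF
  have eF : toL2 F = ((opT α hl z g - g : spaceY l) : L2T) := by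
    rw [coe_opT_sub, projQ_eq, hF, toL2, map_sub, map_sub, map_smul, map_smul, map_sub, map_smul]
    change z • toL2 (P pU) - (Complex.I * α * l) • (toL2 (sinC * P pX) - a • eT 0)
      - toL2 (P fun _ => 1) = _
    rw [toL2_sinC_mul, eU, eX, e1]
  -- the mean value only enters when the coefficient of `Ψ` vanishes
  have hma : ((l : ℂ) ^ 2 - 1) * (a / μ) = 0 := by
    by_cases h : |l| = 1
    · have : l ^ 2 = 1 := by rw [← sq_abs, h]; rfl
      have h2 : (l : ℂ) ^ 2 = 1 := by exact_mod_cast this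
      rw [h2, sub_self, zero_mul]
    · rw [ha, if_neg h, zero_div, mul_zero]
  have hpX2 : ∀ n, pX n = p2 n - ((l : ℂ) ^ 2 - 1) * p0 n := fun n => by
    have := hN0 n
    simp only [hpX, hp2, hp0]
    field_simp
    rw [hNe]
    linear_combination ((n : ℂ) ^ 2) * Complex.I_sq
  have eV : ∀ y : Torus, P p2 y - (((l : ℝ) ^ 2 - 1 : ℝ) : ℂ) * (P p0 y - a / μ) = P pX y := by
    intro y
    rw [linP (p := p2) (q := p0) (r := pX) ((l : ℂ) ^ 2 - 1) hpX2]
    push_cast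
    linear_combination hma
  have h2pi : 0 ≤ √(2 * Real.pi) := Real.sqrt_nonneg _
  refine ⟨fun x => P p0 (x : Torus) - a / μ, fun x => P p1 (x : Torus), fun x => P p2 (x : Torus),
    fun x => P p3 (x : Torus), fun x => P pU (x : Torus), fun x => P pU₁ (x : Torus),
    fun x => P pU₂ (x : Torus), fun x => F (x : Torus), ?_, ?_, ?_⟩
  · have eV' : (fun x : ℝ => P p2 (x : Torus) - (((l : ℝ) ^ 2 - 1 : ℝ) : ℂ)
        * (P p0 (x : Torus) - a / μ)) = fun x : ℝ => P pX (x : Torus) := funext fun x => eV x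
    have eV₁ : (fun x : ℝ => P p3 (x : Torus) - (((l : ℝ) ^ 2 - 1 : ℝ) : ℂ) * P p1 (x : Torus))
        = fun x : ℝ => P (fun n => Complex.I * n * pX n) (x : Torus) := funext fun x => by
      rw [linP (p := p3) (q := p1) (r := fun n => Complex.I * n * pX n) ((l : ℂ) ^ 2 - 1)
        fun n => by
          simp only [hpX2, hp3, hp2, hp1, hp0]
          ring]
      push_cast
      rfl
    have hpX' : ∀ n, ‖pX n‖ = |(symb l n)⁻¹ - (symb l n)⁻¹ ^ 2| := fun n => by
      rw [← Real.norm_eq_abs, ← Complex.norm_real]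
      push_cast
      rfl
    have hpU' : ∀ n, ‖pU n‖ = (symb l n)⁻¹ := fun n => by
      rw [← abs_of_pos (inv_pos.2 (symb_pos hl n)), ← Real.norm_eq_abs, ← Complex.norm_real]
      push_cast
      rfl
    have hpU₁' : ∀ n, ‖pU₁ n‖ = |(n : ℝ)| * (symb l n)⁻¹ := fun n => by
      rw [hpU₁, norm_mul, norm_mul, Complex.norm_I, Complex.norm_intCast, one_mul, ← hpU' n]
    have hp2' : ∀ n, ‖p2 n‖ = (n : ℝ) ^ 2 * (symb l n)⁻¹ ^ 2 := fun n => by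
      simp only [hp2, norm_mul, norm_neg, norm_pow, Complex.norm_I, Complex.norm_intCast]
      rw [← sq_abs (n : ℝ), ← hpU' n]
      ring
    have comp : ∀ {p q : ℤ → ℂ} (k : ℝ), 0 ≤ k →
        (∀ n, fc (g : L2T) n ≠ 0 → ‖p n‖ ≤ k * ‖q n‖) →
        cnrm (fun x : ℝ => P p (x : Torus)) ≤ k * cnrm fun x : ℝ => P q (x : Torus) := by
      intro p q k hk h
      rw [cnrm_coe_comp, cnrm_coe_comp, mul_left_comm]
      refine mul_le_mul_of_nonneg_left (norm_le_of_fc hk fun n => ?_) h2pi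
      rw [fcP, fcP]
      by_cases hn : fc (g : L2T) n = 0
      · simp [hn]
      · rw [norm_mul, norm_mul, ← mul_assoc]
        exact mul_le_mul_of_nonneg_right (h n hn) (norm_nonneg _)
    refine
      { m_nonneg := by linarith
        L_nonneg := by linarith
        per := fun x => by
          have := periodic_coe_comp (P p0) x
          simp only [this]
        per₁ := periodic_coe_comp _
        per₂ := periodic_coe_comp _
        per₃ := periodic_coe_comp _
        perU := periodic_coe_comp _
        perU₁ := periodic_coe_comp _
        perF := periodic_coe_comp _
        der := fun x => (derP (fun n => rfl) x).sub_const _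
        der₁ := derP fun n => rfl
        der₂ := derP fun n => rfl
        derU₁ := derP fun n => rfl
        cont₃ := continuous_coe_comp _
        contU := continuous_coe_comp _
        contU₂ := continuous_coe_comp _
        contF := continuous_coe_comp _
        eqn := fun x => ?_
        U_le := ?_
        Ψ₂_le := ?_
        v₁_le := ?_
        energy := ?_ }
    · rw [eV x]
      have h1 : P p0 (x : Torus) = P pX (x : Torus) - 1 * P pU (x : Torus) :=
        linP 1 (fun n => by simp only [hp0, hpX, hpU]; ring) _
      have h2 : P (fun _ => 1) (x : Torus)
          = (l : ℂ) ^ 2 * P pU (x : Torus) - P pU₂ (x : Torus) := by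
        have h3 : P pU₂ (x : Torus)
            = P (fun n => (l : ℂ) ^ 2 * pU n) (x : Torus) - 1 * P (fun _ => 1) (x : Torus) := by
          refine linP 1 (fun n => ?_) _
          have := hN0 n
          simp only [hpU, hpU₂]
          field_simp
          rw [hNe]
          linear_combination ((n : ℂ) ^ 2) * Complex.I_sq
        have h4 : P (fun n => (l : ℂ) ^ 2 * pU n) (x : Torus)
            = P (fun _ => 0) (x : Torus) - (-(l : ℂ) ^ 2) * P pU (x : Torus) :=
          linP _ (fun n => by ring) _
        have h5 : P (fun _ => 0) (x : Torus) = 0 := by simp [hP, trigPoly_apply]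
        rw [h3, h4, h5]
        ring
      have hμ' : (μ : ℂ) ≠ 0 := Complex.ofReal_ne_zero.2 hμ
      have hsin : sinC (x : Torus) = ((Real.sin x : ℝ) : ℂ) := rfl
      have hFx : F (x : Torus) = z * P pU (x : Torus) - (Complex.I * α * l)
          * (((Real.sin x : ℝ) : ℂ) * P pX (x : Torus) - a) - P (fun _ => 1) (x : Torus) := by
        rw [hF, ← hsin]
        simp
      rw [hFx, h1, h2, hz]
      push_cast
      field_simp
      ring
    · rw [eV']
      refine comp 2 two_pos.le fun n hn => ?_
      obtain ⟨h1, h2⟩ := inv_symb_bounds hl hn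
      rw [hpU', hpX', abs_of_nonneg (by nlinarith)]
      nlinarith
    · rw [eV']
      refine comp 2 two_pos.le fun n hn => ?_
      obtain ⟨h1, h2⟩ := inv_symb_bounds hl hn
      rw [hp2', hpX', abs_of_nonneg (by nlinarith)]
      have h3 : ((n : ℝ) ^ 2 + (l : ℝ) ^ 2) * (symb l n)⁻¹ = 1 :=
        mul_inv_cancel₀ (symb_pos hl n).ne'
      have h4 : (n : ℝ) ^ 2 * (symb l n)⁻¹ ≤ 1 - (symb l n)⁻¹ := by nlinarith
      have h5 := mul_le_mul_of_nonneg_right h4 h1.le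
      nlinarith
    · rw [eV₁]
      refine (comp (q := pU₁) 1 zero_le_one fun n hn => ?_).trans_eq (one_mul _)
      obtain ⟨h1, h2⟩ := inv_symb_bounds hl hn
      rw [one_mul, hpU₁, norm_mul, norm_mul _ (N n)⁻¹]
      refine mul_le_mul_of_nonneg_left ?_ (norm_nonneg _)
      change ‖pX n‖ ≤ ‖pU n‖
      rw [hpU', hpX', abs_of_nonneg (by nlinarith)]
      nlinarith
    · have h1 : ‖toL2 (P pU₁)‖ ^ 2 + (l : ℝ) ^ 2 * ‖toL2 (P pU)‖ ^ 2
          = (inner ℂ (opG hl g) (g : L2T)).re := by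
        have h2 := Complex.hasSum_re (hasSum_inner_fc (fc_opG_eq hl g) (fc_self_eq (g : L2T)))
        simp only [Complex.ofReal_re] at h2
        refine HasSum.unique ?_ h2
        refine ((hasSum_norm_fc_sq _).add ((hasSum_norm_fc_sq _).mul_left _)).congr_fun fun n => ?_
        rw [fcP, fcP, norm_mul, norm_mul (pU n), hpU₁', hpU']
        have h3 : ((n : ℝ) ^ 2 + (l : ℝ) ^ 2) * (symb l n)⁻¹ = 1 :=
          mul_inv_cancel₀ (symb_pos hl n).ne'
        simp only [mul_pow, sq_abs]
        linear_combination (-(symb l n)⁻¹ * ‖fc (g : L2T) n‖ ^ 2) * h3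
      have h2 := energy_le hl g α (z := z) (by rw [hz]; simp)
      rw [cnrm_coe_comp, cnrm_coe_comp, cnrm_coe_comp, eF, mul_pow, mul_pow]
      have h3 : √(2 * Real.pi) ^ 2 * (‖toL2 (P pU₁)‖ ^ 2 + (l : ℝ) ^ 2 * ‖toL2 (P pU)‖ ^ 2)
          ≤ √(2 * Real.pi) ^ 2 * (2 * (‖opT α hl z g - g‖ * ‖toL2 (P pU)‖)) := by
        rw [h1, eU]
        exact mul_le_mul_of_nonneg_left h2 (sq_nonneg _)
      have h4 : ‖((opT α hl z g - g : spaceY l) : L2T)‖ = ‖opT α hl z g - g‖ := rfl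
      rw [h4]
      linarith
  · rw [cnrm_coe_comp, eU, norm_opGY]
  · rw [cnrm_coe_comp, eF]
    rfl

/-! ### The resolvent estimates -/

variable {l : ℤ}

/-- It suffices to prove an a priori estimate for trigonometric polynomials. -/
lemma norm_opGY_le_of_trigPoly (α : ℝ) (hl : l ≠ 0) (z : ℂ) {M : ℝ}
    (h : ∀ (g : spaceY l) (s : Finset ℤ), (∀ n ∉ s, fc (g : L2T) n = 0) →
      ‖opGY hl g‖ ≤ M * ‖opT α hl z g - g‖) (g : spaceY l) :
    ‖opGY hl g‖ ≤ M * ‖opT α hl z g - g‖ := by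
  have hlim : Filter.Tendsto (fun s : Finset ℤ => projQ l (∑ n ∈ s, fc (g : L2T) n • eT n))
      Filter.atTop (nhds g) := by
    have := ((projQ l).continuous.tendsto (g : L2T)).comp (hasSum_fc (g : L2T))
    rwa [projQ_coe] at this
  have c1 : Continuous fun g : spaceY l => ‖opGY hl g‖ := by fun_prop
  have c2 : Continuous fun g : spaceY l => M * ‖opT α hl z g - g‖ := by fun_prop
  refine le_of_tendsto_of_tendsto ((c1.tendsto g).comp hlim) ((c2.tendsto g).comp hlim)
    (Filter.Eventually.of_forall fun s => h _ s fun n hn => ?_)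
  rw [projQ_of_mem (mem_spaceY_iff.2 fun h1 => ?_), fc_sum_smul_eT, if_neg hn]
  rw [fc_sum_smul_eT, mem_spaceY_iff.1 g.2 h1, ite_self]

lemma rpow_half_facts {b : ℝ} (hb : 0 < b) :
    0 < 1 / b ^ (1 / 2 : ℝ) ∧ b * (1 / b ^ (1 / 2 : ℝ)) ^ 2 = 1 := by
  have h : (b ^ (1 / 2 : ℝ)) ^ 2 = b := by
    rw [← Real.rpow_natCast, ← Real.rpow_mul hb.le]
    norm_num
  have hp : 0 < b ^ (1 / 2 : ℝ) := Real.rpow_pos_of_pos hb _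
  refine ⟨by positivity, ?_⟩
  rw [div_pow, h]
  field_simp

/-- The length scales of the critical layer. -/
lemma exists_layerScale {b μ η : ℝ} (hη : 0 < η) (hη1 : η ≤ 1) (hb : 1 / η ^ 4 ≤ b) (hμ : 0 < μ)
    (hμ1 : μ ≤ 1 + 1 / b ^ (1 / 2 : ℝ)) :
    ∃ δ κ d, LayerScale μ δ κ d ∧ b * (κ * d ^ 2) = 1 ∧ d ≤ η ∧ d ^ 2 ≤ 1 / b ^ (1 / 2 : ℝ) ∧
      (μ ≤ 1 - 1 / b ^ (1 / 2 : ℝ) →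
        d ^ 2 = 1 / (b ^ (2 / 3 : ℝ) * (1 - μ) ^ (1 / 3 : ℝ))) := by
  have hb1 : 1 ≤ b := le_trans (by
    rw [le_div_iff₀ (by positivity), one_mul]
    exact pow_le_one₀ hη.le hη1) hb
  have hb0 : 0 < b := by linarith
  obtain ⟨hε, hbε⟩ := rpow_half_facts hb0
  set ε := 1 / b ^ (1 / 2 : ℝ) with hεdef
  have hε1 : ε ≤ 1 := by nlinarith
  -- δ is the distance from μ to the top of the sine, cut off at b^{-1/2}. The width d solves b√δ d³
  -- = 1, which is bκd² = 1 for κ = d√δ. Under the cutoff d² = δ = κ; otherwise d² = b^{-2/3}(1 -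
  -- μ)^{-1/3}.
  set δ := max (1 - μ) ε with hδdef
  have hδε : ε ≤ δ := le_max_right _ _
  have hδ : 0 < δ := hε.trans_le hδε
  set d := (1 / (b * √δ)) ^ (1 / 3 : ℝ) with hd
  have hsq : √δ ^ 2 = δ := Real.sq_sqrt hδ.le
  have hsδ : 0 < √δ := Real.sqrt_pos.2 hδ
  have hd0 : 0 < d := Real.rpow_pos_of_pos (by positivity) _
  have hd3 : d ^ 3 = 1 / (b * √δ) := by
    rw [hd, ← Real.rpow_natCast, ← Real.rpow_mul (by positivity)]
    norm_num
  have hd3' : b * √δ * d ^ 3 = 1 := by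
    rw [hd3]
    field_simp
  have hd6 : b ^ 2 * δ * d ^ 6 = 1 := by
    rw [← hsq]
    calc b ^ 2 * √δ ^ 2 * d ^ 6 = (b * √δ * d ^ 3) ^ 2 := by ring
      _ = 1 := by rw [hd3', one_pow]
  have hε4 : b ^ 2 * ε ^ 4 = 1 := by
    calc b ^ 2 * ε ^ 4 = (b * ε ^ 2) ^ 2 := by ring
      _ = 1 := by rw [hbε, one_pow]
  have hd2ε : d ^ 2 ≤ ε := by
    refine le_of_pow_le_pow_left₀ three_ne_zero hε.le ?_
    refine le_of_mul_le_mul_left (a := b ^ 2 * ε) ?_ (by positivity)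
    calc b ^ 2 * ε * (d ^ 2) ^ 3 ≤ b ^ 2 * δ * (d ^ 2) ^ 3 := by gcongr
      _ = b ^ 2 * ε * ε ^ 3 := by
        rw [← pow_mul, hd6, ← hε4]
        ring
  refine ⟨δ, d * √δ, d, ?_, ?_, ?_, hd2ε, ?_⟩
  · refine ⟨hμ, hd0, by positivity, max_le (by linarith) hε1, hd2ε.trans hδε, ?_, ?_, ?_⟩
    · rw [mul_pow, hsq]
    · rw [abs_le]
      exact ⟨by linarith, le_max_left _ _⟩
    · rcases le_total (1 - μ) ε with h | h
      · right
        have hδe : δ = ε := max_eq_right h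
        have h1 : d ^ 2 = δ := by
          refine (pow_left_inj₀ (sq_nonneg _) hδ.le three_ne_zero).1 ?_
          refine mul_left_cancel₀ (a := b ^ 2 * δ) (by positivity) ?_
          rw [← pow_mul, hd6, hδe, ← hε4]
          ring
        have h2 : d = √δ := by rw [← h1, Real.sqrt_sq hd0.le]
        rw [h2, ← sq, hsq]
      · left
        exact max_eq_left h
  · rw [← hd3']
    ring
  -- d⁴ ≤ ε² = 1/b ≤ η⁴: this is where b must be large.
  · refine le_of_pow_le_pow_left₀ (n := 4) (by norm_num) hη.le ?_
    have h1 : (d ^ 2) ^ 2 ≤ ε ^ 2 := pow_le_pow_left₀ (sq_nonneg _) hd2ε 2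
    have h2 : 1 ≤ b * η ^ 4 := by rwa [div_le_iff₀ (by positivity)] at hb
    have h3 : b * ε ^ 2 ≤ b * η ^ 4 := by rw [hbε]; exact h2
    calc d ^ 4 = (d ^ 2) ^ 2 := by ring
      _ ≤ ε ^ 2 := h1
      _ ≤ η ^ 4 := le_of_mul_le_mul_left h3 hb0
  · intro h
    have hδe : δ = 1 - μ := max_eq_left (by linarith)
    have h0 : 0 < 1 - μ := by linarith
    have hp1 : 0 < b ^ (2 / 3 : ℝ) := Real.rpow_pos_of_pos hb0 _
    have hp2 : 0 < (1 - μ) ^ (1 / 3 : ℝ) := Real.rpow_pos_of_pos h0 _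
    have e1 : (b ^ (2 / 3 : ℝ)) ^ 3 = b ^ 2 := by
      rw [← Real.rpow_natCast, ← Real.rpow_mul hb0.le, ← Real.rpow_natCast]
      norm_num
    have e2 : ((1 - μ) ^ (1 / 3 : ℝ)) ^ 3 = 1 - μ := by
      rw [← Real.rpow_natCast, ← Real.rpow_mul h0.le]
      norm_num
    refine (pow_left_inj₀ (sq_nonneg _) (by positivity) three_ne_zero).1 ?_
    rw [div_pow, mul_pow, e1, e2, one_pow, eq_div_iff (by positivity), ← pow_mul, ← hδe, ← hd6]
    ring

/-- The a priori estimates in and near the range of the shear. -/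
lemma exists_resolvent_estimate_of_ne_zero : ∃ C α₀ : ℝ, 0 < C ∧ 2 ≤ α₀ ∧ ∀ (α : ℝ) (l : ℤ)
    (hl : l ≠ 0), α₀ ≤ |α * l| → ∀ (μ : ℝ) (g : spaceY l), μ ≠ 0 →
      (|μ| ≤ 1 + 1 / |α * l| ^ (1 / 2 : ℝ) → ‖opGY hl g‖ ≤ C / |α * l| ^ (1 / 2 : ℝ)
        * ‖opT α hl (Complex.I * (α * l * μ : ℝ)) g - g‖) ∧
      (|μ| ≤ 1 - 1 / |α * l| ^ (1 / 2 : ℝ) →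
        ‖opGY hl g‖ ≤ C / (|α * l| ^ (2 / 3 : ℝ) * (1 - |μ|) ^ (1 / 3 : ℝ))
          * ‖opT α hl (Complex.I * (α * l * μ : ℝ)) g - g‖) := by
  obtain ⟨η, hη, hη1, H⟩ := exists_vorticity_bound
  have hη4 : 1 ≤ 1 / η ^ 4 := by
    rw [le_div_iff₀ (by positivity), one_mul]
    exact pow_le_one₀ hη.le hη1
  refine ⟨4 / η ^ 2, 2 / η ^ 4, by positivity, ?_, ?_⟩
  · rw [show 2 / η ^ 4 = 2 * (1 / η ^ 4) by ring]
    linarith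
  intro α l hl hα μ g hμ
  have hb : 1 / η ^ 4 ≤ |α * l| :=
    le_trans (div_le_div_of_nonneg_right one_le_two (by positivity)) hα
  have hb0 : 0 < |α * l| := by linarith
  have key : |μ| ≤ 1 + 1 / |α * l| ^ (1 / 2 : ℝ) → ∃ d : ℝ,
      d ^ 2 ≤ 1 / |α * l| ^ (1 / 2 : ℝ) ∧ (|μ| ≤ 1 - 1 / |α * l| ^ (1 / 2 : ℝ) →
        d ^ 2 = 1 / (|α * l| ^ (2 / 3 : ℝ) * (1 - |μ|) ^ (1 / 3 : ℝ))) ∧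
      ‖opGY hl g‖ ≤ 4 / η ^ 2 * d ^ 2 * ‖opT α hl (Complex.I * (α * l * μ : ℝ)) g - g‖ := by
    intro h
    obtain ⟨δ, κ, d, hs, hβ, hdη, hd1, hd2⟩ := exists_layerScale hη hη1 hb (abs_pos.2 hμ) h
    refine ⟨d, hd1, hd2, norm_opGY_le_of_trigPoly α hl _ (fun g s hgs => ?_) g⟩
    obtain ⟨Ψ, Ψ₁, Ψ₂, Ψ₃, U, U₁, U₂, F, hsol, hU, hF⟩ := exists_vorticitySol α hl hμ g hgs
    have h1 := H hμ hs hdη hβ hsol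
    rw [hU, hF] at h1
    have hpi : 0 < √(2 * Real.pi) := Real.sqrt_pos.2 Real.two_pi_pos
    have h2 : η ^ 2 / 4 * ‖opGY hl g‖
        ≤ ‖opT α hl (Complex.I * (α * l * μ : ℝ)) g - g‖ * d ^ 2 := by
      refine le_of_mul_le_mul_left ?_ hpi
      linarith
    have h3 := mul_le_mul_of_nonneg_left h2 (show 0 ≤ 4 / η ^ 2 by positivity)
    have h4 : 4 / η ^ 2 * (η ^ 2 / 4 * ‖opGY hl g‖) = ‖opGY hl g‖ := by
      field_simp
    rw [h4] at h3
    linarith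
  have hε := (rpow_half_facts hb0).1
  refine ⟨fun h => ?_, fun h => ?_⟩
  · obtain ⟨d, hd1, -, hd3⟩ := key h
    refine hd3.trans (mul_le_mul_of_nonneg_right ?_ (norm_nonneg _))
    rw [← mul_one_div _ (|α * l| ^ (1 / 2 : ℝ))]
    exact mul_le_mul_of_nonneg_left hd1 (by positivity)
  · obtain ⟨d, -, hd2, hd3⟩ := key (by linarith)
    rwa [hd2 h, mul_one_div] at hd3

/-- Adds μ = 0 and extends the bound b^{-1/2} to every real μ; above 1 + b^{-1/2} it is weaker than
the exterior bound. The spectral estimate needs this uniform version. -/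
lemma exists_resolvent_estimate : ∃ C α₀ : ℝ, 2 ≤ C ∧ 2 ≤ α₀ ∧ ∀ (α : ℝ) (l : ℤ)
    (hl : l ≠ 0), α₀ ≤ |α * l| → ∀ (μ : ℝ) (g : spaceY l),
      (1 < |μ| → ‖opGY hl g‖ ≤ C / (|α * l| * (|μ| - 1))
        * ‖opT α hl (Complex.I * (α * l * μ : ℝ)) g - g‖) ∧
      ‖opGY hl g‖ ≤ C / |α * l| ^ (1 / 2 : ℝ)
        * ‖opT α hl (Complex.I * (α * l * μ : ℝ)) g - g‖ ∧
      (|μ| ≤ 1 - 1 / |α * l| ^ (1 / 2 : ℝ) →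
        ‖opGY hl g‖ ≤ C / (|α * l| ^ (2 / 3 : ℝ) * (1 - |μ|) ^ (1 / 3 : ℝ))
          * ‖opT α hl (Complex.I * (α * l * μ : ℝ)) g - g‖) := by
  obtain ⟨C, α₀, hC, hα₀, H⟩ := exists_resolvent_estimate_of_ne_zero
  refine ⟨max C 2, α₀, le_max_right _ _, hα₀, fun α l hl hα μ g => ?_⟩
  have hb0 : 0 < |α * l| := by linarith
  have hβ : α * l ≠ 0 := abs_pos.1 hb0
  obtain ⟨hε, hbε⟩ := rpow_half_facts hb0
  set ε := 1 / |α * l| ^ (1 / 2 : ℝ) with hεdef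
  have hε1 : ε < 1 := by nlinarith
  have out : 1 < |μ| → ‖opGY hl g‖ ≤ max C 2 / (|α * l| * (|μ| - 1))
        * ‖opT α hl (Complex.I * (α * l * μ : ℝ)) g - g‖ := fun h => by
    refine (norm_opGY_le_of_one_lt hl g α h hβ rfl).trans
      (mul_le_mul_of_nonneg_right ?_ (norm_nonneg _))
    exact div_le_div_of_nonneg_right (le_max_right _ _)
      (mul_nonneg hb0.le (by linarith))
  -- For fixed g both sides are continuous in μ at 0, so the estimates for ν ≠ 0 pass to the limit
  -- with the same constants, although a/ν may blow up.
  have zero : μ = 0 → ∀ Q : ℝ → ℝ, ContinuousAt Q 0 → (∀ ν, ν ≠ 0 → |ν| ≤ 1 - ε →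
      ‖opGY hl g‖ ≤ Q ν * ‖opT α hl (Complex.I * (α * l * ν : ℝ)) g - g‖) →
      ‖opGY hl g‖ ≤ Q μ * ‖opT α hl (Complex.I * (α * l * μ : ℝ)) g - g‖ := by
    rintro rfl Q hQ h
    have hc : ContinuousAt (fun ν : ℝ =>
        Q ν * ‖opT α hl (Complex.I * (α * l * ν : ℝ)) g - g‖) 0 := by
      refine hQ.mul (Continuous.continuousAt ?_)
      simp only [opT_apply]
      fun_prop
    refine ge_of_tendsto (hc.tendsto.mono_left (nhdsWithin_le_nhds (s := {0}ᶜ))) ?_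
    have hev : ∀ᶠ ν : ℝ in nhds 0, |ν| < 1 - ε :=
      (continuous_abs.tendsto' 0 0 abs_zero).eventually (gt_mem_nhds (by linarith))
    filter_upwards [self_mem_nhdsWithin, hev.filter_mono nhdsWithin_le_nhds] with ν h1 h2
    exact h ν h1 h2.le
  refine ⟨out, ?_, fun h => ?_⟩
  · by_cases hμ : μ = 0
    · refine zero hμ (fun _ => max C 2 / |α * l| ^ (1 / 2 : ℝ)) continuousAt_const fun ν h1 h2 => ?_
      refine ((H α l hl hα ν g h1).1 (by linarith)).trans
        (mul_le_mul_of_nonneg_right ?_ (norm_nonneg _))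
      exact div_le_div_of_nonneg_right (le_max_left _ _) (by positivity)
    · rcases le_or_gt |μ| (1 + ε) with h | h
      · refine ((H α l hl hα μ g hμ).1 h).trans
          (mul_le_mul_of_nonneg_right ?_ (norm_nonneg _))
        exact div_le_div_of_nonneg_right (le_max_left _ _) (by positivity)
      · refine (out (by linarith)).trans (mul_le_mul_of_nonneg_right ?_ (norm_nonneg _))
        rw [← mul_one_div _ (|α * l| ^ (1 / 2 : ℝ)), ← hεdef, div_le_iff₀
          (mul_pos hb0 (by linarith))]
        have h1 : 1 ≤ ε * (|α * l| * (|μ| - 1)) := by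
          have : |α * l| * ε * ε ≤ |α * l| * ε * (|μ| - 1) :=
            mul_le_mul_of_nonneg_left (by linarith) (by positivity)
          linarith
        have h2 : 0 ≤ max C 2 := by positivity
        nlinarith
  · have hmono : ∀ ν : ℝ, |ν| ≤ 1 - ε →
        C / (|α * l| ^ (2 / 3 : ℝ) * (1 - |ν|) ^ (1 / 3 : ℝ))
          ≤ max C 2 / (|α * l| ^ (2 / 3 : ℝ) * (1 - |ν|) ^ (1 / 3 : ℝ)) := fun ν hν =>
      div_le_div_of_nonneg_right (le_max_left _ _)
        (mul_nonneg (by positivity) (Real.rpow_nonneg (by linarith) _))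
    by_cases hμ : μ = 0
    · refine zero hμ (fun ν => max C 2 / (|α * l| ^ (2 / 3 : ℝ) * (1 - |ν|) ^ (1 / 3 : ℝ))) ?_
        fun ν h1 h2 => ((H α l hl hα ν g h1).2 h2).trans
          (mul_le_mul_of_nonneg_right (hmono ν h2) (norm_nonneg _))
      refine ContinuousAt.div continuousAt_const (ContinuousAt.mul continuousAt_const ?_) ?_
      · refine ContinuousAt.rpow_const (by fun_prop) (Or.inl (by norm_num))
      · rw [abs_zero, sub_zero, Real.one_rpow, mul_one]
        exact (Real.rpow_pos_of_pos hb0 _).ne'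
    · exact ((H α l hl hα μ g hμ).2 h).trans
        (mul_le_mul_of_nonneg_right (hmono μ h) (norm_nonneg _))

/-- The a priori estimate in a strip to the right of the imaginary axis. -/
lemma norm_opGY_le_of_re_le (α : ℝ) (hl : l ≠ 0) (g : spaceY l) {M lam : ℝ} {z : ℂ}
    (hM : 0 < M) (him : z.im = lam) (h0 : 0 ≤ z.re) (hz : M * z.re ≤ 1 / 2)
    (h : ‖opGY hl g‖ ≤ M * ‖opT α hl (Complex.I * lam) g - g‖) :
    ‖opGY hl g‖ ≤ 2 * M * ‖opT α hl z g - g‖ := by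
  -- Moving z horizontally by Re z changes T g - g by Re z · G g. As M Re z ≤ 1/2, at most half of
  -- ‖G g‖ has to be absorbed, which doubles the constant.
  have h1 : opT α hl (Complex.I * lam) g - g = (opT α hl z g - g) - (z.re : ℂ) • opGY hl g := by
    have hz' : z = (z.re : ℂ) + Complex.I * lam := by
      rw [← him, mul_comm]
      exact (Complex.re_add_im z).symm
    rw [opT_apply, opT_apply]
    conv_rhs => rw [hz']
    rw [add_smul]
    simp only [Complex.add_re, Complex.ofReal_re, Complex.mul_re, Complex.I_re, Complex.I_im,
      Complex.ofReal_im, zero_mul, mul_zero, sub_zero, add_zero]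
    abel
  have h2 : ‖opT α hl (Complex.I * lam) g - g‖ ≤ ‖opT α hl z g - g‖ + z.re * ‖opGY hl g‖ := by
    rw [h1]
    refine (norm_sub_le _ _).trans_eq ?_
    rw [norm_smul, Complex.norm_real, Real.norm_of_nonneg h0]
  have h3 := mul_le_mul_of_nonneg_left h2 hM.le
  have h4 := mul_le_mul_of_nonneg_right hz (norm_nonneg (opGY hl g))
  nlinarith

end Kolmogorov

end

/-! ### The spectrum and the resolvent -/

theorem mainTheorem1 :
    ∃ c C α₀ : ℝ, 0 < c ∧ 0 < C ∧ 0 < α₀ ∧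
      ∀ α : ℝ, α₀ ≤ |α| → ∀ l : ℤ, l ≠ 0 →
        (∀ ζ ∈ Kolmogorov.opSpectrum (Kolmogorov.opQL α l),
          ζ.re ≤ -c * |α * l| ^ (1 / 2 : ℝ)) ∧
        ∀ lam μ : ℝ, μ = lam / (α * l) →
          ∃ R : Kolmogorov.spaceY l →L[ℂ] Kolmogorov.spaceY l,
            Kolmogorov.IsBoundedInverse
              (Kolmogorov.shift (Complex.I * lam) (Kolmogorov.opQL α l)) R ∧
            (1 + 1 / |α * l| ^ (1 / 2 : ℝ) < |μ| →
              ‖R‖ ≤ C / (|α * l| * (|μ| - 1))) ∧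
            (1 - 1 / |α * l| ^ (1 / 2 : ℝ) < |μ| → |μ| ≤ 1 + 1 / |α * l| ^ (1 / 2 : ℝ) →
              ‖R‖ ≤ C / |α * l| ^ (1 / 2 : ℝ)) ∧
            (|μ| ≤ 1 - 1 / |α * l| ^ (1 / 2 : ℝ) →
              ‖R‖ ≤ C / (|α * l| ^ (2 / 3 : ℝ) * (1 - |μ|) ^ (1 / 3 : ℝ))) := by
  obtain ⟨C, α₀, hC, hα₀, H⟩ := Kolmogorov.exists_resolvent_estimate
  -- c = 1/(2C) is what the absorption in `norm_opGY_le_of_re_le` allows with M = C b^{-1/2}.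
  -- Largeness of |α| suffices for all l at once, because |l| ≥ 1.
  refine ⟨1 / (2 * C), C, α₀, by positivity, by linarith, by linarith, fun α hα l hl => ?_⟩
  have hβα : α₀ ≤ |α * l| := by
    have h1 : (1 : ℝ) ≤ |(l : ℝ)| := by exact_mod_cast Int.one_le_abs hl
    rw [abs_mul]
    nlinarith [abs_nonneg α]
  have hb0 : 0 < |α * l| := by linarith
  have hβ : α * l ≠ 0 := abs_pos.1 hb0
  have hbp : 0 < |α * l| ^ (1 / 2 : ℝ) := Real.rpow_pos_of_pos hb0 _
  have hz : ∀ lam : ℝ, α * l * (lam / (α * l)) = lam := fun lam => mul_div_cancel₀ lam hβ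
  refine ⟨fun ζ hζ => ?_, fun lam μ hμ => ?_⟩
  · by_contra! hlt
    refine hζ ?_
    suffices h : ∃ M : ℝ, ∀ g : Kolmogorov.spaceY l, ‖Kolmogorov.opGY hl g‖
        ≤ M * ‖Kolmogorov.opT α hl (-ζ) g - g‖ by
      obtain ⟨M, hM⟩ := h
      obtain ⟨R, hR, -⟩ := Kolmogorov.exists_isBoundedInverse α hl (-ζ) hM
      exact ⟨-R, hR.neg⟩
    -- With z = -ζ, the case Re ζ ≥ 0 is dissipative; otherwise 0 < Re z < c b^{1/2}, and the bound
    -- on the imaginary axis is perturbed.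
    rcases le_or_gt 0 ζ.re with h0 | h0
    · exact ⟨1, fun g => Kolmogorov.norm_opGY_le_of_re_nonpos hl g α (by simpa using h0)⟩
    · refine ⟨2 * (C / |α * l| ^ (1 / 2 : ℝ)), fun g => ?_⟩
      have hg := (H α l hl hβα ((-ζ).im / (α * l)) g).2.1
      rw [hz] at hg
      refine Kolmogorov.norm_opGY_le_of_re_le α hl g (by positivity) rfl
        (by rw [Complex.neg_re]; linarith) ?_ hg
      rw [Complex.neg_re, div_mul_eq_mul_div, div_le_iff₀ hbp]
      have h1 : C * -ζ.re ≤ C * (1 / (2 * C) * |α * l| ^ (1 / 2 : ℝ)) :=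
        mul_le_mul_of_nonneg_left (by linarith) (by linarith)
      refine h1.trans_eq ?_
      field_simp
  · have hz' : α * l * μ = lam := by rw [hμ, hz]
    have H' := H α l hl hβα μ
    rw [hz'] at H'
    have inv : ∀ M : ℝ, 0 ≤ M → (∀ g : Kolmogorov.spaceY l, ‖Kolmogorov.opGY hl g‖
        ≤ M * ‖Kolmogorov.opT α hl (Complex.I * lam) g - g‖) →
        ∃ R : Kolmogorov.spaceY l →L[ℂ] Kolmogorov.spaceY l, Kolmogorov.IsBoundedInverse
          (Kolmogorov.shift (Complex.I * lam) (Kolmogorov.opQL α l)) R ∧ ‖R‖ ≤ M := by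
      intro M hM h
      obtain ⟨R, hR, hn⟩ := Kolmogorov.exists_isBoundedInverse α hl _ h
      exact ⟨R, hR, R.opNorm_le_bound hM hn⟩
    have hε := (Kolmogorov.rpow_half_facts hb0).1
    rcases le_or_gt |μ| (1 - 1 / |α * l| ^ (1 / 2 : ℝ)) with h1 | h1
    · obtain ⟨R, hR, hn⟩ := inv _ (div_nonneg (by linarith) (mul_nonneg (by positivity)
        (Real.rpow_nonneg (by linarith) _))) fun g => (H' g).2.2 h1
      exact ⟨R, hR, fun h => absurd h (by linarith), fun h => absurd h (by linarith), fun _ => hn⟩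
    · rcases le_or_gt |μ| (1 + 1 / |α * l| ^ (1 / 2 : ℝ)) with h2 | h2
      · obtain ⟨R, hR, hn⟩ := inv _ (by positivity) fun g => (H' g).2.1
        exact ⟨R, hR, fun h => absurd h (by linarith), fun _ _ => hn,
          fun h => absurd h (by linarith)⟩
      · obtain ⟨R, hR, hn⟩ := inv _ (div_nonneg (by linarith) (mul_nonneg hb0.le (by linarith)))
          fun g => (H' g).1 (by linarith)
        exact ⟨R, hR, fun _ => hn, fun _ h => absurd h (by linarith),
          fun h => absurd h (by linarith)⟩
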